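/- **Setting.** Let $d\ge 1$, let $\Theta^\star\in\mathbb{R}^{d\times d}$ satisfy $\operatorname{rank}(\Theta^\star)\le r$ and $\|\Theta^\star\|_\infty\le\alpha$, where $\|\cdot\|_\infty$ is the largest absolute value of an entry. Write $\|\cdot\|_F$ for the Frobenius norm, $\|\cdot\|_{nu}$ for the nuclear norm (the sum of the singular values) and $\langle A,B\rangle=\operatorname{tr}(A^\top B)$. Let $\sigma\ge0$ and $\Delta\ge 0$ with $\sigma+\Delta>0$. For $k=1,\dots,n$ one has $$y_k=\langle X_k,\Theta^\star\rangle+\epsilon_k,\qquad \dot y_k=\mathcal{Q}_\Delta(y_k+\tau_k),$$ where $\mathcal{Q}_\Delta(a)=\Delta\big(\lfloor a/\Delta\rfloor+\tfrac12\big)$ for $\Delta>0$ and $\mathcal{Q}_0(a)=a$. Here $X_k=e_{i(k)}e_{j(k)}^\top$ with $(i(k),j(k))$ uniform on $\{1,\dots,d\}^2$; the noise variables $\epsilon_k$ are identically distributed with $\mathbb{E}\,\epsilon_k=0$ and $\|\epsilon_k\|_{\psi_1}:=\inf\{t>0:\mathbb{E}\exp(|\epsilon_k|/t)\le2\}\le\sigma$;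 the dithers $\tau_k$ are uniform on $[-\frac\Delta2,\frac\Delta2]$ (equal to $0$ if $\Delta=0$); for each $k$ the variables $X_k,\epsilon_k,\tau_k$ are independent, and the triples $(X_k,\epsilon_k,\tau_k)$, $k=1,\dots,n$, are independent. Given $\lambda$, let $\widehat\Theta$ be any solution of $$\widehat\Theta\in\arg\min_{\|\Theta\|_\infty\le\alpha}\ \frac1{2n}\sum_{k=1}^n\big(\dot y_k-\langle X_k,\Theta\rangle\big)^2+\lambda\|\Theta\|_{nu}.$$ **Theorem.** For every $\delta_0>0$ there is $C_0>0$, depending only on $\delta_0$, such that for every $C_1\ge C_0$ and all $c,K>0$ there are $C_2,C_3>0$, depending only on $\delta_0,C_1,c,K$, with the following property. In the setting above, let $\delta\ge\delta_0$, suppose that $$c\,d\log^3 d\ \le\ n\ \le\ K\,r^2d^2\log d,$$ and put $\lambda=C_1(\sigma+\Delta)\sqrt{\frac{\delta\log d}{nd}}$ and $\mathscr{L}=\alpha+\sigma+\Delta$. Then there is an event of probability at least $1-4d^{-\delta}$ on which every minimizer $\widehat\Theta$ as above satisfies, with $\widehat{\mathbf\Delta}:=\widehat\Theta-\Theta^\star$,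 $$\frac{\|\widehat{\mathbf\Delta}\|_F}{d}\le C_2\,\mathscr{L}\sqrt{\frac{\delta rd\log d}{n}}\qquad\text{and}\qquad\frac{\|\widehat{\mathbf\Delta}\|_{nu}}{d}\le C_3\,\mathscr{L}\,r\sqrt{\frac{\delta d\log d}{n}}.$$ -/

import Mathlib

open MeasureTheory ProbabilityTheory Set
open scoped ENNReal

noncomputable section

namespace QMC

/-- Frobenius norm. -/
def frobNorm {d : ℕ} (A : Matrix (Fin d) (Fin d) ℝ) : ℝ :=
  √(∑ i, ∑ j, A i j ^ 2)

/-- Max norm: the largest absolute value of an entry. -/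
def maxNorm {d : ℕ} (A : Matrix (Fin d) (Fin d) ℝ) : ℝ :=
  ⨆ p : Fin d × Fin d, |A p.1 p.2|

/-- Nuclear norm: the sum of the singular values of `A`, viewed as a map of Euclidean space. -/
def nuclearNorm {d : ℕ} (A : Matrix (Fin d) (Fin d) ℝ) : ℝ :=
  ∑ i : Fin d, (Matrix.toEuclideanLin A).singularValues i

/-- The trace inner product of matrices. -/
def matInner {d : ℕ} (A B : Matrix (Fin d) (Fin d) ℝ) : ℝ :=
  (A.transpose * B).trace

/-- The sub-exponential norm `inf {t > 0 : E exp (|Z| / t) ≤ 2}`, which is `∞` if there is no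
such `t`. -/
def psi1Norm {Ω : Type*} [MeasurableSpace Ω] (μ : Measure Ω) (Z : Ω → ℝ) : ℝ≥0∞ :=
  ⨅ (t : ℝ) (_ : 0 < t ∧ ∫⁻ ω, ENNReal.ofReal (Real.exp (|Z ω| / t)) ∂μ ≤ 2), ENNReal.ofReal t

/-- The uniform quantizer of resolution `Δ`; resolution `0` means no quantization. -/
def quantize (Δ a : ℝ) : ℝ :=
  if Δ = 0 then a else Δ * ((⌊a / Δ⌋ : ℝ) + 1 / 2)

/-- The law of the dither: uniform on `[-Δ/2, Δ/2]`, that is, the point mass at `0` if `Δ = 0`. -/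
def uniformDither (Δ : ℝ) : Measure ℝ :=
  if Δ = 0 then Measure.dirac 0 else ProbabilityTheory.cond volume (Icc (-(Δ / 2)) (Δ / 2))

/-- The design matrix `e_i e_jᵀ` attached to a position `(i, j)`. -/
def design {d : ℕ} (p : Fin d × Fin d) : Matrix (Fin d) (Fin d) ℝ :=
  Matrix.single p.1 p.2 1

/-- The dithered and quantized observation of the entry of `Θ` at position `p`, with noise `e`
and dither `t`. -/
def quantizedObs {d : ℕ} (Δ : ℝ) (Θ : Matrix (Fin d) (Fin d) ℝ) (p : Fin d × Fin d)
    (e t : ℝ) : ℝ :=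
  quantize Δ ((matInner (design p) Θ + e) + t)

/-- The randomness of the model: positions `J k` that are uniform on `[d] × [d]`, noise `ε k` that
is identically distributed with mean zero and sub-exponential norm at most `σ`, and dither `τ k`.
The position, the noise and the dither of one sample are independent, and the `n` samples are
independent of each other. -/
structure IsModel {Ω : Type*} [MeasurableSpace Ω] (μ : Measure Ω) {d n : ℕ} (σ Δ : ℝ)
    (J : Fin n → Ω → Fin d × Fin d) (ε τ : Fin n → Ω → ℝ) : Prop where
  position_law : ∀ k, HasLaw (J k) (uniformOn univ) μ
  noise_identDistrib : ∀ k l, IdentDistrib (ε k) (ε l) μ μ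
  noise_mean : ∀ k, ∫ ω, ε k ω ∂μ = 0
  noise_psi1 : ∀ k, psi1Norm μ (ε k) ≤ ENNReal.ofReal σ
  dither_law : ∀ k, HasLaw (τ k) (uniformDither Δ) μ
  indep_position_noise : ∀ k, IndepFun (J k) (ε k) μ
  indep_dither : ∀ k, IndepFun (fun ω => (J k ω, ε k ω)) (τ k) μ
  indep_samples : iIndepFun (fun k ω => (J k ω, ε k ω, τ k ω)) μ

/-- The regularized least squares objective, for positions `p k` and observations `y k`. -/
def objective {d n : ℕ} (lam : ℝ) (p : Fin n → Fin d × Fin d) (y : Fin n → ℝ)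
    (Θ : Matrix (Fin d) (Fin d) ℝ) : ℝ :=
  1 / (2 * (n : ℝ)) * ∑ k, (y k - matInner (design (p k)) Θ) ^ 2 + lam * nuclearNorm Θ

/-- `Θ` minimizes the objective over the max norm ball of radius `α`. -/
def IsEstimator {d n : ℕ} (α lam : ℝ) (p : Fin n → Fin d × Fin d) (y : Fin n → ℝ)
    (Θ : Matrix (Fin d) (Fin d) ℝ) : Prop :=
  maxNorm Θ ≤ α ∧ IsMinOn (objective lam p y) {M | maxNorm M ≤ α} Θ

end QMC

end

/-! Write `ξ_k` for the observation minus the entry it observes. Uniform dither makes the quantizer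
unbiased, so `ξ_k` has mean zero given the position, and `|ξ_k| ≤ |ε_k| + Δ` almost surely, so it is
sub-exponential at scale `σ + Δ`. With `D` the error matrix and `X_k` the design matrices, comparing
the objective at a minimizer and at the truth bounds half of `∑ D(J k)²` by `⟨∑ ξ_k X_k, D⟩ + nλ
(‖Θ‖_nu - ‖Θhat‖_nu)`. Put `X = √(δ d log d / n)`. Up to a factor depending on `δ₀`, there are two
regimes according to whether `n` exceeds `δ d log d`.

Large `n`. Three facts are combined. (1) The noise matrix has operator norm at most `nλ/2`
(`IsModel.measure_noise_le`). This is the matrix Laplace transform method: Golden–Thompson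
(`trace_exp_add_le`) peels off one sample at a time, and the single-sample bound uses mean zero
noise, exponential moments and the fact that `X Xᵀ` averages to `1/d`. (2) Decomposability of the
nuclear norm then puts `D` in a cone: its nuclear norm is `O(√r)` times its Frobenius norm, and `∑
D(J k)²` is at most `O(nλ√r)` times that Frobenius norm (`IsEstimator.error_cone`). (3) The sampled
quadratic form is bounded below uniformly over a class with bounded entries and bounded nuclear
norm. Symmetrization, contraction of the square, and duality reduce the deviation to a Rademacher
sum of design matrices, again controlled by a trace exponential (`sum_exp_iSup_frobNorm_sub_le`).
Since only finitely many position patterns exist, one bad witness per pattern suffices, so every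
supremum is over a finite family. Scaling `D` down to a critical radius replaces a peeling argument
(`frobNorm_le_of_not_convexityFails`).

Small `n`. Now `X` is bounded below. Since all entries of `D` are at most `2α`, the Frobenius claim
is immediate. For the nuclear norm, the comparison gives `nλ (‖Θhat‖_nu - ‖Θ‖_nu) ≤ 2α ∑ |ξ_k|`, and
a Chernoff bound controls the total absolute noise (`IsModel.measure_error_small_le`). -/

/-! ### Singular value decomposition -/

namespace QMC

open Matrix

/-- Singular value decomposition, over the positive singular values. -/
theorem exists_svd {d : ℕ} (A : Matrix (Fin d) (Fin d) ℝ) :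
    ∃ (s : Finset (Fin d)) (w : Fin d → ℝ) (u v : Fin d → Fin d → ℝ),
      (∀ i ∈ s, 0 < w i) ∧
      (∀ i ∈ s, ∀ j ∈ s, u i ⬝ᵥ u j = if i = j then 1 else 0) ∧
      (∀ i ∈ s, ∀ j ∈ s, v i ⬝ᵥ v j = if i = j then 1 else 0) ∧
      A = ∑ i ∈ s, w i • vecMulVec (u i) (v i) ∧
      nuclearNorm A = ∑ i ∈ s, w i ∧ s.card = A.rank := by
  classical
  set T := Matrix.toEuclideanLin A with hT
  have hn : Module.finrank ℝ (EuclideanSpace ℝ (Fin d)) = d := by simp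
  have hsym := T.isSymmetric_adjoint_comp_self
  set b := hsym.eigenvectorBasis hn with hb
  set w : Fin d → ℝ := fun i => T.singularValues i with hw
  set v : Fin d → Fin d → ℝ := fun i => WithLp.ofLp (b i) with hv
  set u : Fin d → Fin d → ℝ := fun i => (w i)⁻¹ • A *ᵥ v i with hu
  set s : Finset (Fin d) := Finset.univ.filter (fun i => 0 < w i) with hs
  have hvv : ∀ i j, v i ⬝ᵥ v j = if i = j then (1 : ℝ) else 0 := by
    intro i j
    have := (orthonormal_iff_ite.1 b.orthonormal) j i
    rw [EuclideanSpace.inner_eq_star_dotProduct] at this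
    simpa [hv, eq_comm] using this
  -- The right singular vectors are eigenvectors of `AᵀA`, so their images under `A` are orthogonal
  -- with lengths `w i`. Normalizing those images gives the left singular vectors.
  have hAA : ∀ i j, (A *ᵥ v i) ⬝ᵥ (A *ᵥ v j) = if i = j then w i ^ 2 else 0 := by
    intro i j
    have h1 : inner ℝ (T (b j)) (T (b i)) = (A *ᵥ v i) ⬝ᵥ (A *ᵥ v j) := by
      rw [EuclideanSpace.inner_eq_star_dotProduct]
      simp [hT, hv]
    have h2 : inner ℝ (T (b j)) (T (b i)) = inner ℝ (b j) ((T.adjoint ∘ₗ T) (b i)) := by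
      rw [LinearMap.comp_apply, LinearMap.adjoint_inner_right]
    rw [← h1, h2, hsym.apply_eigenvectorBasis hn i, ← T.sq_singularValues_fin hn i]
    have := (orthonormal_iff_ite.1 b.orthonormal) j i
    rw [inner_smul_right]
    simp only [← hb, this]
    by_cases h : i = j <;> simp [h, hw, eq_comm]
  refine ⟨s, w, u, v, ?_, ?_, fun i _ j _ => hvv i j, ?_, ?_, ?_⟩
  · intro i hi
    simpa [hs] using hi
  · intro i hi j hj
    have hi' : 0 < w i := by simpa [hs] using hi
    have hj' : 0 < w j := by simpa [hs] using hj
    simp only [hu, smul_dotProduct, dotProduct_smul, hAA]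
    by_cases h : i = j
    · subst h
      simp
      field_simp
    · simp [h]
  · apply Matrix.toEuclideanLin.injective
    refine b.toBasis.ext fun j => ?_
    rw [OrthonormalBasis.coe_toBasis]
    apply (WithLp.equiv 2 _).injective
    change A *ᵥ v j = (∑ i ∈ s, w i • vecMulVec (u i) (v i)) *ᵥ v j
    rw [Matrix.sum_mulVec]
    simp only [smul_mulVec, vecMulVec_mulVec, hvv]
    by_cases hj : j ∈ s
    · rw [Finset.sum_eq_single j]
      · have hj' : 0 < w j := by simpa [hs] using hj
        simp [hu, smul_smul, hj'.ne']
      · intro i _ hij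
        simp [hij]
      · intro h
        exact absurd hj h
    -- Off `s` the singular value vanishes, hence so does `A *ᵥ v j`, and dropping these indices
    -- loses nothing.
    · have hj0 : w j = 0 := by
        have := T.singularValues_nonneg j
        simp only [hs, Finset.mem_filter, Finset.mem_univ, true_and, not_lt] at hj
        exact le_antisymm hj this
      have h0 : A *ᵥ v j = 0 := by
        have := hAA j j
        rw [hj0] at this
        simpa using this
      rw [h0, Finset.sum_eq_zero]
      intro i hi
      have : i ≠ j := fun h => hj (h ▸ hi)
      simp [this]
  · rw [nuclearNorm, hs, Finset.sum_filter]
    refine Finset.sum_congr rfl fun i _ => ?_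
    have := T.singularValues_nonneg i
    split_ifs with h
    · rfl
    · exact le_antisymm (not_lt.1 h) this
  · have h1 := T.card_support_singularValues
    have h2 : A.rank = Module.finrank ℝ T.range := by
      rw [Matrix.rank_eq_finrank_range_toLin A (EuclideanSpace.basisFun (Fin d) ℝ).toBasis
        (EuclideanSpace.basisFun (Fin d) ℝ).toBasis, hT, Matrix.toEuclideanLin_eq_toLin_orthonormal]
    rw [h2, ← h1]
    refine Finset.card_bij (fun i _ => (i : ℕ)) ?_ ?_ ?_
    · intro i hi
      simp only [hs, Finset.mem_filter, Finset.mem_univ, true_and] at hi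
      exact Finsupp.mem_support_iff.2 hi.ne'
    · intro i _ j _ h
      exact Fin.ext h
    · intro m hm
      have hm0 : T.singularValues m ≠ 0 := Finsupp.mem_support_iff.1 hm
      have hmd : m < d := by
        by_contra h
        exact hm0 (T.singularValues_of_finrank_le (by rw [hn]; omega))
      refine ⟨⟨m, hmd⟩, ?_, rfl⟩
      simp only [hs, Finset.mem_filter, Finset.mem_univ, true_and]
      exact (T.singularValues_pos_iff_ne_zero m).2 hm0

end QMC

/-! ### Nuclear norm and duality -/

namespace QMC

open Matrix

/-- The operator norm bound `‖A‖ ≤ t`, stated through the bilinear form of `A`. -/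
def OpLe {m : Type*} [Fintype m] (A : Matrix m m ℝ) (t : ℝ) : Prop :=
  ∀ x y : m → ℝ, 2 * (x ⬝ᵥ A *ᵥ y) ≤ t * (x ⬝ᵥ x + y ⬝ᵥ y)

theorem matInner_sum_right {d : ℕ} {ι : Type*} (s : Finset ι) (W : Matrix (Fin d) (Fin d) ℝ)
    (f : ι → Matrix (Fin d) (Fin d) ℝ) :
    matInner W (∑ i ∈ s, f i) = ∑ i ∈ s, matInner W (f i) := by
  simp [matInner, Finset.mul_sum, Matrix.trace_sum]

theorem matInner_sum_left {d : ℕ} {ι : Type*} (s : Finset ι) (W : Matrix (Fin d) (Fin d) ℝ)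
    (f : ι → Matrix (Fin d) (Fin d) ℝ) :
    matInner (∑ i ∈ s, f i) W = ∑ i ∈ s, matInner (f i) W := by
  simp [matInner, Finset.sum_mul, Matrix.trace_sum, Matrix.transpose_sum]

theorem matInner_add_right {d : ℕ} (W A B : Matrix (Fin d) (Fin d) ℝ) :
    matInner W (A + B) = matInner W A + matInner W B := by
  simp [matInner, Matrix.mul_add]

theorem matInner_add_left {d : ℕ} (W A B : Matrix (Fin d) (Fin d) ℝ) :
    matInner (A + B) W = matInner A W + matInner B W := by
  simp [matInner, Matrix.add_mul]

theorem matInner_sub_right {d : ℕ} (W A B : Matrix (Fin d) (Fin d) ℝ) :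
    matInner W (A - B) = matInner W A - matInner W B := by
  simp [matInner, Matrix.mul_sub]

theorem matInner_neg_left {d : ℕ} (W A : Matrix (Fin d) (Fin d) ℝ) :
    matInner (-W) A = -matInner W A := by
  simp [matInner]

theorem matInner_smul_right {d : ℕ} (c : ℝ) (W A : Matrix (Fin d) (Fin d) ℝ) :
    matInner W (c • A) = c * matInner W A := by
  simp [matInner]

theorem matInner_smul_left {d : ℕ} (c : ℝ) (W A : Matrix (Fin d) (Fin d) ℝ) :
    matInner (c • W) A = c * matInner W A := by
  simp [matInner]

theorem matInner_vecMulVec {d : ℕ} (W : Matrix (Fin d) (Fin d) ℝ) (u v : Fin d → ℝ) :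
    matInner W (vecMulVec u v) = u ⬝ᵥ W *ᵥ v := by
  rw [matInner, Matrix.mul_vecMulVec, Matrix.trace_vecMulVec, Matrix.mulVec_transpose,
    ← Matrix.dotProduct_mulVec]

theorem matInner_comm {d : ℕ} (A B : Matrix (Fin d) (Fin d) ℝ) :
    matInner A B = matInner B A := by
  rw [matInner, matInner, ← Matrix.trace_transpose, Matrix.transpose_mul, Matrix.transpose_transpose]

theorem matInner_eq_sum {d : ℕ} (A B : Matrix (Fin d) (Fin d) ℝ) :
    matInner A B = ∑ i, ∑ j, A i j * B i j := by
  rw [Finset.sum_comm]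
  simp [matInner, Matrix.trace, Matrix.mul_apply]

theorem frobNorm_sq {d : ℕ} (A : Matrix (Fin d) (Fin d) ℝ) :
    frobNorm A ^ 2 = matInner A A := by
  rw [frobNorm, Real.sq_sqrt (by positivity), matInner_eq_sum]
  simp [sq]

theorem frobNorm_nonneg {d : ℕ} (A : Matrix (Fin d) (Fin d) ℝ) : 0 ≤ frobNorm A :=
  Real.sqrt_nonneg _

theorem OpLe.neg {m : Type*} [Fintype m] {A : Matrix m m ℝ} {t : ℝ} (h : OpLe A t) :
    OpLe (-A) t := by
  intro x y
  have := h (-x) y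
  simpa [Matrix.neg_mulVec] using this

theorem OpLe.smul {m : Type*} [Fintype m] {A : Matrix m m ℝ} {t c : ℝ} (hc : 0 ≤ c)
    (h : OpLe A t) : OpLe (c • A) (c * t) := by
  intro x y
  have := mul_le_mul_of_nonneg_left (h x y) hc
  simp only [smul_mulVec, dotProduct_smul, smul_eq_mul]
  linarith

theorem dotProduct_self_nonneg' {m : Type*} [Fintype m] (x : m → ℝ) : 0 ≤ x ⬝ᵥ x := by
  simpa using dotProduct_star_self_nonneg x

theorem OpLe.mono {m : Type*} [Fintype m] {A : Matrix m m ℝ} {t t' : ℝ} (htt : t ≤ t')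
    (h : OpLe A t) : OpLe A t' := by
  intro x y
  refine (h x y).trans (mul_le_mul_of_nonneg_right htt ?_)
  exact add_nonneg (dotProduct_self_nonneg' x) (dotProduct_self_nonneg' y)

theorem nuclearNorm_nonneg {d : ℕ} (A : Matrix (Fin d) (Fin d) ℝ) : 0 ≤ nuclearNorm A :=
  Finset.sum_nonneg fun _ _ => LinearMap.singularValues_nonneg _ _

/-- Duality of the operator norm and the nuclear norm. -/
theorem OpLe.matInner_le {d : ℕ} {W : Matrix (Fin d) (Fin d) ℝ} {t : ℝ} (h : OpLe W t)
    (A : Matrix (Fin d) (Fin d) ℝ) : matInner W A ≤ t * nuclearNorm A := by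
  obtain ⟨s, w, u, v, hw, hu, hv, hA, hn, -⟩ := exists_svd A
  rw [hn]
  conv_lhs => rw [hA]
  rw [matInner_sum_right, Finset.mul_sum]
  refine Finset.sum_le_sum fun i hi => ?_
  rw [matInner_smul_right, matInner_vecMulVec, mul_comm t]
  refine mul_le_mul_of_nonneg_left ?_ (hw i hi).le
  have := h (u i) (v i)
  rw [hu i hi i hi, hv i hi i hi] at this
  simp at this
  linarith

/-! ### Projections and partial isometries of orthonormal families. -/

section Families

variable {d : ℕ} {s : Finset (Fin d)} {u v : Fin d → Fin d → ℝ}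

/-- The projection onto the orthogonal complement of the span of an orthonormal family. -/
def complProj (s : Finset (Fin d)) (u : Fin d → Fin d → ℝ) : Matrix (Fin d) (Fin d) ℝ :=
  1 - ∑ i ∈ s, vecMulVec (u i) (u i)

theorem complProj_transpose : (complProj s u)ᵀ = complProj s u := by
  simp [complProj, Matrix.transpose_sum, Matrix.transpose_vecMulVec]

theorem complProj_mulVec (x : Fin d → ℝ) :
    complProj s u *ᵥ x = x - ∑ i ∈ s, (u i ⬝ᵥ x) • u i := by
  simp [complProj, Matrix.sub_mulVec, Matrix.sum_mulVec, vecMulVec_mulVec]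

theorem complProj_mulVec_self (hu : ∀ i ∈ s, ∀ j ∈ s, u i ⬝ᵥ u j = if i = j then 1 else 0)
    {j : Fin d} (hj : j ∈ s) : complProj s u *ᵥ u j = 0 := by
  rw [complProj_mulVec, Finset.sum_eq_single j]
  · simp [hu j hj j hj]
  · intro i hi hij
    simp [hu i hi j hj, hij]
  · intro h
    exact absurd hj h

theorem complProj_idem (hu : ∀ i ∈ s, ∀ j ∈ s, u i ⬝ᵥ u j = if i = j then 1 else 0) :
    complProj s u * complProj s u = complProj s u := by
  have h : complProj s u * complProj s u =
      complProj s u - (∑ i ∈ s, vecMulVec (u i) (u i)) * complProj s u := by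
    conv_lhs => rw [complProj, Matrix.sub_mul, Matrix.one_mul, ← complProj]
  rw [h, sub_eq_self, Finset.sum_mul]
  refine Finset.sum_eq_zero fun i hi => ?_
  rw [Matrix.vecMulVec_mul, ← Matrix.mulVec_transpose, complProj_transpose,
    complProj_mulVec_self hu hi]
  simp

theorem complProj_dotProduct (hu : ∀ i ∈ s, ∀ j ∈ s, u i ⬝ᵥ u j = if i = j then 1 else 0)
    (x : Fin d → ℝ) :
    complProj s u *ᵥ x ⬝ᵥ complProj s u *ᵥ x = x ⬝ᵥ x - ∑ i ∈ s, (u i ⬝ᵥ x) ^ 2 := by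
  rw [Matrix.dotProduct_mulVec, Matrix.vecMul_mulVec, complProj_transpose, complProj_idem hu,
    ← Matrix.mulVec_transpose, complProj_transpose, complProj_mulVec,
    sub_dotProduct, sum_dotProduct]
  simp [sq]

theorem _root_.Matrix.rank_add_le' {m : Type*} [Fintype m] (A B : Matrix m m ℝ) :
    (A + B).rank ≤ A.rank + B.rank := by
  classical
  rw [Matrix.rank, Matrix.rank, Matrix.rank, Matrix.mulVecLin_add]
  exact (Submodule.finrank_mono (LinearMap.range_add_le _ _)).trans
    (Submodule.finrank_add_le_finrank_add_finrank _ _)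

theorem rank_one_sub_complProj_le : (1 - complProj s u).rank ≤ s.card := by
  rw [complProj, sub_sub_cancel]
  classical
  induction s using Finset.induction_on with
  | empty => simp
  | insert a t ha ih =>
    rw [Finset.sum_insert ha, Finset.card_insert_of_notMem ha, add_comm]
    exact (Matrix.rank_add_le' _ _).trans (add_le_add ih (Matrix.rank_vecMulVec_le _ _))

/-- The partial isometry of two orthonormal families. -/
def partialIsom (s : Finset (Fin d)) (u v : Fin d → Fin d → ℝ) : Matrix (Fin d) (Fin d) ℝ :=
  ∑ i ∈ s, vecMulVec (u i) (v i)

theorem dotProduct_partialIsom (x y : Fin d → ℝ) :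
    x ⬝ᵥ partialIsom s u v *ᵥ y = ∑ i ∈ s, (u i ⬝ᵥ x) * (v i ⬝ᵥ y) := by
  simp only [partialIsom, Matrix.sum_mulVec, vecMulVec_mulVec, dotProduct_sum, dotProduct_smul]
  refine Finset.sum_congr rfl fun i _ => ?_
  rw [dotProduct_comm x]
  simp

theorem matInner_partialIsom (w : Fin d → ℝ)
    (hu : ∀ i ∈ s, ∀ j ∈ s, u i ⬝ᵥ u j = if i = j then 1 else 0)
    (hv : ∀ i ∈ s, ∀ j ∈ s, v i ⬝ᵥ v j = if i = j then 1 else 0) :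
    matInner (partialIsom s u v) (∑ i ∈ s, w i • vecMulVec (u i) (v i)) = ∑ i ∈ s, w i := by
  rw [matInner_sum_right]
  refine Finset.sum_congr rfl fun i hi => ?_
  rw [matInner_smul_right, matInner_vecMulVec, dotProduct_partialIsom, Finset.sum_eq_single i]
  · simp [hu i hi i hi, hv i hi i hi]
  · intro j hj hji
    simp [hu j hj i hi, hji]
  · intro h
    exact absurd hi h

/-- The two summands act between orthogonal pieces of the spaces. The partial isometry uses up `∑ ⟨u
i, x⟩²` and `∑ ⟨v i, y⟩²`, and the compressed `W` sees only what Pythagoras leaves of `|x|²` and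
`|y|²`. -/
theorem opLe_partialIsom_add (hu : ∀ i ∈ s, ∀ j ∈ s, u i ⬝ᵥ u j = if i = j then 1 else 0)
    (hv : ∀ i ∈ s, ∀ j ∈ s, v i ⬝ᵥ v j = if i = j then 1 else 0)
    {W : Matrix (Fin d) (Fin d) ℝ} (hW : OpLe W 1) :
    OpLe (partialIsom s u v + complProj s u * W * complProj s v) 1 := by
  intro x y
  have h1 := hW (complProj s u *ᵥ x) (complProj s v *ᵥ y)
  rw [complProj_dotProduct hu, complProj_dotProduct hv] at h1
  have h2 : x ⬝ᵥ (complProj s u * W * complProj s v) *ᵥ y =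
      complProj s u *ᵥ x ⬝ᵥ W *ᵥ (complProj s v *ᵥ y) := by
    rw [← Matrix.mulVec_mulVec, ← Matrix.mulVec_mulVec, Matrix.dotProduct_mulVec x,
      ← Matrix.mulVec_transpose, complProj_transpose]
  rw [Matrix.add_mulVec, dotProduct_add, h2, dotProduct_partialIsom]
  have h3 : 2 * ∑ i ∈ s, (u i ⬝ᵥ x) * (v i ⬝ᵥ y) ≤
      ∑ i ∈ s, (u i ⬝ᵥ x) ^ 2 + ∑ i ∈ s, (v i ⬝ᵥ y) ^ 2 := by
    rw [Finset.mul_sum, ← Finset.sum_add_distrib]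
    refine Finset.sum_le_sum fun i _ => ?_
    nlinarith [sq_nonneg (u i ⬝ᵥ x - v i ⬝ᵥ y)]
  linarith

end Families

theorem opLe_zero {m : Type*} [Fintype m] : OpLe (0 : Matrix m m ℝ) 1 := by
  intro x y
  have h1 := dotProduct_self_nonneg' x
  have h2 := dotProduct_self_nonneg' y
  simp only [Matrix.zero_mulVec, dotProduct_zero]
  linarith

/-- The polar factor `∑ u i (v i)ᵀ` attains the supremum in the dual description of the nuclear
norm. Together with `OpLe.matInner_le` this makes the nuclear norm a supremum of linear forms, from
which its triangle inequality and its scaling bound follow. -/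
theorem exists_dual_matrix {d : ℕ} (A : Matrix (Fin d) (Fin d) ℝ) :
    ∃ W, OpLe W 1 ∧ matInner W A = nuclearNorm A := by
  obtain ⟨s, w, u, v, hw, hu, hv, hA, hn, -⟩ := exists_svd A
  refine ⟨partialIsom s u v, ?_, ?_⟩
  · simpa using opLe_partialIsom_add hu hv opLe_zero
  · rw [hn, ← matInner_partialIsom w hu hv, ← hA]

theorem nuclearNorm_le_of_forall {d : ℕ} {A : Matrix (Fin d) (Fin d) ℝ} {c : ℝ}
    (h : ∀ W, OpLe W 1 → matInner W A ≤ c) : nuclearNorm A ≤ c := by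
  obtain ⟨W, hW, hWA⟩ := exists_dual_matrix A
  exact hWA ▸ h W hW

theorem nuclearNorm_add_le {d : ℕ} (A B : Matrix (Fin d) (Fin d) ℝ) :
    nuclearNorm (A + B) ≤ nuclearNorm A + nuclearNorm B := by
  refine nuclearNorm_le_of_forall fun W hW => ?_
  have h1 := hW.matInner_le A
  have h2 := hW.matInner_le B
  rw [matInner_add_right]
  linarith

theorem nuclearNorm_sub_le {d : ℕ} (A B : Matrix (Fin d) (Fin d) ℝ) :
    nuclearNorm (A - B) ≤ nuclearNorm A + nuclearNorm B := by
  refine nuclearNorm_le_of_forall fun W hW => ?_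
  have h1 := hW.matInner_le A
  have h2 := hW.neg.matInner_le B
  rw [matInner_neg_left] at h2
  rw [matInner_sub_right]
  linarith

theorem nuclearNorm_smul_le {d : ℕ} {c : ℝ} (hc : 0 ≤ c) (A : Matrix (Fin d) (Fin d) ℝ) :
    nuclearNorm (c • A) ≤ c * nuclearNorm A := by
  refine nuclearNorm_le_of_forall fun W hW => ?_
  rw [matInner_smul_right]
  have h1 := hW.matInner_le A
  rw [one_mul] at h1
  exact mul_le_mul_of_nonneg_left h1 hc

theorem nuclearNorm_le_sqrt_rank {d : ℕ} (A : Matrix (Fin d) (Fin d) ℝ) :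
    nuclearNorm A ≤ √A.rank * frobNorm A := by
  obtain ⟨s, w, u, v, hw, hu, hv, hA, hn, hr⟩ := exists_svd A
  have hF : frobNorm A ^ 2 = ∑ i ∈ s, w i ^ 2 := by
    rw [frobNorm_sq]
    conv_lhs => rw [hA]
    rw [matInner_sum_right]
    refine Finset.sum_congr rfl fun i hi => ?_
    rw [matInner_smul_right, matInner_comm, matInner_sum_right, Finset.sum_eq_single i]
    · rw [matInner_smul_right, matInner_vecMulVec, vecMulVec_mulVec]
      simp [hu i hi i hi, hv i hi i hi, sq]
    · intro j hj hji
      rw [matInner_smul_right, matInner_vecMulVec, vecMulVec_mulVec]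
      simp [hv i hi j hj, hji.symm]
    · intro h
      exact absurd hi h
  have h1 : nuclearNorm A ^ 2 ≤ A.rank * frobNorm A ^ 2 := by
    rw [hn, hF, ← hr]
    exact sq_sum_le_card_mul_sum_sq
  have h2 := Real.sqrt_le_sqrt h1
  rwa [Real.sqrt_sq (nuclearNorm_nonneg A), Real.sqrt_mul (by positivity),
    Real.sqrt_sq (frobNorm_nonneg A)] at h2

/-- Decomposability of the nuclear norm at `Θ`. -/
theorem exists_nuclearNorm_decomposition {d : ℕ} (Θ D : Matrix (Fin d) (Fin d) ℝ) :
    ∃ D₁ D₂ : Matrix (Fin d) (Fin d) ℝ, D = D₁ + D₂ ∧ D₁.rank ≤ 2 * Θ.rank ∧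
      frobNorm D₁ ≤ frobNorm D ∧
      nuclearNorm Θ + nuclearNorm D₂ - nuclearNorm D₁ ≤ nuclearNorm (Θ + D) := by
  obtain ⟨s, w, u, v, hw, hu, hv, hA, hn, hr⟩ := exists_svd Θ
  set P := complProj s u with hP
  set Q := complProj s v with hQ
  have hPP : P * P = P := complProj_idem hu
  have hQQ : Q * Q = Q := complProj_idem hv
  have hPt : Pᵀ = P := complProj_transpose
  have hQt : Qᵀ = Q := complProj_transpose
  have hQv : ∀ j ∈ s, Q *ᵥ v j = 0 := fun j hj => complProj_mulVec_self hv hj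
  refine ⟨D - P * D * Q, P * D * Q, by simp, ?_, ?_, ?_⟩
  -- Each summand has a factor of rank at most `s.card`, which is the rank of `Θ`; hence the factor
  -- two.
  · have : D - P * D * Q = (1 - P) * D + P * D * (1 - Q) := by
      rw [Matrix.sub_mul, Matrix.mul_sub]
      simp
    rw [this]
    refine (Matrix.rank_add_le' _ _).trans ?_
    have h1 := (Matrix.rank_mul_le_left (1 - P) D).trans rank_one_sub_complProj_le
    have h2 := (Matrix.rank_mul_le_right (P * D) (1 - Q)).trans rank_one_sub_complProj_le
    omega
  -- The map `D ↦ P * D * Q` is an orthogonal projection for the trace inner product, so the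
  -- complementary part is no larger than `D`.
  · have horth : matInner (P * D * Q) (P * D * Q) = matInner (P * D * Q) D := by
      rw [matInner, matInner, Matrix.transpose_mul, Matrix.transpose_mul, hPt, hQt]
      rw [Matrix.trace_mul_comm]
      calc (P * D * Q * (Q * (Dᵀ * P))).trace = (P * (D * (Q * Q) * Dᵀ * P)).trace := by
            simp only [Matrix.mul_assoc]
        _ = ((D * (Q * Q) * Dᵀ * P) * P).trace := Matrix.trace_mul_comm _ _
        _ = (D * (Q * Dᵀ * (P * P))).trace := by
            rw [hQQ]; simp only [Matrix.mul_assoc]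
        _ = (Q * (Dᵀ * P) * D).trace := by
            rw [hPP, Matrix.trace_mul_comm]; simp only [Matrix.mul_assoc]
    have h1 : frobNorm (D - P * D * Q) ^ 2 ≤ frobNorm D ^ 2 := by
      have h0 := sq_nonneg (frobNorm (P * D * Q))
      rw [frobNorm_sq] at h0 ⊢
      rw [frobNorm_sq, matInner_sub_right, matInner_comm, matInner_sub_right,
        matInner_comm D (P * D * Q), matInner_comm _ (P * D * Q), matInner_sub_right, horth]
      linarith
    exact le_of_sq_le_sq h1 (frobNorm_nonneg D)
  · obtain ⟨W, hW, hWD⟩ := exists_dual_matrix (P * D * Q)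
    have hop := opLe_partialIsom_add hu hv hW
    -- `V` is a subgradient of the nuclear norm at `Θ`, chosen to be also norming for `P * D * Q`.
    -- Testing it against `Θ + D` leaves only its pairing with the low-rank part, which costs at
    -- most that part's nuclear norm.
    set V := partialIsom s u v + P * W * Q with hV
    have h1 : matInner V Θ = nuclearNorm Θ := by
      rw [hV, matInner_add_left, hn]
      conv_lhs => rw [hA]
      rw [matInner_partialIsom w hu hv, add_eq_left, matInner_sum_right]
      refine Finset.sum_eq_zero ?_
      intro i hi
      rw [matInner_smul_right, matInner_vecMulVec, ← Matrix.mulVec_mulVec, hQv i hi]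
      simp
    have h2 : matInner V (P * D * Q) = nuclearNorm (P * D * Q) := by
      rw [hV, matInner_add_left, partialIsom, matInner_sum_left, Finset.sum_eq_zero, zero_add]
      · rw [← hWD, matInner, matInner, Matrix.transpose_mul, Matrix.transpose_mul, hPt, hQt]
        calc (Q * (Wᵀ * P) * (P * D * Q)).trace = (Q * (Wᵀ * (P * P) * D * Q)).trace := by
              simp only [Matrix.mul_assoc]
          _ = (Wᵀ * (P * P) * D * Q * Q).trace := Matrix.trace_mul_comm _ _
          _ = (Wᵀ * (P * P) * D * (Q * Q)).trace := by simp only [Matrix.mul_assoc]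
          _ = _ := by rw [hPP, hQQ]; simp only [Matrix.mul_assoc]
      · intro i hi
        rw [matInner_comm, matInner_vecMulVec, ← Matrix.mulVec_mulVec, hQv i hi]
        simp
    have h3 := hop.matInner_le (Θ + D)
    have h4 := hop.neg.matInner_le (D - P * D * Q)
    rw [matInner_neg_left] at h4
    have h5 : matInner V (Θ + D) =
        matInner V Θ + matInner V (P * D * Q) + matInner V (D - P * D * Q) := by
      rw [← matInner_add_right, ← matInner_add_right]
      congr 1
      abel
    linarith

end QMC

/-! ### Trace exponential inequalities -/

namespace QMC

open Matrix

/-- Telescoping: exchange one factor `x` for `y` at a time. Nothing has to commute. -/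
theorem norm_pow_sub_pow_le_of_norm_le {𝔸 : Type*} [NormedRing 𝔸] [NormOneClass 𝔸] {x y : 𝔸}
    {c : ℝ} (hx : ‖x‖ ≤ c) (hy : ‖y‖ ≤ c) (n : ℕ) :
    ‖x ^ (n + 1) - y ^ (n + 1)‖ ≤ (n + 1) * c ^ n * ‖x - y‖ := by
  have hc : 0 ≤ c := (norm_nonneg x).trans hx
  induction n with
  | zero => simp
  | succ n ih =>
    have h : x ^ (n + 1 + 1) - y ^ (n + 1 + 1) =
        x ^ (n + 1) * (x - y) + (x ^ (n + 1) - y ^ (n + 1)) * y := by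
      rw [pow_succ x (n + 1), pow_succ y (n + 1), mul_sub, sub_mul]
      abel
    rw [h]
    have h1 : ‖x ^ (n + 1) * (x - y)‖ ≤ c ^ (n + 1) * ‖x - y‖ :=
      (norm_mul_le _ _).trans (mul_le_mul_of_nonneg_right
        ((norm_pow_le _ _).trans (pow_le_pow_left₀ (norm_nonneg _) hx _)) (norm_nonneg _))
    have h2 : ‖(x ^ (n + 1) - y ^ (n + 1)) * y‖ ≤ ((n + 1) * c ^ n * ‖x - y‖) * c :=
      (norm_mul_le _ _).trans (mul_le_mul ih hy (norm_nonneg _) (by positivity))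
    refine (norm_add_le _ _).trans ((add_le_add h1 h2).trans (le_of_eq ?_))
    push_cast
    ring

/-! ### The Lie product formula. -/

section LieTrotter

variable {𝔸 : Type*} [NormedRing 𝔸] [NormedAlgebra ℝ 𝔸] [CompleteSpace 𝔸] [NormOneClass 𝔸]

theorem norm_exp_le_exp_norm (a : 𝔸) : ‖NormedSpace.exp a‖ ≤ Real.exp ‖a‖ := by
  rw [Real.exp_eq_exp_ℝ]
  have h1 := NormedSpace.exp_series_hasSum_exp' (𝕂 := ℝ) a
  have h2 := NormedSpace.exp_series_hasSum_exp' (𝕂 := ℝ) ‖a‖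
  rw [← h1.tsum_eq]
  refine tsum_of_norm_bounded h2 fun n => ?_
  rw [norm_smul, smul_eq_mul, Real.norm_of_nonneg (by positivity)]
  exact mul_le_mul_of_nonneg_left (norm_pow_le a n) (by positivity)

/-- The Lie product formula. -/
theorem tendsto_exp_mul_exp_pow (a b : 𝔸) :
    Filter.Tendsto (fun n : ℕ => (NormedSpace.exp (((n : ℝ) + 1)⁻¹ • a) *
      NormedSpace.exp (((n : ℝ) + 1)⁻¹ • b)) ^ (n + 1)) Filter.atTop
      (nhds (NormedSpace.exp (a + b))) := by
  set f : ℝ → 𝔸 := fun t => NormedSpace.exp (t • a) * NormedSpace.exp (t • b) -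
    NormedSpace.exp (t • (a + b)) with hf
  -- The product of exponentials and the exponential of the sum agree to first order at `0`. So `f
  -- (1 / N)` is `o(1 / N)`, which beats the factor `N` lost in the telescoping bound for `N`-th
  -- powers.
  have hd : HasDerivAt f 0 0 := by
    have h1 := hasDerivAt_exp_smul_const (𝕂 := ℝ) a (0 : ℝ)
    have h2 := hasDerivAt_exp_smul_const (𝕂 := ℝ) b (0 : ℝ)
    have h3 := hasDerivAt_exp_smul_const (𝕂 := ℝ) (a + b) (0 : ℝ)
    have h4 : HasDerivAt f _ 0 := (h1.mul h2).sub h3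
    convert h4 using 1
    simp
  have hlim : Filter.Tendsto (fun n : ℕ => ((n : ℝ) + 1) * ‖f (((n : ℝ) + 1)⁻¹)‖)
      Filter.atTop (nhds 0) := by
    rw [hasDerivAt_iff_tendsto_slope_zero] at hd
    have hs : Filter.Tendsto (fun n : ℕ => ((n : ℝ) + 1)⁻¹) Filter.atTop
        (nhdsWithin 0 {0}ᶜ) := by
      rw [tendsto_nhdsWithin_iff]
      refine ⟨?_, Filter.Eventually.of_forall fun n => ?_⟩
      · simpa using tendsto_one_div_add_atTop_nhds_zero_nat (𝕜 := ℝ)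
      · have : ((n : ℝ) + 1)⁻¹ ≠ 0 := by positivity
        simpa using this
    have := (hd.comp hs).norm
    simp only [Function.comp_def, zero_add, inv_inv, norm_smul, norm_zero] at this
    refine this.congr fun n => ?_
    have h0 : f 0 = 0 := by simp [hf]
    rw [h0, sub_zero, Real.norm_of_nonneg (by positivity)]
  rw [tendsto_iff_norm_sub_tendsto_zero]
  have hb : ∀ n : ℕ, ‖(NormedSpace.exp (((n : ℝ) + 1)⁻¹ • a) *
      NormedSpace.exp (((n : ℝ) + 1)⁻¹ • b)) ^ (n + 1) - NormedSpace.exp (a + b)‖ ≤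
      Real.exp (‖a‖ + ‖b‖) * (((n : ℝ) + 1) * ‖f (((n : ℝ) + 1)⁻¹)‖) := by
    intro n
    have hpos : (0 : ℝ) < (n : ℝ) + 1 := by positivity
    have hexp : ∀ c : 𝔸, ‖NormedSpace.exp (((n : ℝ) + 1)⁻¹ • c)‖ ≤
        Real.exp (((n : ℝ) + 1)⁻¹ * ‖c‖) := fun c => by
      refine (norm_exp_le_exp_norm _).trans (le_of_eq ?_)
      rw [norm_smul, Real.norm_of_nonneg (by positivity)]
    have hX : ‖NormedSpace.exp (((n : ℝ) + 1)⁻¹ • a) * NormedSpace.exp (((n : ℝ) + 1)⁻¹ • b)‖ ≤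
        Real.exp (((n : ℝ) + 1)⁻¹ * (‖a‖ + ‖b‖)) := by
      refine (norm_mul_le _ _).trans ?_
      rw [mul_add, Real.exp_add]
      exact mul_le_mul (hexp a) (hexp b) (norm_nonneg _) (Real.exp_pos _).le
    have hY : ‖NormedSpace.exp (((n : ℝ) + 1)⁻¹ • (a + b))‖ ≤
        Real.exp (((n : ℝ) + 1)⁻¹ * (‖a‖ + ‖b‖)) := by
      refine (hexp _).trans (Real.exp_le_exp.2 ?_)
      exact mul_le_mul_of_nonneg_left (norm_add_le _ _) (by positivity)
    have hYpow : NormedSpace.exp (((n : ℝ) + 1)⁻¹ • (a + b)) ^ (n + 1) =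
        NormedSpace.exp (a + b) := by
      let _ := NormedAlgebra.restrictScalars ℚ ℝ 𝔸
      rw [← NormedSpace.exp_nsmul, ← Nat.cast_smul_eq_nsmul ℝ, smul_smul]
      push_cast
      rw [mul_inv_cancel₀ hpos.ne', one_smul]
    have := norm_pow_sub_pow_le_of_norm_le hX hY n
    rw [hYpow] at this
    refine this.trans ?_
    have hc : Real.exp (((n : ℝ) + 1)⁻¹ * (‖a‖ + ‖b‖)) ^ n ≤ Real.exp (‖a‖ + ‖b‖) := by
      rw [← Real.exp_nat_mul]
      refine Real.exp_le_exp.2 ?_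
      rw [← mul_assoc]
      refine mul_le_of_le_one_left (by positivity) ?_
      rw [← div_eq_mul_inv, div_le_one hpos]
      linarith
    calc ((n : ℝ) + 1) * Real.exp (((n : ℝ) + 1)⁻¹ * (‖a‖ + ‖b‖)) ^ n * _
        = Real.exp (((n : ℝ) + 1)⁻¹ * (‖a‖ + ‖b‖)) ^ n *
          (((n : ℝ) + 1) * ‖f (((n : ℝ) + 1)⁻¹)‖) := by ring
      _ ≤ _ := mul_le_mul_of_nonneg_right hc (by positivity)
  refine squeeze_zero (fun n => norm_nonneg _) hb ?_
  simpa using hlim.const_mul (Real.exp (‖a‖ + ‖b‖))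

end LieTrotter

/-! ### The Golden–Thompson inequality and trace exponentials of symmetric matrices. -/

variable {m : Type*} [Fintype m] [DecidableEq m]

theorem trace_mul_pow_comm (X Y : Matrix m m ℝ) (k : ℕ) :
    ((X * Y) ^ k).trace = ((Y * X) ^ k).trace := by
  cases k with
  | zero => simp
  | succ k =>
    rw [pow_succ, ← Matrix.mul_assoc, mul_pow_mul, Matrix.mul_assoc, Matrix.trace_mul_comm,
      Matrix.mul_assoc, ← pow_succ]

theorem trace_transpose_mul_self_nonneg {m : Type*} [Fintype m] (M : Matrix m m ℝ) : 0 ≤ (Mᵀ * M).trace := by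
  simp only [Matrix.trace, Matrix.diag, Matrix.mul_apply, Matrix.transpose_apply]
  exact Finset.sum_nonneg fun i _ => Finset.sum_nonneg fun j _ => mul_self_nonneg _

theorem two_mul_trace_mul_le {m : Type*} [Fintype m] (P Q : Matrix m m ℝ) :
    2 * (Pᵀ * Q).trace ≤ (Pᵀ * P).trace + (Qᵀ * Q).trace := by
  have h := trace_transpose_mul_self_nonneg (P - Q)
  have h2 : (Qᵀ * P).trace = (Pᵀ * Q).trace := by
    rw [← Matrix.trace_transpose, Matrix.transpose_mul, Matrix.transpose_transpose]
  rw [Matrix.transpose_sub, Matrix.sub_mul, Matrix.mul_sub, Matrix.mul_sub] at h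
  simp only [Matrix.trace_sub] at h
  linarith

/-- The two statements feed each other. For the first, apply it one level down to `M ^ 2`, rotate
the trace to reach `(Mᵀ * M) * (M * Mᵀ)`, use the second, and finish with Cauchy–Schwarz, since `Mᵀ
* M` and `M * Mᵀ` have equal traces of powers. For the second, apply the first to `P * Q` and rotate
to reach `P ^ 2 * Q ^ 2`. -/
theorem trace_pow_two_pow_le_aux (k : ℕ) :
    (∀ M : Matrix m m ℝ, (M ^ 2 ^ (k + 1)).trace ≤ ((Mᵀ * M) ^ 2 ^ k).trace) ∧
    (∀ P Q : Matrix m m ℝ, Pᵀ = P → Qᵀ = Q →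
      ((P * Q) ^ 2 ^ k).trace ≤ (P ^ 2 ^ k * Q ^ 2 ^ k).trace) := by
  induction k with
  | zero =>
    refine ⟨fun M => ?_, fun P Q _ _ => by simp⟩
    have h := two_mul_trace_mul_le Mᵀ M
    rw [Matrix.transpose_transpose, Matrix.trace_mul_comm M Mᵀ] at h
    simp only [zero_add, pow_one, pow_zero, sq]
    linarith
  | succ k ih =>
    obtain ⟨ih1, ih2⟩ := ih
    constructor
    · intro M
      have h1 := ih1 (M ^ 2)
      rw [← pow_mul, ← pow_succ' 2 (k + 1)] at h1
      refine h1.trans ?_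
      have h2 : (((M ^ 2)ᵀ * M ^ 2) ^ 2 ^ k).trace = (((Mᵀ * M) * (M * Mᵀ)) ^ 2 ^ k).trace := by
        have e1 : (M ^ 2)ᵀ * M ^ 2 = Mᵀ * (Mᵀ * M * M) := by
          rw [sq, Matrix.transpose_mul]
          simp only [Matrix.mul_assoc]
        rw [e1, trace_mul_pow_comm]
        simp only [Matrix.mul_assoc]
      rw [h2]
      refine (ih2 (Mᵀ * M) (M * Mᵀ) (by simp) (by simp)).trans ?_
      have h3 := two_mul_trace_mul_le ((Mᵀ * M) ^ 2 ^ k) ((M * Mᵀ) ^ 2 ^ k)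
      rw [Matrix.transpose_pow, Matrix.transpose_pow, Matrix.transpose_mul, Matrix.transpose_mul,
        Matrix.transpose_transpose, ← pow_add, ← pow_add, trace_mul_pow_comm M Mᵀ] at h3
      have e : 2 ^ k + 2 ^ k = 2 ^ (k + 1) := by ring
      rw [e] at h3
      linarith
    · intro P Q hP hQ
      refine (ih1 (P * Q)).trans ?_
      have e1 : (P * Q)ᵀ * (P * Q) = Q * (P ^ 2 * Q) := by
        rw [Matrix.transpose_mul, hP, hQ, sq]
        simp only [Matrix.mul_assoc]
      rw [e1, trace_mul_pow_comm, Matrix.mul_assoc, ← sq]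
      have := ih2 (P ^ 2) (Q ^ 2) (by rw [Matrix.transpose_pow, hP])
        (by rw [Matrix.transpose_pow, hQ])
      rwa [← pow_mul, ← pow_mul, ← pow_succ'] at this

theorem exp_smul_pow_self (n : ℕ) (A : Matrix m m ℝ) :
    NormedSpace.exp (((n : ℝ) + 1)⁻¹ • A) ^ (n + 1) = NormedSpace.exp A := by
  rw [← Matrix.exp_nsmul, ← Nat.cast_smul_eq_nsmul ℝ, smul_smul]
  push_cast
  rw [mul_inv_cancel₀ (by positivity), one_smul]

open scoped Matrix.Norms.Operator in
theorem tendsto_matrix_exp_mul_exp_pow (A B : Matrix m m ℝ) :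
    Filter.Tendsto (fun n : ℕ => (NormedSpace.exp (((n : ℝ) + 1)⁻¹ • A) *
      NormedSpace.exp (((n : ℝ) + 1)⁻¹ • B)) ^ (n + 1)) Filter.atTop
      (nhds (NormedSpace.exp (A + B))) := by
  cases isEmpty_or_nonempty m with
  | inl h => exact tendsto_const_nhds.congr fun n => Subsingleton.elim _ _
  | inr h => exact tendsto_exp_mul_exp_pow A B

/-- The Golden–Thompson inequality for real symmetric matrices. -/
theorem trace_exp_add_le {A B : Matrix m m ℝ} (hA : Aᵀ = A) (hB : Bᵀ = B) :
    (NormedSpace.exp (A + B)).trace ≤ (NormedSpace.exp A * NormedSpace.exp B).trace := by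
  have hlim := tendsto_matrix_exp_mul_exp_pow A B
  -- The product formula is indexed by the exponent minus one; this subsequence makes the exponent a
  -- power of two, where the trace inequality is available.
  have hsub : Filter.Tendsto (fun k : ℕ => 2 ^ k - 1) Filter.atTop Filter.atTop :=
    Filter.tendsto_atTop_mono (fun k => Nat.le_sub_one_of_lt Nat.lt_two_pow_self) Filter.tendsto_id
  have hcont : Continuous (Matrix.trace : Matrix m m ℝ → ℝ) := continuous_id.matrix_trace
  have h := (hcont.tendsto _).comp (hlim.comp hsub)
  refine le_of_tendsto h (Filter.Eventually.of_forall fun k => ?_)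
  have hk : 2 ^ k - 1 + 1 = 2 ^ k := Nat.sub_add_cancel Nat.one_le_two_pow
  simp only [Function.comp_apply]
  have h2 := (trace_pow_two_pow_le_aux (m := m) k).2
    (NormedSpace.exp ((((2 ^ k - 1 : ℕ) : ℝ) + 1)⁻¹ • A))
    (NormedSpace.exp ((((2 ^ k - 1 : ℕ) : ℝ) + 1)⁻¹ • B))
    (by rw [← Matrix.exp_transpose, Matrix.transpose_smul, hA])
    (by rw [← Matrix.exp_transpose, Matrix.transpose_smul, hB])
  generalize 2 ^ k - 1 = N at h2 hk ⊢
  rwa [← hk, exp_smul_pow_self, exp_smul_pow_self] at h2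

theorem exp_posSemidef {A : Matrix m m ℝ} (hA : Aᵀ = A) :
    (NormedSpace.exp A).PosSemidef := by
  have h : NormedSpace.exp A =
      (NormedSpace.exp ((2 : ℝ)⁻¹ • A))ᴴ * NormedSpace.exp ((2 : ℝ)⁻¹ • A) := by
    rw [Matrix.conjTranspose_eq_transpose_of_trivial, ← Matrix.exp_transpose,
      Matrix.transpose_smul, hA, ← Matrix.exp_add_of_commute _ _ (Commute.refl _), ← add_smul]
    norm_num
  rw [h]
  exact Matrix.posSemidef_conjTranspose_mul_self _

theorem exists_diagonalization {A : Matrix m m ℝ} (hA : Aᵀ = A) :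
    ∃ (U : Matrix m m ℝ) (w : m → ℝ), U * Uᵀ = 1 ∧ A = U * Matrix.diagonal w * Uᵀ ∧
      (NormedSpace.exp A).trace = ∑ i, Real.exp (w i) := by
  have hH : A.IsHermitian := by
    rw [Matrix.IsHermitian, Matrix.conjTranspose_eq_transpose_of_trivial, hA]
  set U : Matrix m m ℝ := (hH.eigenvectorUnitary : Matrix m m ℝ) with hU
  have hUU : U * Uᵀ = 1 := by
    have := Matrix.mem_unitaryGroup_iff.1 hH.eigenvectorUnitary.2
    rwa [Matrix.star_eq_conjTranspose, Matrix.conjTranspose_eq_transpose_of_trivial] at this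
  have hinv : U⁻¹ = Uᵀ := Matrix.inv_eq_right_inv hUU
  have hUU' : Uᵀ * U = 1 := mul_eq_one_comm.1 hUU
  have hunit : IsUnit U := ⟨⟨U, Uᵀ, hUU, hUU'⟩, rfl⟩
  have hspec : A = U * Matrix.diagonal hH.eigenvalues * Uᵀ := by
    have := hH.spectral_theorem
    rw [Unitary.conjStarAlgAut_apply] at this
    simpa [Matrix.star_eq_conjTranspose, Matrix.conjTranspose_eq_transpose_of_trivial,
      Function.comp_def] using this
  refine ⟨U, hH.eigenvalues, hUU, hspec, ?_⟩
  conv_lhs => rw [hspec, ← hinv, Matrix.exp_conj U _ hunit, Matrix.trace_mul_comm,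
    ← Matrix.mul_assoc, hinv, hUU', Matrix.one_mul, Matrix.exp_diagonal, Matrix.trace_diagonal]
  simp [Pi.coe_exp, Real.exp_eq_exp_ℝ]

theorem trace_exp_pos [Nonempty m] {A : Matrix m m ℝ} (hA : Aᵀ = A) :
    0 < (NormedSpace.exp A).trace := by
  obtain ⟨U, w, -, -, h⟩ := exists_diagonalization hA
  rw [h]
  exact Finset.sum_pos (fun i _ => Real.exp_pos _) Finset.univ_nonempty

/-- The quadratic form of a symmetric matrix is at most the logarithm of its trace exponential. -/
theorem dotProduct_mulVec_le_log_trace_exp {A : Matrix m m ℝ} (hA : Aᵀ = A) (x : m → ℝ) :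
    x ⬝ᵥ A *ᵥ x ≤ Real.log (NormedSpace.exp A).trace * (x ⬝ᵥ x) := by
  obtain ⟨U, w, hUU, hspec, htr⟩ := exists_diagonalization hA
  -- One eigenvalue is at most the log of the sum of exponentials of all of them. This soft maximum
  -- is what later costs the factor `2 * d` in the tail bounds.
  have hle : ∀ i, w i ≤ Real.log (NormedSpace.exp A).trace := by
    intro i
    rw [htr]
    conv_lhs => rw [← Real.log_exp (w i)]
    refine Real.log_le_log (Real.exp_pos _) ?_
    exact Finset.single_le_sum (f := fun i => Real.exp (w i))
      (fun i _ => (Real.exp_pos _).le) (Finset.mem_univ i)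
  have hx : x ⬝ᵥ x = (Uᵀ *ᵥ x) ⬝ᵥ (Uᵀ *ᵥ x) := by
    rw [Matrix.dotProduct_mulVec, Matrix.vecMul_mulVec, Matrix.transpose_transpose, hUU,
      Matrix.vecMul_one]
  have hAx : x ⬝ᵥ A *ᵥ x = ∑ i, w i * ((Uᵀ *ᵥ x) i * (Uᵀ *ᵥ x) i) := by
    conv_lhs => rw [hspec, ← Matrix.mulVec_mulVec, ← Matrix.mulVec_mulVec,
      Matrix.dotProduct_mulVec, ← Matrix.mulVec_transpose]
    simp only [dotProduct, Matrix.mulVec_diagonal]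
    exact Finset.sum_congr rfl fun i _ => by ring
  rw [hAx, hx, dotProduct, Finset.mul_sum]
  exact Finset.sum_le_sum fun i _ => mul_le_mul_of_nonneg_right (hle i) (mul_self_nonneg _)

end QMC

/-! ### Hermitian dilation -/

namespace QMC

open Matrix

theorem exp_smul_idempotent {𝔸 : Type*} [NormedRing 𝔸] [NormedAlgebra ℝ 𝔸] [CompleteSpace 𝔸]
    {e : 𝔸} (he : e * e = e) (c : ℝ) :
    NormedSpace.exp (c • e) = 1 + (Real.exp c - 1) • e := by
  have h1 := NormedSpace.exp_series_hasSum_exp' (𝕂 := ℝ) (c • e)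
  have h2 := (NormedSpace.exp_series_hasSum_exp' (𝕂 := ℝ) c).smul_const e
  -- All positive powers of `e` equal `e`, but the zeroth power is `1`; this series carries the
  -- correction at index `0`.
  have h3 : HasSum (fun n : ℕ => if n = 0 then 1 - e else 0) (1 - e) := hasSum_ite_eq 0 (1 - e)
  have h4 := h2.add h3
  have hpow : ∀ n : ℕ, e ^ (n + 1) = e := fun n => by
    induction n with
    | zero => simp
    | succ n ih => rw [pow_succ, ih, he]
  have h5 : (fun n : ℕ => ((n.factorial : ℝ)⁻¹ • c ^ n) • e + if n = 0 then 1 - e else 0) =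
      fun n : ℕ => (n.factorial : ℝ)⁻¹ • (c • e) ^ n := by
    funext n
    cases n with
    | zero => simp
    | succ n => rw [smul_pow, hpow, smul_smul]; simp
  rw [h5] at h4
  rw [h1.unique h4, Real.exp_eq_exp_ℝ, sub_smul, one_smul]
  abel

/-- Such an `h` has spectrum in `{-1, 0, 1}`: it is `e₁ - e₂` for the orthogonal idempotents `(h² ±
h) / 2`, whose exponentials are explicit. Dilated design matrices are of this type, so their
exponentials have a closed form. -/
theorem exp_smul_of_mul_mul_self {𝔸 : Type*} [NormedRing 𝔸] [NormedAlgebra ℝ 𝔸]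
    [CompleteSpace 𝔸] {h : 𝔸} (hh : h * h * h = h) (c : ℝ) :
    NormedSpace.exp (c • h) = 1 + (Real.cosh c - 1) • (h * h) + Real.sinh c • h := by
  let _ := NormedAlgebra.restrictScalars ℚ ℝ 𝔸
  set p := h * h with hp
  have hph : p * h = h := hh
  have hhp : h * p = h := by rw [hp, ← mul_assoc, hh]
  have hpp : p * p = p := by
    conv_lhs => rw [hp]
    rw [mul_assoc, hhp]
  set e₁ : 𝔸 := (2 : ℝ)⁻¹ • (p + h) with he₁
  set e₂ : 𝔸 := (2 : ℝ)⁻¹ • (p - h) with he₂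
  have h12 : e₁ * e₂ = 0 := by
    rw [he₁, he₂, smul_mul_smul_comm, add_mul, mul_sub, mul_sub, hpp, hph, hhp, ← hp]
    simp
  have h21 : e₂ * e₁ = 0 := by
    rw [he₁, he₂, smul_mul_smul_comm, sub_mul, mul_add, mul_add, hpp, hph, hhp, ← hp]
    rw [add_comm h p, sub_self, smul_zero]
  have h11 : e₁ * e₁ = e₁ := by
    rw [he₁, smul_mul_smul_comm, add_mul, mul_add, mul_add, hpp, hph, hhp, ← hp, add_comm h p,
      ← two_smul ℝ (p + h), smul_smul]
    norm_num
  have h22 : e₂ * e₂ = e₂ := by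
    rw [he₂, smul_mul_smul_comm, sub_mul, mul_sub, mul_sub, hpp, hph, hhp, ← hp, sub_sub_eq_add_sub,
      show p - h + p - h = (2 : ℝ) • (p - h) by rw [two_smul]; abel, smul_smul]
    norm_num
  have hdec : c • h = c • e₁ + (-c) • e₂ := by
    rw [he₁, he₂]
    module
  rw [hdec, NormedSpace.exp_add_of_commute, exp_smul_idempotent h11, exp_smul_idempotent h22]
  · rw [add_mul, mul_add, mul_add, smul_mul_smul_comm, h12, Real.cosh_eq, Real.sinh_eq, he₁, he₂]
    simp only [one_mul, mul_one, smul_zero, add_zero]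
    module
  · change _ * _ = _ * _
    rw [smul_mul_smul_comm c, smul_mul_smul_comm (-c), h12, h21, smul_zero, smul_zero]

/-- The symmetric dilation of a square matrix. -/
def dilation {d : ℕ} (A : Matrix (Fin d) (Fin d) ℝ) : Matrix (Fin d ⊕ Fin d) (Fin d ⊕ Fin d) ℝ :=
  fromBlocks 0 A Aᵀ 0

variable {d : ℕ}

theorem dilation_transpose (A : Matrix (Fin d) (Fin d) ℝ) : (dilation A)ᵀ = dilation A := by
  simp [dilation, fromBlocks_transpose]

theorem dilation_smul (c : ℝ) (A : Matrix (Fin d) (Fin d) ℝ) :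
    dilation (c • A) = c • dilation A := by
  simp [dilation, fromBlocks_smul]

theorem dilation_add (A B : Matrix (Fin d) (Fin d) ℝ) :
    dilation (A + B) = dilation A + dilation B := by
  simp [dilation, fromBlocks_add]

theorem dilation_sum {ι : Type*} (s : Finset ι) (A : ι → Matrix (Fin d) (Fin d) ℝ) :
    dilation (∑ i ∈ s, A i) = ∑ i ∈ s, dilation (A i) := by
  classical
  induction s using Finset.induction_on with
  | empty => simp [dilation]
  | insert a t ha ih => rw [Finset.sum_insert ha, Finset.sum_insert ha, dilation_add, ih]

theorem dotProduct_dilation (A : Matrix (Fin d) (Fin d) ℝ) (x y : Fin d → ℝ) :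
    Sum.elim x y ⬝ᵥ dilation A *ᵥ Sum.elim x y = 2 * (x ⬝ᵥ A *ᵥ y) := by
  rw [dilation, fromBlocks_mulVec, sumElim_dotProduct_sumElim] 
  simp only [Sum.elim_comp_inl, Sum.elim_comp_inr, Matrix.zero_mulVec, zero_add, add_zero]
  rw [Matrix.dotProduct_mulVec y, Matrix.vecMul_transpose, dotProduct_comm (A *ᵥ y)]
  ring

/-- At a stacked vector `(x, y)` the quadratic form of the dilation is `2 * (x ⬝ᵥ A *ᵥ y)`. This is
why `OpLe` is stated with a sum of squares and not with a product of norms. -/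
theorem opLe_log_trace_exp_dilation (A : Matrix (Fin d) (Fin d) ℝ) :
    OpLe A (Real.log (NormedSpace.exp (dilation A)).trace) := by
  intro x y
  have h := dotProduct_mulVec_le_log_trace_exp (dilation_transpose A) (Sum.elim x y)
  rwa [dotProduct_dilation, sumElim_dotProduct_sumElim] at h

theorem opLe_of_trace_exp_dilation_le [NeZero d] {A : Matrix (Fin d) (Fin d) ℝ} {t : ℝ}
    (h : (NormedSpace.exp (dilation A)).trace ≤ Real.exp t) : OpLe A t := by
  refine (opLe_log_trace_exp_dilation A).mono ?_
  rw [← Real.log_exp t]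
  have : Nonempty (Fin d ⊕ Fin d) := ⟨Sum.inl 0⟩
  exact Real.log_le_log (trace_exp_pos (dilation_transpose A)) h

theorem dilation_design_sq (p : Fin d × Fin d) :
    dilation (design p) * dilation (design p) =
      fromBlocks (Matrix.single p.1 p.1 1) 0 0 (Matrix.single p.2 p.2 1) := by
  simp [dilation, design, fromBlocks_multiply]

theorem dilation_design_cube (p : Fin d × Fin d) :
    dilation (design p) * dilation (design p) * dilation (design p) = dilation (design p) := by
  rw [dilation_design_sq]
  simp [dilation, design, fromBlocks_multiply]

open scoped Matrix.Norms.Operator in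
theorem exp_smul_dilation_design (p : Fin d × Fin d) (c : ℝ) :
    NormedSpace.exp (c • dilation (design p)) = 1 + (Real.cosh c - 1) •
      fromBlocks (Matrix.single p.1 p.1 1) 0 0 (Matrix.single p.2 p.2 1) +
      Real.sinh c • dilation (design p) := by
  rw [← dilation_design_sq]
  exact exp_smul_of_mul_mul_self (dilation_design_cube p) c

theorem matInner_design (p : Fin d × Fin d) (A : Matrix (Fin d) (Fin d) ℝ) :
    matInner (design p) A = A p.1 p.2 := by
  rw [matInner_comm, matInner, design, Matrix.trace_mul_single]
  simp

theorem dotProduct_single_mulVec (i j : Fin d) (x y : Fin d → ℝ) :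
    x ⬝ᵥ Matrix.single i j (1 : ℝ) *ᵥ y = x i * y j := by
  rw [Matrix.single_mulVec, one_mul]
  exact dotProduct_single x (y j) i

/-- This reduces the single-sample matrix moment bounds to scalar ones: the `sinh` term is removed
to leading order by centering, and the `cosh` term plays the role of the variance. -/
theorem dotProduct_exp_smul_dilation_design (p : Fin d × Fin d) (c : ℝ) (x y : Fin d → ℝ) :
    Sum.elim x y ⬝ᵥ NormedSpace.exp (c • dilation (design p)) *ᵥ Sum.elim x y =
      (x ⬝ᵥ x + y ⬝ᵥ y) + (Real.cosh c - 1) * (x p.1 ^ 2 + y p.2 ^ 2) +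
        Real.sinh c * (2 * (x p.1 * y p.2)) := by
  rw [exp_smul_dilation_design, Matrix.add_mulVec, Matrix.add_mulVec, Matrix.one_mulVec,
    smul_mulVec, smul_mulVec, dotProduct_add, dotProduct_add, dotProduct_smul, dotProduct_smul,
    dotProduct_dilation, fromBlocks_mulVec, sumElim_dotProduct_sumElim,
    sumElim_dotProduct_sumElim, design, dotProduct_single_mulVec]
  simp only [Sum.elim_comp_inl, Sum.elim_comp_inr, Matrix.zero_mulVec, zero_add, add_zero,
    dotProduct_single_mulVec, smul_eq_mul]
  ring

/-! ### Trace exponential moments of sums of independent symmetric matrices. -/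

section TraceExp

variable {m : Type*} [Fintype m] [DecidableEq m]

/-- Splitting `exp S` as `R * R` with `R` symmetric turns the trace into a sum of quadratic forms of
`E` at the rows of `R`. In particular `E` need not be symmetric. -/
theorem trace_mul_exp_le {E S : Matrix m m ℝ} {b : ℝ} (hE : ∀ v, v ⬝ᵥ E *ᵥ v ≤ b * (v ⬝ᵥ v))
    (hS : Sᵀ = S) : (E * NormedSpace.exp S).trace ≤ b * (NormedSpace.exp S).trace := by
  set R := NormedSpace.exp ((2 : ℝ)⁻¹ • S) with hR
  have hRt : Rᵀ = R := by rw [hR, ← Matrix.exp_transpose, Matrix.transpose_smul, hS]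
  have h : NormedSpace.exp S = R * R := by
    rw [hR, ← Matrix.exp_add_of_commute _ _ (Commute.refl _), ← add_smul]
    norm_num
  have key : ∀ M : Matrix m m ℝ, (M * (R * R)).trace = ∑ i, R i ⬝ᵥ M *ᵥ R i := by
    intro M
    rw [← Matrix.mul_assoc, Matrix.trace_mul_comm, Matrix.trace]
    refine Finset.sum_congr rfl fun i _ => ?_
    rw [Matrix.diag_apply, ← Matrix.mul_assoc, Matrix.mul_assoc, Matrix.mul_apply']
    congr 1
    funext j
    change (M * R) j i = _
    rw [Matrix.mul_apply', Matrix.mulVec]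
    congr 1
    funext k
    conv_lhs => rw [← hRt]
    rfl
  have key1 := key 1
  rw [Matrix.one_mul] at key1
  rw [h, key, key1, Finset.mul_sum]
  refine Finset.sum_le_sum fun i _ => ?_
  rw [Matrix.one_mulVec]
  exact hE (R i)

/-- A finite form of the trace exponential moment bound for sums of independent symmetric
matrices. -/
theorem sum_trace_exp_sum_le {T : Type*} [Fintype T] (F : T → Matrix m m ℝ)
    (hF : ∀ t, (F t)ᵀ = F t) {b : ℝ} (hb : 0 ≤ b)
    (h : ∀ v, ∑ t, v ⬝ᵥ NormedSpace.exp (F t) *ᵥ v ≤ b * (v ⬝ᵥ v)) (n : ℕ) :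
    ∑ z : Fin n → T, (NormedSpace.exp (∑ k, F (z k))).trace ≤ b ^ n * Fintype.card m := by
  induction n with
  | zero => simp
  | succ n ih =>
    rw [← (Fin.consEquiv (fun _ => T)).sum_comp, Fintype.sum_prod_type_right, pow_succ', mul_assoc]
    refine le_trans ?_ (mul_le_mul_of_nonneg_left ih hb)
    rw [Finset.mul_sum]
    refine Finset.sum_le_sum fun z _ => ?_
    have hS : (∑ k, F (z k))ᵀ = ∑ k, F (z k) := by simp [Matrix.transpose_sum, hF]
    have h1 : ∀ t : T, (NormedSpace.exp (∑ k, F ((Fin.consEquiv fun _ => T) (t, z) k))).trace ≤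
        (NormedSpace.exp (F t) * NormedSpace.exp (∑ k, F (z k))).trace := by
      intro t
      rw [Fin.sum_univ_succ]
      exact trace_exp_add_le (hF t) hS
    refine (Finset.sum_le_sum fun t _ => h1 t).trans ?_
    rw [← Matrix.trace_sum, ← Finset.sum_mul]
    refine trace_mul_exp_le (fun v => ?_) hS
    rw [Matrix.sum_mulVec, dotProduct_sum]
    exact h v

open scoped Matrix.Norms.Operator in
theorem measurable_exp_apply {E : Type*} [MeasurableSpace E] {F : E → Matrix m m ℝ}
    (hF : ∀ p q, Measurable fun e => F e p q) (p q : m) :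
    Measurable fun e => NormedSpace.exp (F e) p q := by
  have h1 : Continuous fun M : m → m → ℝ => (NormedSpace.exp (Matrix.of M)) p q := by
    have : Continuous fun M : Matrix m m ℝ => NormedSpace.exp M :=
      NormedSpace.exp_continuous (𝔸 := Matrix m m ℝ)
    exact (this.comp (continuous_id : Continuous fun M : m → m → ℝ => Matrix.of M)).matrix_elem p q
  have h2 : Measurable fun e => (fun p q => F e p q : m → m → ℝ) :=
    measurable_pi_lambda _ fun p => measurable_pi_lambda _ fun q => hF p q
  exact h1.measurable.comp h2

theorem measurable_trace_exp {E : Type*} [MeasurableSpace E] {F : E → Matrix m m ℝ}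
    (hF : ∀ p q, Measurable fun e => F e p q) :
    Measurable fun e => (NormedSpace.exp (F e)).trace :=
  Finset.measurable_sum _ fun p _ => measurable_exp_apply hF p p

theorem trace_exp_nonneg {A : Matrix m m ℝ} (hA : Aᵀ = A) : 0 ≤ (NormedSpace.exp A).trace :=
  (exp_posSemidef hA).trace_nonneg

/-- The trace exponential moment bound for sums of independent symmetric matrices. -/
theorem lintegral_trace_exp_sum_le {E : Type*} [MeasurableSpace E] (F : E → Matrix m m ℝ)
    (hF : ∀ t, (F t)ᵀ = F t) (hmeas : ∀ p q, Measurable fun e => F e p q) {b : ℝ} (hb : 0 ≤ b)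
    {n : ℕ} (ν : Fin n → Measure E) [∀ k, IsProbabilityMeasure (ν k)]
    (hint : ∀ k p q, Integrable (fun e => NormedSpace.exp (F e) p q) (ν k))
    (h : ∀ k v, ∫ e, v ⬝ᵥ NormedSpace.exp (F e) *ᵥ v ∂ν k ≤ b * (v ⬝ᵥ v)) :
    ∫⁻ z, ENNReal.ofReal (NormedSpace.exp (∑ k, F (z k))).trace ∂Measure.pi ν ≤
      ENNReal.ofReal (b ^ n * Fintype.card m) := by
  induction n with
  | zero => simp
  | succ n ih =>
    have hmp := (measurePreserving_piFinSuccAbove ν 0).symm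
    rw [← hmp.lintegral_comp_emb (MeasurableEquiv.measurableEmbedding _)]
    have hsum : ∀ p q, Measurable fun z : Fin n → E => (∑ k, F (z k)) p q := by
      intro p q
      simp only [Matrix.sum_apply]
      exact Finset.measurable_sum _ fun k _ => (hmeas p q).comp (measurable_pi_apply k)
    have hsymm : ∀ z : Fin n → E, (∑ k, F (z k))ᵀ = ∑ k, F (z k) := fun z => by
      simp [Matrix.transpose_sum, hF]
    have hle : ∀ w : E × (Fin n → E), ENNReal.ofReal (NormedSpace.exp (∑ k, F
        ((MeasurableEquiv.piFinSuccAbove (fun _ => E) 0).symm w k))).trace ≤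
        ENNReal.ofReal (NormedSpace.exp (F w.1) * NormedSpace.exp (∑ k, F (w.2 k))).trace := by
      intro w
      refine ENNReal.ofReal_le_ofReal ?_
      rw [Fin.sum_univ_succ]
      -- Golden–Thompson separates the first sample from the rest; the first is then averaged with
      -- the others frozen.
      exact trace_exp_add_le (hF w.1) (hsymm w.2)
    refine (lintegral_mono hle).trans ?_
    have hmeas2 : Measurable fun w : E × (Fin n → E) => ENNReal.ofReal
        (NormedSpace.exp (F w.1) * NormedSpace.exp (∑ k, F (w.2 k))).trace := by
      refine ENNReal.measurable_ofReal.comp ?_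
      simp only [Matrix.trace, Matrix.diag_apply, Matrix.mul_apply]
      exact Finset.measurable_sum _ fun p _ => Finset.measurable_sum _ fun q _ =>
        ((measurable_exp_apply hmeas p q).comp measurable_fst).mul
          ((measurable_exp_apply hsum q p).comp measurable_snd)
    rw [lintegral_prod_symm _ hmeas2.aemeasurable]
    have hinner : ∀ z : Fin n → E, ∫⁻ e, ENNReal.ofReal
        (NormedSpace.exp (F e) * NormedSpace.exp (∑ k, F (z k))).trace ∂ν 0 ≤
        ENNReal.ofReal b * ENNReal.ofReal (NormedSpace.exp (∑ k, F (z k))).trace := by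
      intro z
      set G := NormedSpace.exp (∑ k, F (z k)) with hG
      have hi : Integrable (fun e => (NormedSpace.exp (F e) * G).trace) (ν 0) := by
        simp only [Matrix.trace, Matrix.diag_apply, Matrix.mul_apply]
        exact integrable_finsetSum _ fun p _ => integrable_finsetSum _ fun q _ =>
          (hint 0 p q).mul_const _
      have hpos : ∀ e, 0 ≤ (NormedSpace.exp (F e) * G).trace := fun e =>
        (trace_exp_nonneg (A := F e + ∑ k, F (z k))
          (by rw [Matrix.transpose_add, hF, hsymm])).trans (trace_exp_add_le (hF e) (hsymm z))
      rw [← ofReal_integral_eq_lintegral_ofReal hi (Filter.Eventually.of_forall hpos),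
        ← ENNReal.ofReal_mul hb]
      refine ENNReal.ofReal_le_ofReal ?_
      -- The entrywise mean of the first factor: the hypothesis on quadratic forms bounds `M` by
      -- `b`, and averaging commutes with the linear trace.
      set M : Matrix m m ℝ := Matrix.of fun p q => ∫ e, NormedSpace.exp (F e) p q ∂ν 0 with hM
      have h1 : ∫ e, (NormedSpace.exp (F e) * G).trace ∂ν 0 = (M * G).trace := by
        simp only [Matrix.trace, Matrix.diag_apply, Matrix.mul_apply]
        rw [integral_finsetSum _ fun p _ => integrable_finsetSum _ fun q _ =>
          (hint 0 p q).mul_const _]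
        refine Finset.sum_congr rfl fun p _ => ?_
        rw [integral_finsetSum _ fun q _ => (hint 0 p q).mul_const _]
        refine Finset.sum_congr rfl fun q _ => ?_
        rw [integral_mul_const]
        rfl
      rw [h1]
      refine trace_mul_exp_le (fun v => ?_) (hsymm z)
      refine le_trans (le_of_eq ?_) (h 0 v)
      simp only [dotProduct, Matrix.mulVec]
      rw [integral_finsetSum _ fun p _ => (integrable_finsetSum _ fun q _ =>
          (hint 0 p q).mul_const _).const_mul _]
      refine Finset.sum_congr rfl fun p _ => ?_
      rw [integral_const_mul, integral_finsetSum _ fun q _ => (hint 0 p q).mul_const _]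
      congr 1
      refine Finset.sum_congr rfl fun q _ => ?_
      rw [integral_mul_const]
      rfl
    refine (lintegral_mono hinner).trans ?_
    rw [lintegral_const_mul' _ _ ENNReal.ofReal_ne_top, pow_succ', mul_assoc,
      ENNReal.ofReal_mul hb]
    gcongr
    exact ih (fun k => ν (Fin.succAbove 0 k)) (fun k => hint _) (fun k => h _)

end TraceExp

end QMC

/-! ### Symmetrization and contraction -/

namespace QMC

open Matrix

/-- Weak majorization for the convex increasing exponential. In the main case `B ≤ p ≤ A`, one
replaces `q` by `A + B - p`, and the gap becomes `(exp A - exp p) * (exp p - exp B) / exp p`. -/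
theorem exp_add_exp_le_of_add_le {p q A B : ℝ} (h : p + q ≤ A + B) (hp : p ≤ max A B)
    (hq : q ≤ max A B) : Real.exp p + Real.exp q ≤ Real.exp A + Real.exp B := by
  wlog hAB : B ≤ A generalizing A B
  · rw [add_comm (Real.exp A)]
    exact this (by linarith) (by rwa [max_comm]) (by rwa [max_comm]) (le_of_not_ge hAB)
  wlog hpq : q ≤ p generalizing p q
  · rw [add_comm (Real.exp p)]
    exact this (by linarith) hq hp (le_of_not_ge hpq)
  rw [max_eq_left hAB] at hp hq
  rcases le_total p B with hpB | hpB
  · exact add_le_add (Real.exp_le_exp.2 hp) (Real.exp_le_exp.2 (hpq.trans hpB))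
  · have hq' : Real.exp q ≤ Real.exp A * Real.exp B / Real.exp p := by
      rw [← Real.exp_add, ← Real.exp_sub]
      exact Real.exp_le_exp.2 (by linarith)
    have h1 := Real.exp_le_exp.2 hp
    have h2 := Real.exp_le_exp.2 hpB
    have hpos := Real.exp_pos p
    suffices h3 : Real.exp p + Real.exp A * Real.exp B / Real.exp p ≤
        Real.exp A + Real.exp B by linarith
    rw [← sub_nonneg]
    have h4 : Real.exp A + Real.exp B - (Real.exp p + Real.exp A * Real.exp B / Real.exp p) =
        (Real.exp A - Real.exp p) * (Real.exp p - Real.exp B) / Real.exp p := by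
      field_simp
      ring
    rw [h4]
    exact div_nonneg (mul_nonneg (by linarith) (by linarith)) hpos.le

section Processes

variable {ι : Type*} [Finite ι] [Nonempty ι]

theorem le_ciSup_of_finite {ι : Type*} [Finite ι] (f : ι → ℝ) (i : ι) : f i ≤ ⨆ i, f i :=
  le_ciSup (Set.finite_range f).bddAbove i

/-- The contraction step for a single sign. The Lipschitz condition compares the sums of the two
suprema: for each pair `i, j` the indices may be interchanged according to the sign of `t i - t j`.
The bound `h0` keeps each supremum below the larger of the two targets. -/
theorem exp_iSup_contraction (g t s : ι → ℝ) (hL : ∀ i j, |s i - s j| ≤ |t i - t j|)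
    (h0 : ∀ i, |s i| ≤ |t i|) :
    Real.exp (⨆ i, (g i + s i)) + Real.exp (⨆ i, (g i - s i)) ≤
      Real.exp (⨆ i, (g i + t i)) + Real.exp (⨆ i, (g i - t i)) := by
  set A := ⨆ i, (g i + t i) with hA
  set B := ⨆ i, (g i - t i) with hB
  have hAi : ∀ i, g i + t i ≤ A := le_ciSup_of_finite _
  have hBi : ∀ i, g i - t i ≤ B := le_ciSup_of_finite _
  apply exp_add_exp_le_of_add_le
  · have h1 : ∀ i j, (g i + s i) + (g j - s j) ≤ A + B := by
      intro i j
      have h2 := (le_abs_self _).trans (hL i j)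
      rcases abs_cases (t i - t j) with h | h
      · linarith [hAi i, hBi j]
      · linarith [hAi j, hBi i]
    have h3 : ∀ i, (g i + s i) ≤ A + B - ⨆ j, (g j - s j) := by
      intro i
      have : ⨆ j, (g j - s j) ≤ A + B - (g i + s i) := ciSup_le fun j => by linarith [h1 i j]
      linarith
    linarith [ciSup_le h3]
  · refine ciSup_le fun i => ?_
    have h2 := (le_abs_self _).trans (h0 i)
    rcases abs_cases (t i) with h | h
    · exact le_max_of_le_left (by linarith [hAi i])
    · exact le_max_of_le_right (by linarith [hBi i])
  · refine ciSup_le fun i => ?_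
    have h2 := (neg_abs_le (s i)).trans' (neg_le_neg (h0 i))
    rcases abs_cases (t i) with h | h
    · exact le_max_of_le_left (by linarith [hAi i])
    · exact le_max_of_le_right (by linarith [hBi i])

/-- The sign attached to a Boolean. -/
def sgn (b : Bool) : ℝ := if b then 1 else -1

/-- The contraction principle for exponential moments of Rademacher processes. -/
theorem sum_exp_iSup_contraction {n : ℕ} (g : ι → ℝ) (t s : Fin n → ι → ℝ)
    (hL : ∀ k i j, |s k i - s k j| ≤ |t k i - t k j|) (h0 : ∀ k i, |s k i| ≤ |t k i|) :
    ∑ e : Fin n → Bool, Real.exp (⨆ i, (g i + ∑ k, sgn (e k) * s k i)) ≤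
      ∑ e : Fin n → Bool, Real.exp (⨆ i, (g i + ∑ k, sgn (e k) * t k i)) := by
  induction n generalizing g with
  | zero => simp
  | succ n ih =>
    rw [← (Fin.consEquiv (fun _ => Bool)).sum_comp, ← (Fin.consEquiv (fun _ => Bool)).sum_comp,
      Fintype.sum_prod_type_right, Fintype.sum_prod_type]
    have h1 : ∀ e : Fin n → Bool,
        ∑ b : Bool, Real.exp (⨆ i, (g i + ∑ k, sgn (Fin.consEquiv (fun _ => Bool) (b, e) k) *
          s k i)) ≤ ∑ b : Bool, Real.exp (⨆ i, ((g i + sgn b * t 0 i) +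
            ∑ k : Fin n, sgn (e k) * s k.succ i)) := by
      intro e
      have := exp_iSup_contraction (fun i => g i + ∑ k : Fin n, sgn (e k) * s k.succ i) (t 0) (s 0)
        (hL 0) (h0 0)
      rw [Fintype.sum_bool, Fintype.sum_bool]
      simp only [Fin.sum_univ_succ, Fin.consEquiv_apply, Fin.cons_zero, Fin.cons_succ, sgn,
        if_true, one_mul, Bool.false_eq_true, if_false, neg_one_mul] at this ⊢
      convert this using 4
      all_goals (funext i; ring)
    refine (Finset.sum_le_sum fun e _ => h1 e).trans ?_
    rw [Finset.sum_comm]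
    refine Finset.sum_le_sum fun b _ => ?_
    refine (ih (fun i => g i + sgn b * t 0 i) (fun k => t k.succ) (fun k => s k.succ)
      (fun k => hL k.succ) (fun k => h0 k.succ)).trans (le_of_eq ?_)
    refine Finset.sum_congr rfl fun e _ => ?_
    simp only [Fin.sum_univ_succ, Fin.consEquiv_apply, Fin.cons_zero, Fin.cons_succ, add_assoc]

variable {P : Type*} [Fintype P] [Nonempty P]

/-- Introduces a ghost sample `J'`: the mean is an average over `J'`, and Jensen's inequality moves
that average outside the supremum and then outside the exponential. -/
theorem exp_iSup_mean_sub_le {n : ℕ} (f : ι → P → ℝ) (J : Fin n → P) :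
    (Fintype.card P : ℝ) ^ n *
        Real.exp (⨆ i, (n * ((Fintype.card P : ℝ)⁻¹ * ∑ p, f i p) - ∑ k, f i (J k))) ≤
      ∑ J' : Fin n → P, Real.exp (⨆ i, ∑ k, (f i (J' k) - f i (J k))) := by
  classical
  have hN : (0 : ℝ) < Fintype.card P := by exact_mod_cast Fintype.card_pos
  have hNn : (0 : ℝ) < (Fintype.card P : ℝ) ^ n := by positivity
  set w : ℝ := ((Fintype.card P : ℝ) ^ n)⁻¹ with hw
  have hw0 : 0 < w := by positivity
  have hw1 : ∑ _J' : Fin n → P, w = 1 := by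
    rw [Finset.sum_const, Finset.card_univ, Fintype.card_fun, Fintype.card_fin, nsmul_eq_mul, hw]
    push_cast
    exact mul_inv_cancel₀ hNn.ne'
  have hmean : ∀ i, (n : ℝ) * ((Fintype.card P : ℝ)⁻¹ * ∑ p, f i p) - ∑ k, f i (J k) =
      ∑ J' : Fin n → P, w * ∑ k, (f i (J' k) - f i (J k)) := by
    intro i
    simp only [Finset.sum_sub_distrib, mul_sub]
    rw [← Finset.sum_mul, hw1, one_mul, ← Finset.mul_sum, Finset.sum_comm]
    congr 1
    have h1 : ∀ k : Fin n, ∑ J' : Fin n → P, f i (J' k) =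
        (Fintype.card P : ℝ) ^ (n - 1) * ∑ p, f i p := by
      intro k
      have := Fintype.sum_piFinset_apply (f i) (Finset.univ : Finset P) k
      rw [Fintype.piFinset_univ] at this
      rw [this]
      simp
    simp only [h1, Finset.sum_const, Finset.card_univ, Fintype.card_fin, nsmul_eq_mul]
    rcases n with _ | n
    · simp
    · rw [hw, Nat.add_sub_cancel, pow_succ]
      field_simp
  have hsup : ⨆ i, (n * ((Fintype.card P : ℝ)⁻¹ * ∑ p, f i p) - ∑ k, f i (J k)) ≤
      ∑ J' : Fin n → P, w * ⨆ i, ∑ k, (f i (J' k) - f i (J k)) := by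
    refine ciSup_le fun i => ?_
    rw [hmean]
    refine Finset.sum_le_sum fun J' _ => mul_le_mul_of_nonneg_left ?_ hw0.le
    exact le_ciSup_of_finite (fun i => ∑ k, (f i (J' k) - f i (J k))) i
  have hJ := convexOn_exp.map_sum_le (t := Finset.univ) (w := fun _ : Fin n → P => w)
    (p := fun J' : Fin n → P => ⨆ i, ∑ k, (f i (J' k) - f i (J k)))
    (fun _ _ => hw0.le) hw1 (fun _ _ => Set.mem_univ _)
  simp only [smul_eq_mul] at hJ
  have h := (Real.exp_le_exp.2 hsup).trans hJ
  rw [← Finset.mul_sum, hw, ← div_eq_inv_mul, le_div_iff₀ hNn] at h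
  linarith

/-- Exchanging chosen coordinates of a sample and its ghost is an involution on pairs. This is the
exchangeability behind symmetrization. -/
theorem sum_sum_swap {P : Type*} [Fintype P] {n : ℕ} (e : Fin n → Bool) (Φ : (Fin n → P) → (Fin n → P) → ℝ) :
    ∑ J : Fin n → P, ∑ J' : Fin n → P, Φ J J' =
      ∑ J : Fin n → P, ∑ J' : Fin n → P,
        Φ (fun k => if e k then J k else J' k) (fun k => if e k then J' k else J k) := by
  rw [← Fintype.sum_prod_type', ← Fintype.sum_prod_type']
  let S : (Fin n → P) × (Fin n → P) → (Fin n → P) × (Fin n → P) := fun q =>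
    (fun k => if e k then q.1 k else q.2 k, fun k => if e k then q.2 k else q.1 k)
  have hS : Function.Involutive S := by
    intro q
    refine Prod.ext (funext fun k => ?_) (funext fun k => ?_) <;>
      by_cases h : e k <;> simp [S, h]
  exact (Equiv.sum_comp hS.toPerm (fun q : (Fin n → P) × (Fin n → P) => Φ q.1 q.2)).symm

/-- Symmetrization for exponential moments of one-sided suprema. -/
theorem sum_exp_iSup_mean_sub_le {n : ℕ} (f : ι → P → ℝ) :
    (2 : ℝ) ^ n * ∑ J : Fin n → P,
        Real.exp (⨆ i, (n * ((Fintype.card P : ℝ)⁻¹ * ∑ p, f i p) - ∑ k, f i (J k))) ≤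
      ∑ J : Fin n → P, ∑ e : Fin n → Bool,
        Real.exp (⨆ i, ∑ k, sgn (e k) * (2 * f i (J k))) := by
  classical
  have hN : (0 : ℝ) < Fintype.card P := by exact_mod_cast Fintype.card_pos
  have hNn : (0 : ℝ) < (Fintype.card P : ℝ) ^ n := by positivity
  set Z := ∑ J : Fin n → P, ∑ J' : Fin n → P,
    Real.exp (⨆ i, ∑ k, (f i (J' k) - f i (J k))) with hZ
  have h1 : (Fintype.card P : ℝ) ^ n * ∑ J : Fin n → P,
      Real.exp (⨆ i, (n * ((Fintype.card P : ℝ)⁻¹ * ∑ p, f i p) - ∑ k, f i (J k))) ≤ Z := by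
    rw [Finset.mul_sum]
    exact Finset.sum_le_sum fun J _ => exp_iSup_mean_sub_le f J
  set R : (Fin n → Bool) → ℝ := fun e => ∑ J : Fin n → P,
    Real.exp (⨆ i, ∑ k, sgn (e k) * (2 * f i (J k))) with hR
  have h2 : ∀ e : Fin n → Bool, Z ≤
      2⁻¹ * ((Fintype.card P : ℝ) ^ n * R e + (Fintype.card P : ℝ) ^ n * R (fun k => !e k)) := by
    intro e
    rw [hZ, sum_sum_swap e]
    -- Convexity at the midpoint separates sample from ghost. This is the origin of the factor `2`
    -- in front of `f`. The ghost term carries the signs `e` and the sample term the opposite signs,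
    -- which sum to the same total over all `e`.
    have hb : ∀ J J' : Fin n → P, Real.exp (⨆ i, ∑ k,
        (f i (if e k then J' k else J k) - f i (if e k then J k else J' k))) ≤
        2⁻¹ * (Real.exp (⨆ i, ∑ k, sgn (e k) * (2 * f i (J' k))) +
          Real.exp (⨆ i, ∑ k, sgn (!e k) * (2 * f i (J k)))) := by
      intro J J'
      set a := ⨆ i, ∑ k, sgn (e k) * (2 * f i (J' k)) with ha
      set b := ⨆ i, ∑ k, sgn (!e k) * (2 * f i (J k)) with hb
      have hab : ⨆ i, ∑ k, (f i (if e k then J' k else J k) - f i (if e k then J k else J' k)) ≤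
          2⁻¹ * a + 2⁻¹ * b := by
        refine ciSup_le fun i => ?_
        have ha' : ∑ k, sgn (e k) * (2 * f i (J' k)) ≤ a :=
          le_ciSup_of_finite (fun i => ∑ k, sgn (e k) * (2 * f i (J' k))) i
        have hb' : ∑ k, sgn (!e k) * (2 * f i (J k)) ≤ b :=
          le_ciSup_of_finite (fun i => ∑ k, sgn (!e k) * (2 * f i (J k))) i
        have heq : ∑ k, (f i (if e k then J' k else J k) - f i (if e k then J k else J' k)) =
            2⁻¹ * ∑ k, sgn (e k) * (2 * f i (J' k)) +
              2⁻¹ * ∑ k, sgn (!e k) * (2 * f i (J k)) := by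
          rw [Finset.mul_sum, Finset.mul_sum, ← Finset.sum_add_distrib]
          refine Finset.sum_congr rfl fun k _ => ?_
          by_cases h : e k <;> simp [h, sgn] <;> ring
        rw [heq]
        linarith
      have hconv := convexOn_exp.2 (Set.mem_univ a) (Set.mem_univ b)
        (by norm_num : (0 : ℝ) ≤ 2⁻¹) (by norm_num : (0 : ℝ) ≤ 2⁻¹) (by norm_num)
      simp only [smul_eq_mul] at hconv
      refine (Real.exp_le_exp.2 hab).trans (hconv.trans (le_of_eq ?_))
      ring
    refine (Finset.sum_le_sum fun J _ => Finset.sum_le_sum fun J' _ => hb J J').trans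
      (le_of_eq ?_)
    simp only [← Finset.mul_sum, Finset.sum_add_distrib, Finset.sum_const, Finset.card_univ,
      Fintype.card_fun, Fintype.card_fin, nsmul_eq_mul, Nat.cast_pow, hR]
  have h3 : ∑ e : Fin n → Bool, R (fun k => !e k) = ∑ e, R e :=
    Equiv.sum_comp (Equiv.arrowCongr (Equiv.refl (Fin n)) Equiv.boolNot) R
  have h4 := Finset.sum_le_sum fun (e : Fin n → Bool) (_ : e ∈ Finset.univ) => h2 e
  rw [← Finset.mul_sum, Finset.sum_add_distrib, ← Finset.mul_sum, ← Finset.mul_sum, h3,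
    Finset.sum_const, Finset.card_univ, Fintype.card_fun, Fintype.card_fin, Fintype.card_bool,
    nsmul_eq_mul] at h4
  push_cast at h4
  rw [Finset.sum_comm]
  change _ ≤ ∑ e, R e
  have h5 := mul_le_mul_of_nonneg_left h1 (by positivity : (0 : ℝ) ≤ 2 ^ n)
  refine le_of_mul_le_mul_left ?_ hNn
  linarith

end Processes

end QMC

/-! ### Restricted convexity of the sampling operator -/

namespace QMC

open Matrix

variable {d n : ℕ}

theorem cosh_sub_one_le_sq {x : ℝ} (hx : |x| ≤ 1) : Real.cosh x - 1 ≤ x ^ 2 := by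
  have h1 := (abs_le.1 (Real.abs_exp_sub_one_sub_id_le hx)).2
  have h2 := (abs_le.1 (Real.abs_exp_sub_one_sub_id_le (x := -x) (by rwa [abs_neg]))).2
  rw [Real.cosh_eq]
  nlinarith

/-- The variance computation: after division by the `d²` positions, the squared design averages to
`1 / d`. -/
theorem sum_design_sq (x y : Fin d → ℝ) :
    ∑ p : Fin d × Fin d, (x p.1 ^ 2 + y p.2 ^ 2) = d * (x ⬝ᵥ x + y ⬝ᵥ y) := by
  rw [Fintype.sum_prod_type]
  simp only [Finset.sum_add_distrib, Finset.sum_const, Finset.card_univ, Fintype.card_fin,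
    nsmul_eq_mul, dotProduct, sq, ← Finset.mul_sum]
  ring

theorem eq_sumElim {α β γ : Type*} (v : α ⊕ β → γ) :
    v = Sum.elim (fun i => v (Sum.inl i)) (fun i => v (Sum.inr i)) := by
  funext i
  cases i <;> rfl

/-- Exponential moment bound for the Rademacher average of the design matrices. -/
theorem sum_trace_exp_rademacher_le [NeZero d] {κ : ℝ} (hκ0 : 0 ≤ κ) (hκ : κ ≤ 1) :
    ∑ z : Fin n → (Fin d × Fin d) × Bool,
      (NormedSpace.exp (∑ k, (κ * sgn (z k).2) • dilation (design (z k).1))).trace ≤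
      (2 * (d : ℝ) ^ 2 * Real.exp (κ ^ 2 / d)) ^ n * (2 * d) := by
  have hd : (0 : ℝ) < d := by exact_mod_cast Nat.pos_of_ne_zero (NeZero.ne d)
  have h := sum_trace_exp_sum_le (T := (Fin d × Fin d) × Bool)
    (fun z => (κ * sgn z.2) • dilation (design z.1))
    (fun z => by rw [Matrix.transpose_smul, dilation_transpose])
    (b := 2 * (d : ℝ) ^ 2 * Real.exp (κ ^ 2 / d)) (by positivity) ?_ n
  · refine h.trans (le_of_eq ?_)
    simp [two_mul]
  · intro v
    rw [eq_sumElim v]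
    generalize (fun i => v (Sum.inl i)) = x
    generalize (fun i => v (Sum.inr i)) = y
    simp only [dotProduct_exp_smul_dilation_design, sumElim_dotProduct_sumElim]
    rw [Fintype.sum_prod_type]
    simp only [Fintype.sum_bool, sgn, if_true, Bool.false_eq_true, if_false, mul_one, mul_neg,
      Real.cosh_neg, Real.sinh_neg]
    have hc := cosh_sub_one_le_sq (x := κ) (by rwa [abs_of_nonneg hκ0])
    have h0 : 0 ≤ x ⬝ᵥ x + y ⬝ᵥ y :=
      add_nonneg (dotProduct_self_nonneg' x) (dotProduct_self_nonneg' y)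
    -- The odd `sinh` terms cancel between the two signs.
    have h1 : ∀ p : Fin d × Fin d, (x ⬝ᵥ x + y ⬝ᵥ y + (Real.cosh κ - 1) * (x p.1 ^ 2 + y p.2 ^ 2) +
        Real.sinh κ * (2 * (x p.1 * y p.2)) + (x ⬝ᵥ x + y ⬝ᵥ y + (Real.cosh κ - 1) *
          (x p.1 ^ 2 + y p.2 ^ 2) + -Real.sinh κ * (2 * (x p.1 * y p.2)))) =
        2 * (x ⬝ᵥ x + y ⬝ᵥ y) + 2 * (Real.cosh κ - 1) * (x p.1 ^ 2 + y p.2 ^ 2) := fun p => by ring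
    rw [Finset.sum_congr rfl fun p _ => h1 p, Finset.sum_add_distrib,
      ← Finset.mul_sum (f := fun p : Fin d × Fin d => x p.1 ^ 2 + y p.2 ^ 2),
      sum_design_sq, Finset.sum_const, Finset.card_univ, Fintype.card_prod, Fintype.card_fin,
      nsmul_eq_mul]
    push_cast
    have h2 := Real.add_one_le_exp (κ ^ 2 / d)
    have h3 : (Real.cosh κ - 1) / d ≤ κ ^ 2 / d := div_le_div_of_nonneg_right hc hd.le
    have h4 : (d : ℝ) * d * (2 * (x ⬝ᵥ x + y ⬝ᵥ y)) +
        2 * (Real.cosh κ - 1) * (d * (x ⬝ᵥ x + y ⬝ᵥ y)) =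
        2 * (d : ℝ) ^ 2 * (1 + (Real.cosh κ - 1) / d) * (x ⬝ᵥ x + y ⬝ᵥ y) := by
      field_simp
    rw [h4]
    refine mul_le_mul_of_nonneg_right ?_ h0
    exact mul_le_mul_of_nonneg_left (by linarith) (by positivity)

theorem le_log_trace_exp_dilation [NeZero d] {ρ : ℝ} {D : Matrix (Fin d) (Fin d) ℝ}
    (hD : nuclearNorm D ≤ ρ) (M : Matrix (Fin d) (Fin d) ℝ) :
    matInner M D ≤ Real.log (NormedSpace.exp (dilation M)).trace * ρ := by
  have h := opLe_log_trace_exp_dilation M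
  -- Nonnegativity, needed to replace the nuclear norm by its bound `ρ`, comes from testing at a
  -- unit vector paired with zero.
  have h0 : 0 ≤ Real.log (NormedSpace.exp (dilation M)).trace := by
    have := h (Pi.single 0 1) 0
    simpa using this
  exact (h.matInner_le D).trans (mul_le_mul_of_nonneg_left hD h0)

/-- Exponential moment bound for the deviation of the empirical quadratic forms. -/
theorem sum_exp_iSup_frobNorm_sub_le [NeZero d] {ι : Type*} [Finite ι] [Nonempty ι]
    {a ρ κ : ℝ} (ha : 0 < a) (hρ : 0 < ρ) (hκ0 : 0 < κ) (hκ : κ ≤ 1)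
    (D : ι → Matrix (Fin d) (Fin d) ℝ) (hDa : ∀ i p q, |D i p q| ≤ a)
    (hDρ : ∀ i, nuclearNorm (D i) ≤ ρ) :
    ∑ J : Fin n → Fin d × Fin d, Real.exp (⨆ i, κ / (4 * a * ρ) *
      (n * (frobNorm (D i) ^ 2 / (d : ℝ) ^ 2) - ∑ k, D i (J k).1 (J k).2 ^ 2)) ≤
      ((d : ℝ) ^ 2) ^ n * (2 * d * Real.exp (n * κ ^ 2 / d)) := by
  have hd : (0 : ℝ) < d := by exact_mod_cast Nat.pos_of_ne_zero (NeZero.ne d)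
  -- Symmetrization doubles the coefficient, and the square is `2 * a`-Lipschitz on `[-a, a]`; so
  -- contraction leaves `4 * θ * a = κ / ρ`, and duality with nuclear radius `ρ` leaves a Rademacher
  -- sum with weights `κ`.
  set θ := κ / (4 * a * ρ) with hθ
  have hθ0 : 0 < θ := by positivity
  have h1 := sum_exp_iSup_mean_sub_le (n := n) (P := Fin d × Fin d)
    (fun (i : ι) p => θ * D i p.1 p.2 ^ 2)
  have hmean : ∀ i (J : Fin n → Fin d × Fin d), (n : ℝ) * ((Fintype.card (Fin d × Fin d) : ℝ)⁻¹ *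
      ∑ p : Fin d × Fin d, θ * D i p.1 p.2 ^ 2) - ∑ k, θ * D i (J k).1 (J k).2 ^ 2 =
      θ * (n * (frobNorm (D i) ^ 2 / (d : ℝ) ^ 2) - ∑ k, D i (J k).1 (J k).2 ^ 2) := by
    intro i J
    rw [frobNorm_sq, matInner_eq_sum, ← Finset.mul_sum, ← Finset.mul_sum, Fintype.sum_prod_type,
      Fintype.card_prod, Fintype.card_fin]
    push_cast
    simp only [sq]
    ring
  simp only [hmean] at h1
  have h2 : ∀ J : Fin n → Fin d × Fin d, ∑ e : Fin n → Bool,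
      Real.exp (⨆ i, ∑ k, sgn (e k) * (2 * (θ * D i (J k).1 (J k).2 ^ 2))) ≤
      ∑ e : Fin n → Bool, Real.exp (⨆ i, ∑ k, sgn (e k) * (4 * θ * a * D i (J k).1 (J k).2)) := by
    intro J
    have := sum_exp_iSup_contraction (n := n) (fun _ : ι => 0)
      (fun k i => 4 * θ * a * D i (J k).1 (J k).2)
      (fun k i => 2 * (θ * D i (J k).1 (J k).2 ^ 2)) ?_ ?_
    · simpa only [zero_add] using this
    · intro k i j
      set x := D i (J k).1 (J k).2 with hx
      set y := D j (J k).1 (J k).2 with hy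
      have hxa : |x| ≤ a := hDa i _ _
      have hya : |y| ≤ a := hDa j _ _
      have e1 : 2 * (θ * x ^ 2) - 2 * (θ * y ^ 2) = 2 * θ * ((x + y) * (x - y)) := by ring
      have e2 : 4 * θ * a * x - 4 * θ * a * y = 4 * θ * a * (x - y) := by ring
      rw [e1, e2, abs_mul (2 * θ), abs_mul (x + y), abs_mul (4 * θ * a), abs_of_pos (by positivity : 0 < 2 * θ),
        abs_of_pos (by positivity : 0 < 4 * θ * a)]
      have hs : |x + y| ≤ 2 * a := (abs_add_le x y).trans (by linarith)
      nlinarith [mul_le_mul_of_nonneg_right hs (abs_nonneg (x - y)), abs_nonneg (x - y)]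
    · intro k i
      set x := D i (J k).1 (J k).2 with hx
      have hxa : |x| ≤ a := hDa i _ _
      rw [abs_mul, abs_mul, abs_mul, abs_of_pos (by positivity : 0 < 4 * θ * a), abs_pow,
        abs_of_pos hθ0, abs_of_pos (by norm_num : (0 : ℝ) < 2)]
      have := mul_le_mul_of_nonneg_right hxa (abs_nonneg x)
      nlinarith [abs_nonneg x, mul_le_mul_of_nonneg_left this hθ0.le,
        mul_nonneg (mul_nonneg hθ0.le ha.le) (abs_nonneg x)]
  have h3 : ∀ (J : Fin n → Fin d × Fin d) (e : Fin n → Bool),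
      Real.exp (⨆ i, ∑ k, sgn (e k) * (4 * θ * a * D i (J k).1 (J k).2)) ≤
      (NormedSpace.exp (∑ k, (κ * sgn (e k)) • dilation (design (J k)))).trace := by
    intro J e
    set M : Matrix (Fin d) (Fin d) ℝ := ∑ k, (κ * sgn (e k)) • design (J k) with hM
    have hdil : ∑ k, (κ * sgn (e k)) • dilation (design (J k)) = dilation M := by
      rw [hM, dilation_sum]
      simp only [dilation_smul]
    have hne : Nonempty (Fin d ⊕ Fin d) := ⟨Sum.inl 0⟩
    rw [hdil, ← Real.le_log_iff_exp_le (trace_exp_pos (dilation_transpose M))]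
    refine ciSup_le fun i => ?_
    have h4 := le_log_trace_exp_dilation (hDρ i) M
    have h5 : matInner M (D i) = ρ * ∑ k, sgn (e k) * (4 * θ * a * D i (J k).1 (J k).2) := by
      rw [hM, matInner_sum_left, Finset.mul_sum]
      refine Finset.sum_congr rfl fun k _ => ?_
      rw [matInner_smul_left, matInner_design, hθ]
      field_simp
    rw [h5, mul_comm ρ] at h4
    exact le_of_mul_le_mul_right h4 hρ
  have h6 := sum_trace_exp_rademacher_le (d := d) (n := n) hκ0.le hκ
  rw [← (Equiv.arrowProdEquivProdArrow (Fin n) (fun _ => Fin d × Fin d)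
    (fun _ => Bool)).symm.sum_comp, Fintype.sum_prod_type] at h6
  have h7 := h1.trans ((Finset.sum_le_sum fun J _ => (h2 J).trans
    (Finset.sum_le_sum fun e _ => h3 J e)).trans h6)
  have h8 : (2 * (d : ℝ) ^ 2 * Real.exp (κ ^ 2 / d)) ^ n * (2 * d) =
      2 ^ n * (((d : ℝ) ^ 2) ^ n * (2 * d * Real.exp (n * κ ^ 2 / d))) := by
    rw [mul_pow, mul_pow, ← Real.exp_nat_mul, mul_div_assoc]
    ring
  rw [h8] at h7
  exact le_of_mul_le_mul_left h7 (by positivity)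

/-- The event that some matrix in a class violates the restricted strong convexity bound. -/
def ConvexityFails (a ρ u : ℝ) (J : Fin n → Fin d × Fin d) : Prop :=
  ∃ D : Matrix (Fin d) (Fin d) ℝ, (∀ p q, |D p q| ≤ a) ∧ nuclearNorm D ≤ ρ ∧
    u ≤ n * (frobNorm D ^ 2 / (d : ℝ) ^ 2) - ∑ k, D (J k).1 (J k).2 ^ 2

theorem nuclearNorm_zero : nuclearNorm (0 : Matrix (Fin d) (Fin d) ℝ) = 0 := by
  have := nuclearNorm_smul_le (c := 0) le_rfl (0 : Matrix (Fin d) (Fin d) ℝ)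
  rw [zero_smul, zero_mul] at this
  exact le_antisymm this (nuclearNorm_nonneg _)

-- A Chernoff bound by counting. Although the matrix class is infinite, one witness chosen for each
-- position pattern captures every failure, so the finite family indexed by patterns suffices.
open Classical in
theorem card_convexityFails_le [NeZero d] {a ρ κ : ℝ} (ha : 0 < a) (hρ : 0 < ρ) (hκ0 : 0 < κ)
    (hκ : κ ≤ 1) (u : ℝ) :
    ((Finset.univ.filter fun J : Fin n → Fin d × Fin d => ConvexityFails a ρ u J).card : ℝ) ≤
      ((d : ℝ) ^ 2) ^ n * (2 * d * Real.exp (n * κ ^ 2 / d - κ / (4 * a * ρ) * u)) := by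
  have hex : ∀ J : Fin n → Fin d × Fin d, ∃ D : Matrix (Fin d) (Fin d) ℝ,
      (∀ p q, |D p q| ≤ a) ∧ nuclearNorm D ≤ ρ ∧ (ConvexityFails a ρ u J →
        u ≤ n * (frobNorm D ^ 2 / (d : ℝ) ^ 2) - ∑ k, D (J k).1 (J k).2 ^ 2) := by
    intro J
    by_cases h : ConvexityFails a ρ u J
    · obtain ⟨D, h1, h2, h3⟩ := h
      exact ⟨D, h1, h2, fun _ => h3⟩
    -- The zero matrix is a harmless member of the class for patterns without a violation.
    · exact ⟨0, by simpa using ha.le, by simpa [nuclearNorm_zero] using hρ.le, fun h' => absurd h' h⟩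
  choose D hDa hDρ hD using hex
  have h := sum_exp_iSup_frobNorm_sub_le (n := n) ha hρ hκ0 hκ D hDa hDρ
  have hθ : 0 < κ / (4 * a * ρ) := by positivity
  have h1 : ((Finset.univ.filter fun J : Fin n → Fin d × Fin d =>
      ConvexityFails a ρ u J).card : ℝ) * Real.exp (κ / (4 * a * ρ) * u) ≤
      ∑ J : Fin n → Fin d × Fin d, Real.exp (⨆ i, κ / (4 * a * ρ) *
        (n * (frobNorm (D i) ^ 2 / (d : ℝ) ^ 2) - ∑ k, D i (J k).1 (J k).2 ^ 2)) := by
    rw [← nsmul_eq_mul, ← Finset.sum_const, Finset.sum_filter]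
    refine Finset.sum_le_sum fun J _ => ?_
    split_ifs with hJ
    · refine Real.exp_le_exp.2 ((mul_le_mul_of_nonneg_left (hD J hJ) hθ.le).trans ?_)
      exact le_ciSup_of_finite (fun i => κ / (4 * a * ρ) *
        (n * (frobNorm (D i) ^ 2 / (d : ℝ) ^ 2) - ∑ k, D i (J k).1 (J k).2 ^ 2)) J
    · exact (Real.exp_pos _).le
  have h2 := h1.trans h
  rw [Real.exp_sub, ← le_div_iff₀ (Real.exp_pos _)] at *
  refine h2.trans (le_of_eq ?_)
  ring

section Probability

variable {Ω : Type*} [MeasurableSpace Ω] {μ : Measure Ω} {σ Δ : ℝ}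
  {J : Fin n → Ω → Fin d × Fin d} {ε τ : Fin n → Ω → ℝ}

-- Each position pattern has probability `d⁻²ⁿ`, so the union bound over the bad patterns is a
-- count. Working with outer measure avoids any measurability requirement on the event.
open Classical in
theorem IsModel.measure_positions_le (h : IsModel μ σ Δ J ε τ)
    (B : (Fin n → Fin d × Fin d) → Prop) :
    μ {ω | B fun k => J k ω} ≤
      ENNReal.ofReal ((Finset.univ.filter B).card / ((d : ℝ) ^ 2) ^ n) := by
  have hsub : {ω | B fun k => J k ω} ⊆ ⋃ j ∈ Finset.univ.filter B,
      ⋂ k ∈ (Finset.univ : Finset (Fin n)), J k ⁻¹' {j k} := by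
    intro ω hω
    simp only [Set.mem_iUnion, Finset.mem_filter, Finset.mem_univ, true_and]
    exact ⟨fun k => J k ω, hω, by simp⟩
  have hJ : iIndepFun J μ := h.indep_samples.comp (fun _ z => z.1) fun _ => measurable_fst
  have hone : ∀ (k : Fin n) (p : Fin d × Fin d), μ (J k ⁻¹' {p}) = ((d : ℝ≥0∞) ^ 2)⁻¹ := by
    intro k p
    rw [← Measure.map_apply_of_aemeasurable (h.position_law k).aemeasurable
      (measurableSet_singleton p), (h.position_law k).map_eq, uniformOn_univ]
    simp [sq]
  refine (measure_mono hsub).trans ((measure_biUnion_finset_le _ _).trans ?_)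
  have hval : ∀ j : Fin n → Fin d × Fin d,
      μ (⋂ k ∈ (Finset.univ : Finset (Fin n)), J k ⁻¹' {j k}) = (((d : ℝ≥0∞) ^ 2)⁻¹) ^ n := by
    intro j
    rw [hJ.measure_inter_preimage_eq_mul Finset.univ (sets := fun k => {j k})
      fun k _ => measurableSet_singleton _]
    simp [hone]
  simp only [hval, Finset.sum_const, nsmul_eq_mul]
  rcases Nat.eq_zero_or_pos d with rfl | hd
  · rcases Nat.eq_zero_or_pos n with rfl | hn
    · simp
    · have : (Finset.univ.filter B).card = 0 := by
        rw [Finset.card_eq_zero, Finset.eq_empty_iff_forall_notMem]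
        intro j
        exact (j ⟨0, hn⟩).1.elim0
      simp [this]
  · have hd' : (0 : ℝ) < ((d : ℝ) ^ 2) ^ n := by positivity
    rw [ENNReal.ofReal_div_of_pos hd', ENNReal.ofReal_natCast, ENNReal.ofReal_pow (by positivity),
      ENNReal.ofReal_pow (by positivity), ENNReal.ofReal_natCast, ← ENNReal.inv_pow,
      div_eq_mul_inv]

end Probability

end QMC

/-! ### Dithered quantization -/

namespace QMC

open Matrix

section Quantizer

theorem measurable_quantize (Δ : ℝ) : Measurable (quantize Δ) := by
  unfold quantize
  split_ifs with h
  · exact measurable_id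
  · have : Measurable fun a : ℝ => ((⌊a / Δ⌋ : ℤ) : ℝ) :=
      measurable_from_top.comp (Int.measurable_floor.comp (measurable_id.div_const Δ))
    exact (this.add_const _).const_mul _

theorem abs_quantize_sub_le {Δ : ℝ} (hΔ : 0 ≤ Δ) (a : ℝ) : |quantize Δ a - a| ≤ Δ / 2 := by
  unfold quantize
  split_ifs with h
  · simp [h]
  · have hpos : 0 < Δ := lt_of_le_of_ne hΔ (Ne.symm h)
    have h1 := Int.floor_le (a / Δ)
    have h2 := Int.lt_floor_add_one (a / Δ)
    rw [le_div_iff₀ hpos] at h1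
    rw [div_lt_iff₀ hpos] at h2
    rw [abs_le]
    constructor <;> nlinarith

theorem uniformDither_ae_abs_le (Δ : ℝ) :
    ∀ᵐ t ∂uniformDither Δ, |t| ≤ Δ / 2 := by
  unfold uniformDither
  split_ifs with h
  · have hms : MeasurableSet {t : ℝ | |t| ≤ Δ / 2} := measurableSet_le (by fun_prop) (by fun_prop)
    rw [ae_dirac_iff hms]
    simp [h]
  · refine Measure.ae_smul_measure ?_ _
    filter_upwards [ae_restrict_mem measurableSet_Icc] with t ht
    exact abs_le.2 ht

theorem intervalIntegrable_floor (a b : ℝ) :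
    IntervalIntegrable (fun u : ℝ => ((⌊u⌋ : ℤ) : ℝ)) volume a b := by
  have h : Monotone fun u : ℝ => ((⌊u⌋ : ℤ) : ℝ) := fun x y hxy =>
    Int.cast_le.2 (Int.floor_mono hxy)
  exact h.intervalIntegrable

/-- The fractional part is periodic with mean `1 / 2` over any period, so the midpoint rule for the
floor errs by zero on average over a window of length one. -/
theorem intervalIntegral_floor_add_half (c : ℝ) :
    ∫ u in (c - 1 / 2)..(c + 1 / 2), (((⌊u⌋ : ℤ) : ℝ) + 1 / 2) = c := by
  have hfr : ∀ a b : ℝ, IntervalIntegrable (fun u : ℝ => Int.fract u) volume a b := fun a b =>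
    (intervalIntegral.intervalIntegrable_id).sub (intervalIntegrable_floor a b)
  have h1 : ∫ u in (c - 1 / 2)..(c + 1 / 2), Int.fract u = 1 / 2 := by
    have hper : Function.Periodic (fun u : ℝ => Int.fract u) 1 := fun u => Int.fract_add_one u
    have h2 := hper.intervalIntegral_add_eq (c - 1 / 2) 0
    rw [show c - 1 / 2 + 1 = c + 1 / 2 by ring, zero_add] at h2
    rw [h2, intervalIntegral.integral_of_le zero_le_one, integral_Ioc_eq_integral_Ioo]
    have h3 : ∫ u in Ioo (0 : ℝ) 1, Int.fract u = ∫ u in Ioo (0 : ℝ) 1, u :=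
      setIntegral_congr_fun measurableSet_Ioo fun u hu =>
        Int.fract_eq_self.2 ⟨hu.1.le, hu.2⟩
    rw [h3, ← integral_Ioc_eq_integral_Ioo, ← intervalIntegral.integral_of_le zero_le_one,
      integral_id]
    norm_num
  have h4 : ∀ u : ℝ, ((⌊u⌋ : ℤ) : ℝ) + 1 / 2 = (u + 1 / 2) - Int.fract u := fun u => by
    rw [Int.fract]
    ring
  simp only [h4]
  rw [intervalIntegral.integral_sub _ (hfr _ _), h1, intervalIntegral.integral_add, integral_id,
    intervalIntegral.integral_const, smul_eq_mul]
  · ring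
  · exact intervalIntegral.intervalIntegrable_id
  · exact intervalIntegrable_const
  · exact (intervalIntegral.intervalIntegrable_id).add intervalIntegrable_const

/-- Dithered quantization is unbiased. -/
theorem integral_quantize_add {Δ : ℝ} (hΔ : 0 ≤ Δ) (a : ℝ) :
    ∫ t, quantize Δ (a + t) ∂uniformDither Δ = a := by
  by_cases h : Δ = 0
  · simp [uniformDither, quantize, h]
  · have hpos : 0 < Δ := lt_of_le_of_ne hΔ (Ne.symm h)
    have hvol : volume (Icc (-(Δ / 2)) (Δ / 2)) = ENNReal.ofReal Δ := by
      rw [Real.volume_Icc]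
      congr 1
      ring
    rw [uniformDither, if_neg h, ProbabilityTheory.cond, integral_smul_measure, hvol,
      integral_Icc_eq_integral_Ioc, ← intervalIntegral.integral_of_le (by linarith),
      ENNReal.toReal_inv, ENNReal.toReal_ofReal hΔ]
    have h1 : ∀ t : ℝ, quantize Δ (a + t) =
        (fun u : ℝ => Δ * (((⌊u⌋ : ℤ) : ℝ) + 1 / 2)) (a / Δ + t / Δ) := fun t => by
      rw [quantize, if_neg h, add_div]
    simp only [h1]
    rw [intervalIntegral.integral_comp_add_div (fun u : ℝ => Δ * (((⌊u⌋ : ℤ) : ℝ) + 1 / 2)) h,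
      intervalIntegral.integral_const_mul]
    have e1 : a / Δ + -(Δ / 2) / Δ = a / Δ - 1 / 2 := by
      field_simp
      ring
    have e2 : a / Δ + Δ / 2 / Δ = a / Δ + 1 / 2 := by
      field_simp
    rw [e1, e2, intervalIntegral_floor_add_half]
    simp only [smul_eq_mul]
    field_simp

end Quantizer

/-- The strict inequality `σ < s` produces an admissible `t` below `s` without asking whether the
infimum is attained; it also covers `σ = 0`. -/
theorem integrable_exp_of_psi1Norm {Ω : Type*} [MeasurableSpace Ω] {μ : Measure Ω} {Z : Ω → ℝ}
    (hZ : AEMeasurable Z μ) {σ s : ℝ} (h : psi1Norm μ Z ≤ ENNReal.ofReal σ) (hs : σ < s)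
    (hs0 : 0 < s) :
    Integrable (fun ω => Real.exp (|Z ω| / s)) μ ∧ ∫ ω, Real.exp (|Z ω| / s) ∂μ ≤ 2 := by
  have h1 : psi1Norm μ Z < ENNReal.ofReal s :=
    h.trans_lt ((ENNReal.ofReal_lt_ofReal_iff hs0).2 hs)
  simp only [psi1Norm, iInf_lt_iff] at h1
  obtain ⟨t, ⟨ht0, ht⟩, hts⟩ := h1
  have hts' : t < s := (ENNReal.ofReal_lt_ofReal_iff hs0).1 hts
  have h2 : ∫⁻ ω, ENNReal.ofReal (Real.exp (|Z ω| / s)) ∂μ ≤ 2 := by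
    refine (lintegral_mono fun ω => ENNReal.ofReal_le_ofReal (Real.exp_le_exp.2 ?_)).trans ht
    exact div_le_div_of_nonneg_left (abs_nonneg _) ht0 hts'.le
  have hmeas : AEStronglyMeasurable (fun ω => Real.exp (|Z ω| / s)) μ :=
    (Real.measurable_exp.comp_aemeasurable
      ((measurable_norm.comp_aemeasurable hZ).div_const s)).aestronglyMeasurable
  have hnn : 0 ≤ᵐ[μ] fun ω => Real.exp (|Z ω| / s) :=
    Filter.Eventually.of_forall fun ω => (Real.exp_pos _).le
  refine ⟨?_, ?_⟩
  · rw [← lintegral_ofReal_ne_top_iff_integrable hmeas hnn]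
    exact ne_top_of_le_ne_top ENNReal.ofNat_ne_top h2
  · rw [integral_eq_lintegral_of_nonneg_ae hnn hmeas]
    exact (ENNReal.toReal_mono ENNReal.ofNat_ne_top h2).trans (by simp)

/-- For `z ≥ 0` the left side is the second-order Taylor remainder of `exp` at `c = κ * z`, at most
`c² * exp c`. Since `κ ≤ 1 / 2`, half of the exponent pays for `exp c` and the other half for `z² /
8`. -/
theorem cosh_sub_one_add_abs_sinh_sub_le {κ : ℝ} (hκ0 : 0 ≤ κ) (hκ : κ ≤ 1 / 2) (z : ℝ) :
    Real.cosh (κ * z) - 1 + |Real.sinh (κ * z) - κ * z| ≤ 8 * κ ^ 2 * Real.exp |z| := by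
  wlog hz : 0 ≤ z generalizing z
  · have := this (-z) (by linarith)
    rw [mul_neg, Real.cosh_neg, Real.sinh_neg, abs_neg] at this
    rwa [show -Real.sinh (κ * z) - -(κ * z) = -(Real.sinh (κ * z) - κ * z) by ring, abs_neg] at this
  set c := κ * z with hc
  have hc0 : 0 ≤ c := mul_nonneg hκ0 hz
  have h1 : c ≤ Real.sinh c := Real.self_le_sinh_iff.2 hc0
  rw [abs_of_nonneg (by linarith), abs_of_nonneg hz]
  have h2 := Real.cosh_add_sinh c
  have h3 : Real.exp c - 1 ≤ c * Real.exp c := by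
    have h4 := Real.add_one_le_exp (-c)
    rw [Real.exp_neg] at h4
    have h5 := Real.exp_pos c
    have h6 := mul_le_mul_of_nonneg_right h4 h5.le
    rw [inv_mul_cancel₀ h5.ne'] at h6
    linarith
  have h7 : Real.exp c - 1 - c ≤ c ^ 2 * Real.exp c := by
    nlinarith [mul_le_mul_of_nonneg_left h3 hc0]
  have h8 : Real.exp c ≤ Real.exp (z / 2) := Real.exp_le_exp.2 (by rw [hc]; nlinarith)
  have h9 : (z / 2) ^ 2 / 2 ≤ Real.exp (z / 2) := by
    have := Real.quadratic_le_exp_of_nonneg (x := z / 2) (by linarith)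
    linarith
  have h10 : Real.exp z = Real.exp (z / 2) * Real.exp (z / 2) := by
    rw [← Real.exp_add]
    ring_nf
  calc Real.cosh c - 1 + (Real.sinh c - c) = Real.exp c - 1 - c := by rw [← h2]; ring
    _ ≤ c ^ 2 * Real.exp c := h7
    _ ≤ c ^ 2 * Real.exp (z / 2) := mul_le_mul_of_nonneg_left h8 (sq_nonneg c)
    _ = 8 * κ ^ 2 * ((z / 2) ^ 2 / 2 * Real.exp (z / 2)) := by rw [hc]; ring
    _ ≤ 8 * κ ^ 2 * (Real.exp (z / 2) * Real.exp (z / 2)) :=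
      mul_le_mul_of_nonneg_left (mul_le_mul_of_nonneg_right h9 (Real.exp_pos _).le) (by positivity)
    _ = _ := by rw [h10]

end QMC

/-! ### Moments of the noise -/

namespace QMC

open Matrix

variable {d n : ℕ}

/-- The deviation of an observation from the entry of `Θ` it observes. -/
noncomputable def noiseTerm (Δ : ℝ) (Θ : Matrix (Fin d) (Fin d) ℝ) (z : (Fin d × Fin d) × ℝ × ℝ) : ℝ :=
  quantizedObs Δ Θ z.1 z.2.1 z.2.2 - Θ z.1.1 z.1.2

theorem measurable_noiseTerm (Δ : ℝ) (Θ : Matrix (Fin d) (Fin d) ℝ) :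
    Measurable (noiseTerm Δ Θ) := by
  have h1 : Measurable fun z : (Fin d × Fin d) × ℝ × ℝ => Θ z.1.1 z.1.2 :=
    (Measurable.of_discrete (f := fun p : Fin d × Fin d => Θ p.1 p.2)).comp measurable_fst
  unfold noiseTerm quantizedObs
  simp only [matInner_design]
  exact ((measurable_quantize Δ).comp ((h1.add measurable_snd.fst).add measurable_snd.snd)).sub h1

section Sample

variable {Ω : Type*} [MeasurableSpace Ω] {μ : Measure Ω} {σ Δ : ℝ}
  {J : Fin n → Ω → Fin d × Fin d} {ε τ : Fin n → Ω → ℝ}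

theorem IsModel.aemeasurable_noise (h : IsModel μ σ Δ J ε τ) (k : Fin n) : AEMeasurable (ε k) μ :=
  (h.noise_identDistrib k k).aemeasurable_fst

theorem IsModel.abs_noiseTerm_le (h : IsModel μ σ Δ J ε τ) (hΔ : 0 ≤ Δ)
    (Θ : Matrix (Fin d) (Fin d) ℝ) (k : Fin n) :
    ∀ᵐ ω ∂μ, |noiseTerm Δ Θ (J k ω, ε k ω, τ k ω)| ≤ |ε k ω| + Δ := by
  have h1 : ∀ᵐ t ∂(μ.map (τ k)), |t| ≤ Δ / 2 := by
    rw [(h.dither_law k).map_eq]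
    exact uniformDither_ae_abs_le Δ
  filter_upwards [ae_of_ae_map (h.dither_law k).aemeasurable h1] with ω hω
  have h2 := abs_quantize_sub_le hΔ (Θ (J k ω).1 (J k ω).2 + ε k ω + τ k ω)
  rw [noiseTerm, quantizedObs, matInner_design]
  simp only
  rw [abs_le] at *
  have h3 := neg_abs_le (ε k ω)
  have h4 := le_abs_self (ε k ω)
  constructor <;> linarith

theorem IsModel.aemeasurable_sample (h : IsModel μ σ Δ J ε τ) (k : Fin n) :
    AEMeasurable (fun ω => (J k ω, ε k ω, τ k ω)) μ :=
  (h.position_law k).aemeasurable.prodMk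
    ((h.aemeasurable_noise k).prodMk (h.dither_law k).aemeasurable)

theorem IsModel.integrable_exp_noise (h : IsModel μ σ Δ J ε τ) (hΔ : 0 ≤ Δ)
    (hσΔ : 0 < σ + Δ) (k : Fin n) :
    Integrable (fun ω => Real.exp (|ε k ω| / (2 * (σ + Δ)))) μ ∧
      ∫ ω, Real.exp (|ε k ω| / (2 * (σ + Δ))) ∂μ ≤ 2 :=
  integrable_exp_of_psi1Norm (h.aemeasurable_noise k) (h.noise_psi1 k) (by linarith) (by linarith)

theorem IsModel.integral_position [IsProbabilityMeasure μ]
    (h : IsModel μ σ Δ J ε τ) (k : Fin n)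
    (g : Fin d × Fin d → ℝ) : ∫ ω, g (J k ω) ∂μ = (∑ p, g p) / (d : ℝ) ^ 2 := by
  have h1 := (h.position_law k).integral_comp (f := g)
    (Measurable.of_discrete (f := g)).aestronglyMeasurable
  simp only [Function.comp_def] at h1
  rw [h1, Finset.sum_div]
  have : IsProbabilityMeasure (uniformOn (Set.univ : Set (Fin d × Fin d))) :=
    (h.position_law k).isProbabilityMeasure_iff.1 inferInstance
  rw [integral_fintype Integrable.of_finite]
  refine Finset.sum_congr rfl fun p _ => ?_
  rw [Measure.real, uniformOn_univ]
  simp [sq]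
  ring

theorem IsModel.integrable_position [IsProbabilityMeasure μ]
    (h : IsModel μ σ Δ J ε τ) (k : Fin n)
    (g : Fin d × Fin d → ℝ) : Integrable (fun ω => g (J k ω)) μ :=
  have := Measure.isFiniteMeasure_map μ (J k)
  (Integrable.of_finite (f := g) (μ := μ.map (J k))).comp_aemeasurable
    (h.position_law k).aemeasurable

/-- Dither and quantizer contribute at most `Δ / 2` each, so the exponent grows by at most `1 / 2`,
and `exp (1 / 2) ≤ 2`. The right side depends on the noise alone, which is independent of the
position. -/
theorem IsModel.exp_noiseTerm_le (h : IsModel μ σ Δ J ε τ) (hσ : 0 ≤ σ) (hΔ : 0 ≤ Δ)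
    (hσΔ : 0 < σ + Δ) (Θ : Matrix (Fin d) (Fin d) ℝ) (k : Fin n) :
    ∀ᵐ ω ∂μ, Real.exp (|noiseTerm Δ Θ (J k ω, ε k ω, τ k ω)| / (2 * (σ + Δ))) ≤
      2 * Real.exp (|ε k ω| / (2 * (σ + Δ))) := by
  have hhalf : Real.exp (1 / 2) ≤ 2 := by
    have h1 : Real.exp (1 / 2) ^ 2 = Real.exp 1 := by
      rw [← Real.exp_nat_mul]
      norm_num
    have h2 := Real.exp_one_lt_d9
    nlinarith [Real.exp_pos (1 / 2)]
  filter_upwards [h.abs_noiseTerm_le hΔ Θ k] with ω hω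
  have h3 : |noiseTerm Δ Θ (J k ω, ε k ω, τ k ω)| / (2 * (σ + Δ)) ≤
      1 / 2 + |ε k ω| / (2 * (σ + Δ)) := by
    rw [div_le_iff₀ (by linarith), add_mul, div_mul_cancel₀ _ (by linarith)]
    linarith
  refine (Real.exp_le_exp.2 h3).trans ?_
  rw [Real.exp_add]
  exact mul_le_mul_of_nonneg_right hhalf (Real.exp_pos _).le

theorem IsModel.aemeasurable_noiseTerm (h : IsModel μ σ Δ J ε τ)
    (Θ : Matrix (Fin d) (Fin d) ℝ) (k : Fin n) :
    AEMeasurable (fun ω => noiseTerm Δ Θ (J k ω, ε k ω, τ k ω)) μ :=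
  (measurable_noiseTerm Δ Θ).comp_aemeasurable (h.aemeasurable_sample k)

theorem IsModel.aemeasurable_exp_noiseTerm (h : IsModel μ σ Δ J ε τ)
    (Θ : Matrix (Fin d) (Fin d) ℝ) (k : Fin n) (s : ℝ) :
    AEMeasurable (fun ω => Real.exp (|noiseTerm Δ Θ (J k ω, ε k ω, τ k ω)| / s)) μ :=
  Real.measurable_exp.comp_aemeasurable
    ((measurable_norm.comp_aemeasurable (h.aemeasurable_noiseTerm Θ k)).div_const s)

theorem IsModel.integrable_exp_noiseTerm [IsProbabilityMeasure μ]
    (h : IsModel μ σ Δ J ε τ) (hσ : 0 ≤ σ) (hΔ : 0 ≤ Δ)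
    (hσΔ : 0 < σ + Δ) (Θ : Matrix (Fin d) (Fin d) ℝ) (k : Fin n) :
    Integrable (fun ω =>
      Real.exp (|noiseTerm Δ Θ (J k ω, ε k ω, τ k ω)| / (2 * (σ + Δ)))) μ := by
  refine ((h.integrable_exp_noise hΔ hσΔ k).1.const_mul 2).mono'
    (h.aemeasurable_exp_noiseTerm Θ k _).aestronglyMeasurable ?_
  filter_upwards [h.exp_noiseTerm_le hσ hΔ hσΔ Θ k] with ω hω
  rwa [Real.norm_of_nonneg (Real.exp_pos _).le]

theorem IsModel.integrable_noiseTerm [IsProbabilityMeasure μ]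
    (h : IsModel μ σ Δ J ε τ) (hσ : 0 ≤ σ) (hΔ : 0 ≤ Δ)
    (hσΔ : 0 < σ + Δ) (Θ : Matrix (Fin d) (Fin d) ℝ) (k : Fin n) :
    Integrable (fun ω => noiseTerm Δ Θ (J k ω, ε k ω, τ k ω)) μ := by
  refine ((h.integrable_exp_noiseTerm hσ hΔ hσΔ Θ k).const_mul (2 * (σ + Δ))).mono'
    (h.aemeasurable_noiseTerm Θ k).aestronglyMeasurable (Filter.Eventually.of_forall fun ω => ?_)
  have h1 := Real.add_one_le_exp (|noiseTerm Δ Θ (J k ω, ε k ω, τ k ω)| / (2 * (σ + Δ)))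
  have h2 : |noiseTerm Δ Θ (J k ω, ε k ω, τ k ω)| / (2 * (σ + Δ)) ≤
      Real.exp (|noiseTerm Δ Θ (J k ω, ε k ω, τ k ω)| / (2 * (σ + Δ))) := by linarith
  rw [div_le_iff₀ (by linarith)] at h2
  rw [Real.norm_eq_abs, mul_comm]
  exact h2

theorem IsModel.integrable_noise (h : IsModel μ σ Δ J ε τ) (hΔ : 0 ≤ Δ)
    (hσΔ : 0 < σ + Δ) (k : Fin n) : Integrable (ε k) μ := by
  refine ((h.integrable_exp_noise hΔ hσΔ k).1.const_mul (2 * (σ + Δ))).mono'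
    (h.aemeasurable_noise k).aestronglyMeasurable (Filter.Eventually.of_forall fun ω => ?_)
  have h1 := Real.add_one_le_exp (|ε k ω| / (2 * (σ + Δ)))
  have h2 : |ε k ω| / (2 * (σ + Δ)) ≤ Real.exp (|ε k ω| / (2 * (σ + Δ))) := by linarith
  rw [div_le_iff₀ (by linarith)] at h2
  rw [Real.norm_eq_abs, mul_comm]
  exact h2

theorem IsModel.integrable_exp_noiseTerm_mul [IsProbabilityMeasure μ]
    (h : IsModel μ σ Δ J ε τ) (hσ : 0 ≤ σ) (hΔ : 0 ≤ Δ)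
    (hσΔ : 0 < σ + Δ) (Θ : Matrix (Fin d) (Fin d) ℝ) (k : Fin n) (g : Fin d × Fin d → ℝ) :
    Integrable (fun ω => Real.exp (|noiseTerm Δ Θ (J k ω, ε k ω, τ k ω)| / (2 * (σ + Δ))) *
      g (J k ω)) μ := by
  refine (h.integrable_exp_noiseTerm hσ hΔ hσΔ Θ k).mul_bdd (c := ∑ p, |g p|)
    (h.integrable_position k g).aestronglyMeasurable (Filter.Eventually.of_forall fun ω => ?_)
  exact Finset.single_le_sum (f := fun p => |g p|) (fun p _ => abs_nonneg _) (Finset.mem_univ _)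

theorem IsModel.integrable_noiseTerm_mul [IsProbabilityMeasure μ]
    (h : IsModel μ σ Δ J ε τ) (hσ : 0 ≤ σ) (hΔ : 0 ≤ Δ)
    (hσΔ : 0 < σ + Δ) (Θ : Matrix (Fin d) (Fin d) ℝ) (k : Fin n) (g : Fin d × Fin d → ℝ) :
    Integrable (fun ω => noiseTerm Δ Θ (J k ω, ε k ω, τ k ω) * g (J k ω)) μ := by
  refine (h.integrable_noiseTerm hσ hΔ hσΔ Θ k).mul_bdd (c := ∑ p, |g p|)
    (h.integrable_position k g).aestronglyMeasurable (Filter.Eventually.of_forall fun ω => ?_)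
  exact Finset.single_le_sum (f := fun p => |g p|) (fun p _ => abs_nonneg _) (Finset.mem_univ _)

theorem IsModel.integral_exp_noiseTerm_mul_le [IsProbabilityMeasure μ]
    (h : IsModel μ σ Δ J ε τ) (hσ : 0 ≤ σ) (hΔ : 0 ≤ Δ)
    (hσΔ : 0 < σ + Δ) (Θ : Matrix (Fin d) (Fin d) ℝ) (k : Fin n) (g : Fin d × Fin d → ℝ)
    (hg : ∀ p, 0 ≤ g p) :
    ∫ ω, Real.exp (|noiseTerm Δ Θ (J k ω, ε k ω, τ k ω)| / (2 * (σ + Δ))) * g (J k ω) ∂μ ≤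
      4 * ((∑ p, g p) / (d : ℝ) ^ 2) := by
  have hind : IndepFun (fun ω => Real.exp (|ε k ω| / (2 * (σ + Δ)))) (fun ω => g (J k ω)) μ := by
    have hm : Measurable fun x : ℝ => Real.exp (|x| / (2 * (σ + Δ))) :=
      Real.measurable_exp.comp (measurable_norm.div_const _)
    exact (h.indep_position_noise k).symm.comp hm Measurable.of_discrete
  have hi := h.integrable_exp_noise hΔ hσΔ k
  have hJ := h.integrable_position k g
  have h1 : ∫ ω, Real.exp (|noiseTerm Δ Θ (J k ω, ε k ω, τ k ω)| / (2 * (σ + Δ))) *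
      g (J k ω) ∂μ ≤ ∫ ω, 2 * (Real.exp (|ε k ω| / (2 * (σ + Δ))) * g (J k ω)) ∂μ := by
    refine integral_mono_ae (h.integrable_exp_noiseTerm_mul hσ hΔ hσΔ Θ k g)
      ((hind.integrable_mul hi.1 hJ).const_mul 2) ?_
    filter_upwards [h.exp_noiseTerm_le hσ hΔ hσΔ Θ k] with ω hω
    rw [← mul_assoc]
    exact mul_le_mul_of_nonneg_right hω (hg _)
  refine h1.trans ?_
  rw [integral_const_mul, hind.integral_fun_mul_eq_mul_integral hi.1.aestronglyMeasurable
    hJ.aestronglyMeasurable, h.integral_position]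
  have h2 : 0 ≤ (∑ p, g p) / (d : ℝ) ^ 2 :=
    div_nonneg (Finset.sum_nonneg fun p _ => hg p) (by positivity)
  nlinarith [hi.2]

/-- Split the deviation into the noise and the error of dithered quantization. The noise is centered
and independent of the position; the quantization error `Φ` has mean zero over the dither for every
fixed position and noise value, by unbiasedness and Fubini. -/
theorem IsModel.integral_noiseTerm_mul [IsProbabilityMeasure μ]
    (h : IsModel μ σ Δ J ε τ) (hσ : 0 ≤ σ) (hΔ : 0 ≤ Δ)
    (hσΔ : 0 < σ + Δ) (Θ : Matrix (Fin d) (Fin d) ℝ) (k : Fin n) (g : Fin d × Fin d → ℝ) :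
    ∫ ω, noiseTerm Δ Θ (J k ω, ε k ω, τ k ω) * g (J k ω) ∂μ = 0 := by
  have hJ := h.integrable_position k g
  have hε := h.integrable_noise hΔ hσΔ k
  have hind : IndepFun (ε k) (fun ω => g (J k ω)) μ :=
    (h.indep_position_noise k).symm.comp measurable_id Measurable.of_discrete
  have hεg : Integrable (fun ω => ε k ω * g (J k ω)) μ := hind.integrable_mul hε hJ
  set Φ : ((Fin d × Fin d) × ℝ) × ℝ → ℝ := fun q =>
    (quantize Δ (Θ q.1.1.1 q.1.1.2 + q.1.2 + q.2) - (Θ q.1.1.1 q.1.1.2 + q.1.2)) * g q.1.1 with hΦ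
  have hΦm : Measurable Φ := by
    have h1 : Measurable fun q : ((Fin d × Fin d) × ℝ) × ℝ => Θ q.1.1.1 q.1.1.2 :=
      (Measurable.of_discrete (f := fun p : Fin d × Fin d => Θ p.1 p.2)).comp measurable_fst.fst
    have h2 : Measurable fun q : ((Fin d × Fin d) × ℝ) × ℝ => g q.1.1 :=
      (Measurable.of_discrete (f := g)).comp measurable_fst.fst
    have h3 : Measurable fun q : ((Fin d × Fin d) × ℝ) × ℝ => Θ q.1.1.1 q.1.1.2 + q.1.2 :=
      h1.add measurable_fst.snd
    exact (((measurable_quantize Δ).comp (h3.add measurable_snd)).sub h3).mul h2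
  have hsplit : ∀ ω, noiseTerm Δ Θ (J k ω, ε k ω, τ k ω) * g (J k ω) =
      ε k ω * g (J k ω) + Φ ((J k ω, ε k ω), τ k ω) := fun ω => by
    simp only [noiseTerm, quantizedObs, matInner_design, hΦ]
    ring
  have hΦi : Integrable (fun ω => Φ ((J k ω, ε k ω), τ k ω)) μ := by
    refine ((h.integrable_noiseTerm_mul hσ hΔ hσΔ Θ k g).sub hεg).congr
      (Filter.Eventually.of_forall fun ω => ?_)
    simp only [Pi.sub_apply, hsplit]
    ring
  have hq : AEMeasurable (fun ω => (J k ω, ε k ω)) μ :=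
    (h.position_law k).aemeasurable.prodMk (h.aemeasurable_noise k)
  have hτ := (h.dither_law k).aemeasurable
  have : IsProbabilityMeasure (uniformDither Δ) := (h.dither_law k).isProbabilityMeasure_iff.1 inferInstance
  have hmap : μ.map (fun ω => ((J k ω, ε k ω), τ k ω)) =
      (μ.map fun ω => (J k ω, ε k ω)).prod (uniformDither Δ) := by
    rw [(indepFun_iff_map_prod_eq_prod_map_map hq hτ).1 (h.indep_dither k),
      (h.dither_law k).map_eq]
  have hΦ0 : ∫ ω, Φ ((J k ω, ε k ω), τ k ω) ∂μ = 0 := by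
    rw [← integral_map (hq.prodMk hτ) hΦm.aestronglyMeasurable, hmap, integral_prod]
    · refine integral_eq_zero_of_ae (Filter.Eventually.of_forall fun q => ?_)
      simp only [hΦ, Pi.zero_apply]
      rw [integral_mul_const, integral_sub, integral_quantize_add hΔ, integral_const]
      · simp
      · set a := Θ q.1.1 q.1.2 + q.2 with ha
        refine Integrable.of_bound (C := |a| + Δ) ((measurable_quantize Δ).comp
          (measurable_const.add measurable_id)).aestronglyMeasurable ?_
        filter_upwards [uniformDither_ae_abs_le Δ] with t ht
        have h2 := abs_quantize_sub_le hΔ (a + t)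
        rw [Real.norm_eq_abs]
        rw [abs_le] at *
        have h3 := neg_abs_le a
        have h4 := le_abs_self a
        constructor <;> linarith
      · exact integrable_const _
    · rw [← hmap, integrable_map_measure hΦm.aestronglyMeasurable (hq.prodMk hτ)]
      exact hΦi
  simp only [hsplit]
  rw [integral_add hεg hΦi, hΦ0, hind.integral_fun_mul_eq_mul_integral
    hε.aestronglyMeasurable hJ.aestronglyMeasurable, h.noise_mean k]
  simp

end Sample

end QMC

/-! ### Concentration of the noise -/

namespace QMC

open Matrix

variable {d n : ℕ}

theorem abs_dilation_design_le (p : Fin d × Fin d) (q r : Fin d ⊕ Fin d) :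
    |dilation (design p) q r| ≤ 1 := by
  rcases q with q | q <;> rcases r with r | r <;>
    simp [dilation, design, Matrix.single_apply] <;> split_ifs <;> norm_num

theorem abs_dilation_design_sq_le (p : Fin d × Fin d) (q r : Fin d ⊕ Fin d) :
    |(fromBlocks (Matrix.single p.1 p.1 1) 0 0 (Matrix.single p.2 p.2 1) :
      Matrix (Fin d ⊕ Fin d) (Fin d ⊕ Fin d) ℝ) q r| ≤ 1 := by
  rcases q with q | q <;> rcases r with r | r <;>
    simp [Matrix.single_apply] <;> split_ifs <;> norm_num

/-- A crude entrywise bound, used only to obtain integrability of the matrix exponential from that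
of the scalar one. -/
theorem abs_exp_smul_dilation_design_le (p : Fin d × Fin d) (c : ℝ) (q r : Fin d ⊕ Fin d) :
    |NormedSpace.exp (c • dilation (design p)) q r| ≤ 3 * Real.exp |c| := by
  rw [exp_smul_dilation_design, Matrix.add_apply, Matrix.add_apply, Matrix.smul_apply,
    Matrix.smul_apply, smul_eq_mul, smul_eq_mul]
  have h1 : |(1 : Matrix (Fin d ⊕ Fin d) (Fin d ⊕ Fin d) ℝ) q r| ≤ 1 := by
    rw [Matrix.one_apply]
    split_ifs <;> norm_num
  have h2 := abs_dilation_design_le p q r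
  have h3 := abs_dilation_design_sq_le p q r
  have hcs : Real.cosh c + |Real.sinh c| = Real.exp |c| := by
    rw [← Real.cosh_abs, Real.abs_sinh, Real.cosh_add_sinh]
  have hc1 := Real.one_le_cosh c
  have hs0 := abs_nonneg (Real.sinh c)
  have h4 : |Real.cosh c - 1| ≤ Real.exp |c| := by
    rw [abs_of_nonneg (by linarith)]
    linarith
  have h5 : |Real.sinh c| ≤ Real.exp |c| := by linarith
  have h6 : 1 ≤ Real.exp |c| := Real.one_le_exp (abs_nonneg c)
  refine (abs_add_le _ _).trans ((add_le_add_left (abs_add_le _ _) _).trans ?_)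
  rw [abs_mul, abs_mul]
  have h7 := mul_le_mul h4 h3 (abs_nonneg _) (Real.exp_pos _).le
  have h8 := mul_le_mul h5 h2 (abs_nonneg _) (Real.exp_pos _).le
  linarith

theorem measurable_dilation_design_apply (q r : Fin d ⊕ Fin d) :
    Measurable fun z : (Fin d × Fin d) × ℝ × ℝ => dilation (design z.1) q r :=
  (Measurable.of_discrete (f := fun p : Fin d × Fin d => dilation (design p) q r)).comp
    measurable_fst

theorem dotProduct_exp_noise_le {κ : ℝ} (hκ0 : 0 ≤ κ) (hκ : κ ≤ 1 / 2) (p : Fin d × Fin d)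
    (w : ℝ) (x y : Fin d → ℝ) :
    Sum.elim x y ⬝ᵥ NormedSpace.exp ((κ * w) • dilation (design p)) *ᵥ Sum.elim x y ≤
      (x ⬝ᵥ x + y ⬝ᵥ y) + 2 * κ * (w * (x p.1 * y p.2)) +
        8 * κ ^ 2 * (Real.exp |w| * (x p.1 ^ 2 + y p.2 ^ 2)) := by
  rw [dotProduct_exp_smul_dilation_design]
  have h1 := cosh_sub_one_add_abs_sinh_sub_le hκ0 hκ w
  have h2 : 2 * |x p.1 * y p.2| ≤ x p.1 ^ 2 + y p.2 ^ 2 := by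
    rw [abs_mul, ← sq_abs (x p.1), ← sq_abs (y p.2)]
    nlinarith [sq_nonneg (|x p.1| - |y p.2|)]
  have h3 : (Real.sinh (κ * w) - κ * w) * (2 * (x p.1 * y p.2)) ≤
      |Real.sinh (κ * w) - κ * w| * (x p.1 ^ 2 + y p.2 ^ 2) := by
    refine (le_abs_self _).trans ?_
    rw [abs_mul, abs_mul, abs_of_pos (by norm_num : (0 : ℝ) < 2)]
    exact mul_le_mul_of_nonneg_left h2 (abs_nonneg _)
  have h4 := mul_le_mul_of_nonneg_right h1 (by positivity : 0 ≤ x p.1 ^ 2 + y p.2 ^ 2)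
  linarith

section Events

variable {Ω : Type*} [MeasurableSpace Ω] {μ : Measure Ω} [IsProbabilityMeasure μ] {σ Δ : ℝ}
  {J : Fin n → Ω → Fin d × Fin d} {ε τ : Fin n → Ω → ℝ}

theorem IsModel.map_samples (h : IsModel μ σ Δ J ε τ) :
    μ.map (fun ω k => (J k ω, ε k ω, τ k ω)) =
      Measure.pi fun k => μ.map fun ω => (J k ω, ε k ω, τ k ω) :=
  (iIndepFun_iff_map_fun_eq_pi_map h.aemeasurable_sample).1 h.indep_samples

/-- Centering removes the term linear in `κ`. In the quadratic term, `32` is `8` from the scalar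
Taylor bound times the exponential moment `4`, and `1 / d` is the average squared design. -/
theorem IsModel.integral_exp_noise_dilation_le [NeZero d] (h : IsModel μ σ Δ J ε τ) (hσ : 0 ≤ σ)
    (hΔ : 0 ≤ Δ) (hσΔ : 0 < σ + Δ) (Θ : Matrix (Fin d) (Fin d) ℝ) {κ : ℝ} (hκ0 : 0 ≤ κ)
    (hκ : κ ≤ 1 / 2) (k : Fin n) (v : Fin d ⊕ Fin d → ℝ) :
    ∫ ω, v ⬝ᵥ NormedSpace.exp ((κ * (noiseTerm Δ Θ (J k ω, ε k ω, τ k ω) / (2 * (σ + Δ)))) •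
      dilation (design (J k ω))) *ᵥ v ∂μ ≤ (1 + 32 * κ ^ 2 / d) * (v ⬝ᵥ v) := by
  have hd : (0 : ℝ) < d := by exact_mod_cast Nat.pos_of_ne_zero (NeZero.ne d)
  rw [eq_sumElim v]
  generalize (fun i => v (Sum.inl i)) = x
  generalize (fun i => v (Sum.inr i)) = y
  set s := 2 * (σ + Δ) with hs
  have hs0 : 0 < s := by positivity
  set ξ : Ω → ℝ := fun ω => noiseTerm Δ Θ (J k ω, ε k ω, τ k ω) with hξ
  have hi1 := (h.integrable_noiseTerm_mul hσ hΔ hσΔ Θ k fun p => x p.1 * y p.2).const_mul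
    (2 * κ / s)
  have hi2 := (h.integrable_exp_noiseTerm_mul hσ hΔ hσΔ Θ k
    fun p => x p.1 ^ 2 + y p.2 ^ 2).const_mul (8 * κ ^ 2)
  have hle : ∀ ω, Sum.elim x y ⬝ᵥ NormedSpace.exp ((κ * (ξ ω / s)) • dilation (design (J k ω))) *ᵥ
      Sum.elim x y ≤ (x ⬝ᵥ x + y ⬝ᵥ y) + 2 * κ / s * (ξ ω * (x (J k ω).1 * y (J k ω).2)) +
        8 * κ ^ 2 * (Real.exp (|ξ ω| / s) * (x (J k ω).1 ^ 2 + y (J k ω).2 ^ 2)) := by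
    intro ω
    refine (dotProduct_exp_noise_le hκ0 hκ (J k ω) (ξ ω / s) x y).trans (le_of_eq ?_)
    rw [abs_div, abs_of_pos hs0]
    ring
  have hnn : ∀ ω, 0 ≤ Sum.elim x y ⬝ᵥ NormedSpace.exp ((κ * (ξ ω / s)) •
      dilation (design (J k ω))) *ᵥ Sum.elim x y := by
    intro ω
    have := (exp_posSemidef (A := (κ * (ξ ω / s)) • dilation (design (J k ω)))
      (by rw [Matrix.transpose_smul, dilation_transpose])).dotProduct_mulVec_nonneg (Sum.elim x y)
    simpa using this
  have hib := ((integrable_const (μ := μ) (x ⬝ᵥ x + y ⬝ᵥ y)).add hi1).add hi2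
  have hmono := integral_mono_of_nonneg (Filter.Eventually.of_forall hnn) hib
    (Filter.Eventually.of_forall hle)
  refine hmono.trans ?_
  rw [integral_add' ((integrable_const _).add hi1) hi2, integral_add' (integrable_const _) hi1,
    integral_const, integral_const_mul, integral_const_mul,
    h.integral_noiseTerm_mul hσ hΔ hσΔ Θ k fun p => x p.1 * y p.2]
  have h1 := h.integral_exp_noiseTerm_mul_le hσ hΔ hσΔ Θ k (fun p => x p.1 ^ 2 + y p.2 ^ 2)
    (fun p => by positivity)
  rw [sum_design_sq] at h1
  have h2 := mul_le_mul_of_nonneg_left h1 (by positivity : 0 ≤ 8 * κ ^ 2)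
  rw [sumElim_dotProduct_sumElim]
  have h3 : (1 + 32 * κ ^ 2 / d) * (x ⬝ᵥ x + y ⬝ᵥ y) = (x ⬝ᵥ x + y ⬝ᵥ y) +
      8 * κ ^ 2 * (4 * (d * (x ⬝ᵥ x + y ⬝ᵥ y) / (d : ℝ) ^ 2)) := by
    field_simp
    ring
  rw [h3]
  simpa using h2

/-- Operator norm bound for the noise matrix. -/
theorem IsModel.measure_noise_le [NeZero d] (h : IsModel μ σ Δ J ε τ) (hσ : 0 ≤ σ)
    (hΔ : 0 ≤ Δ) (hσΔ : 0 < σ + Δ) (Θ : Matrix (Fin d) (Fin d) ℝ) {κ : ℝ} (hκ0 : 0 < κ)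
    (hκ : κ ≤ 1 / 2) (T : ℝ) :
    μ {ω | ¬ OpLe (∑ k, noiseTerm Δ Θ (J k ω, ε k ω, τ k ω) • design (J k ω))
      (2 * (σ + Δ) / κ * T)} ≤
      ENNReal.ofReal ((1 + 32 * κ ^ 2 / d) ^ n * (2 * d) * Real.exp (-T)) := by
  set s := 2 * (σ + Δ) with hs
  have hs0 : 0 < s := by positivity
  set Z : Ω → Fin n → (Fin d × Fin d) × ℝ × ℝ := fun ω k => (J k ω, ε k ω, τ k ω) with hZ
  have hZm : AEMeasurable Z μ := aemeasurable_pi_lambda _ h.aemeasurable_sample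
  set F : (Fin d × Fin d) × ℝ × ℝ → Matrix (Fin d ⊕ Fin d) (Fin d ⊕ Fin d) ℝ := fun z =>
    (κ * (noiseTerm Δ Θ z / s)) • dilation (design z.1) with hF
  have hFm : ∀ q r, Measurable fun z => F z q r := by
    intro q r
    simp only [hF, Matrix.smul_apply, smul_eq_mul]
    exact (((measurable_noiseTerm Δ Θ).div_const s).const_mul κ).mul
      (measurable_dilation_design_apply q r)
  have hFt : ∀ z, (F z)ᵀ = F z := fun z => by
    rw [hF, Matrix.transpose_smul, dilation_transpose]
  set G : (Fin n → (Fin d × Fin d) × ℝ × ℝ) → ℝ≥0∞ := fun z =>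
    ENNReal.ofReal (NormedSpace.exp (∑ k, F (z k))).trace with hG
  have hGm : Measurable G := by
    refine ENNReal.measurable_ofReal.comp (measurable_trace_exp fun q r => ?_)
    simp only [Matrix.sum_apply]
    exact Finset.measurable_sum _ fun k _ => (hFm q r).comp (measurable_pi_apply k)
  have hprob : ∀ k, IsProbabilityMeasure (μ.map fun ω => (J k ω, ε k ω, τ k ω)) := fun k =>
    Measure.isProbabilityMeasure_map (h.aemeasurable_sample k)
  have hb : (0 : ℝ) ≤ 1 + 32 * κ ^ 2 / d := by positivity
  have hlint : ∫⁻ ω, G (Z ω) ∂μ ≤ ENNReal.ofReal ((1 + 32 * κ ^ 2 / d) ^ n * (2 * d)) := by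
    rw [← lintegral_map' hGm.aemeasurable hZm, h.map_samples]
    refine (lintegral_trace_exp_sum_le F hFt hFm hb _ (fun k q r => ?_) fun k v => ?_).trans
      (le_of_eq ?_)
    · rw [integrable_map_measure (measurable_exp_apply hFm q r).aestronglyMeasurable
        (h.aemeasurable_sample k)]
      refine ((h.integrable_exp_noiseTerm hσ hΔ hσΔ Θ k).const_mul 3).mono'
        ((measurable_exp_apply hFm q r).comp_aemeasurable
          (h.aemeasurable_sample k)).aestronglyMeasurable (Filter.Eventually.of_forall fun ω => ?_)
      refine (abs_exp_smul_dilation_design_le _ _ q r).trans ?_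
      refine mul_le_mul_of_nonneg_left (Real.exp_le_exp.2 ?_) (by norm_num)
      rw [abs_mul, abs_div, abs_of_pos hκ0, abs_of_pos hs0]
      exact mul_le_of_le_one_left (by positivity) (by linarith)
    · rw [integral_map (h.aemeasurable_sample k)]
      · exact h.integral_exp_noise_dilation_le hσ hΔ hσΔ Θ hκ0.le hκ k v
      · refine Measurable.aestronglyMeasurable ?_
        simp only [dotProduct, Matrix.mulVec]
        exact Finset.measurable_sum _ fun q _ => (Finset.measurable_sum _ fun r _ =>
          (measurable_exp_apply hFm q r).mul_const _).const_mul _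
    · simp [two_mul]
  have hsub : {ω | ¬ OpLe (∑ k, noiseTerm Δ Θ (J k ω, ε k ω, τ k ω) • design (J k ω))
      (s / κ * T)} ⊆ {ω | ENNReal.ofReal (Real.exp T) ≤ G (Z ω)} := by
    intro ω hω
    by_contra hlt
    refine hω ?_
    rw [Set.mem_ofPred_eq, not_le, hG, ENNReal.ofReal_lt_ofReal_iff (Real.exp_pos _)] at hlt
    have hdil : ∑ k, F (Z ω k) = dilation ((κ / s) •
        ∑ k, noiseTerm Δ Θ (J k ω, ε k ω, τ k ω) • design (J k ω)) := by
      rw [Finset.smul_sum, dilation_sum]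
      refine Finset.sum_congr rfl fun k _ => ?_
      rw [smul_smul, dilation_smul, hF]
      simp only [hZ]
      congr 1
      ring
    -- Below the Markov threshold, the trace exponential bounds the operator norm of the rescaled
    -- noise matrix; undoing the scaling by `κ / s` gives the claim.
    rw [hdil] at hlt
    have hop := (opLe_of_trace_exp_dilation_le hlt.le).smul (c := s / κ) (by positivity)
    rw [smul_smul, div_mul_div_comm, mul_comm s κ, div_self (by positivity), one_smul] at hop
    exact hop
  refine (measure_mono hsub).trans ((meas_ge_le_lintegral_div (hGm.comp_aemeasurable hZm)
    (by simp [Real.exp_pos]) ENNReal.ofReal_ne_top).trans ?_)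
  refine (ENNReal.div_le_div_right hlint _).trans (le_of_eq ?_)
  rw [← ENNReal.ofReal_div_of_pos (Real.exp_pos _), Real.exp_neg, div_eq_mul_inv]

/-- Tail bound for the total absolute noise. -/
theorem IsModel.measure_sum_abs_noise_le [NeZero d] (h : IsModel μ σ Δ J ε τ) (hσ : 0 ≤ σ)
    (hΔ : 0 ≤ Δ) (hσΔ : 0 < σ + Δ) (Θ : Matrix (Fin d) (Fin d) ℝ) (T : ℝ) :
    μ {ω | T < ∑ k, |noiseTerm Δ Θ (J k ω, ε k ω, τ k ω)| / (2 * (σ + Δ))} ≤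
      ENNReal.ofReal (4 ^ n * Real.exp (-T)) := by
  have hd : (0 : ℝ) < d := by exact_mod_cast Nat.pos_of_ne_zero (NeZero.ne d)
  set s := 2 * (σ + Δ) with hs
  set Z : Ω → Fin n → (Fin d × Fin d) × ℝ × ℝ := fun ω k => (J k ω, ε k ω, τ k ω) with hZ
  have hZm : AEMeasurable Z μ := aemeasurable_pi_lambda _ h.aemeasurable_sample
  set f : (Fin d × Fin d) × ℝ × ℝ → ℝ≥0∞ := fun z =>
    ENNReal.ofReal (Real.exp (|noiseTerm Δ Θ z| / s)) with hf
  have hfm : Measurable f := ENNReal.measurable_ofReal.comp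
    (Real.measurable_exp.comp ((measurable_norm.comp (measurable_noiseTerm Δ Θ)).div_const s))
  have hprob : ∀ k, IsProbabilityMeasure (μ.map fun ω => (J k ω, ε k ω, τ k ω)) := fun k =>
    Measure.isProbabilityMeasure_map (h.aemeasurable_sample k)
  have hGm : Measurable fun z : Fin n → (Fin d × Fin d) × ℝ × ℝ => ∏ k, f (z k) :=
    Finset.measurable_prod _ fun k _ => hfm.comp (measurable_pi_apply k)
  have hone : ∀ k, ∫⁻ ω, f (Z ω k) ∂μ ≤ 4 := by
    intro k
    have h1 := h.integral_exp_noiseTerm_mul_le hσ hΔ hσΔ Θ k (fun _ => 1) (fun _ => zero_le_one)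
    simp only [mul_one, Finset.sum_const, Finset.card_univ, Fintype.card_prod, Fintype.card_fin,
      nsmul_eq_mul] at h1
    push_cast at h1
    rw [← sq, div_self (by positivity), mul_one] at h1
    rw [hf, ← ofReal_integral_eq_lintegral_ofReal (h.integrable_exp_noiseTerm hσ hΔ hσΔ Θ k)
      (Filter.Eventually.of_forall fun ω => (Real.exp_pos _).le)]
    exact (ENNReal.ofReal_le_ofReal h1).trans (by simp)
  have hfk : ∀ k, Measurable fun z : Fin n → (Fin d × Fin d) × ℝ × ℝ => f (z k) :=
    fun k => hfm.comp (measurable_pi_apply k)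
  have hfz : ∀ z, f z = ENNReal.ofReal (Real.exp (|noiseTerm Δ Θ z| / s)) := fun _ => rfl
  clear_value f
  have hlint : ∫⁻ ω, ∏ k, f (Z ω k) ∂μ ≤ 4 ^ n := by
    have hind : iIndepFun (fun k (z : Fin n → (Fin d × Fin d) × ℝ × ℝ) => f (z k))
        (μ.map Z) := by
      rw [h.map_samples]
      exact iIndepFun_pi (X := fun _ => f) fun k => hfm.aemeasurable
    have hk : ∀ k, ∫⁻ z, f (z k) ∂(μ.map Z) ≤ 4 := fun k => by
      rw [lintegral_map' (hfk k).aemeasurable hZm]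
      exact hone k
    have hprodeq := lintegral_prod_eq_prod_lintegral_of_indepFun (μ := μ.map Z) Finset.univ
      (fun k (z : Fin n → (Fin d × Fin d) × ℝ × ℝ) => f (z k)) hind hfk
    rw [← lintegral_map' hGm.aemeasurable hZm, hprodeq]
    calc ∏ k, ∫⁻ z, f (z k) ∂(μ.map Z) ≤ ∏ _k : Fin n, (4 : ℝ≥0∞) :=
          Finset.prod_le_prod' fun k _ => hk k
      _ = 4 ^ n := by simp
  have hsub : {ω | T < ∑ k, |noiseTerm Δ Θ (J k ω, ε k ω, τ k ω)| / s} ⊆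
      {ω | ENNReal.ofReal (Real.exp T) ≤ ∏ k, f (Z ω k)} := by
    intro ω hω
    simp only [Set.mem_ofPred_eq, hfz]
    rw [← ENNReal.ofReal_prod_of_nonneg fun k _ => (Real.exp_pos _).le,
      ← Real.exp_sum]
    exact ENNReal.ofReal_le_ofReal (Real.exp_le_exp.2 (le_of_lt hω))
  refine (measure_mono hsub).trans ((meas_ge_le_lintegral_div (hGm.comp_aemeasurable hZm)
    (by simp [Real.exp_pos]) ENNReal.ofReal_ne_top).trans ?_)
  refine (ENNReal.div_le_div_right hlint _).trans (le_of_eq ?_)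
  rw [Real.exp_neg, ← div_eq_mul_inv, ENNReal.ofReal_div_of_pos (Real.exp_pos _),
    ENNReal.ofReal_pow (by norm_num)]
  simp

end Events

end QMC

/-! ### Deterministic error analysis -/

namespace QMC

open Matrix

variable {d n : ℕ}

theorem abs_apply_le_maxNorm (A : Matrix (Fin d) (Fin d) ℝ) (i j : Fin d) :
    |A i j| ≤ maxNorm A :=
  le_ciSup (f := fun p : Fin d × Fin d => |A p.1 p.2|) (Set.finite_range _).bddAbove (i, j)

theorem maxNorm_nonneg (A : Matrix (Fin d) (Fin d) ℝ) : 0 ≤ maxNorm A :=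
  Real.iSup_nonneg fun _ => abs_nonneg _

theorem frobNorm_smul {c : ℝ} (hc : 0 ≤ c) (A : Matrix (Fin d) (Fin d) ℝ) :
    frobNorm (c • A) = c * frobNorm A := by
  have h : frobNorm (c • A) ^ 2 = (c * frobNorm A) ^ 2 := by
    rw [frobNorm_sq, mul_pow, frobNorm_sq, matInner_smul_left, matInner_smul_right]
    ring
  exact (sq_eq_sq₀ (frobNorm_nonneg _) (mul_nonneg hc (frobNorm_nonneg _))).1 h

theorem frobNorm_le_of_abs_le {a : ℝ} (ha : 0 ≤ a) {A : Matrix (Fin d) (Fin d) ℝ}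
    (h : ∀ i j, |A i j| ≤ a) : frobNorm A ≤ a * d := by
  refine Real.sqrt_le_iff.2 ⟨by positivity, ?_⟩
  calc ∑ i, ∑ j, A i j ^ 2 ≤ ∑ _i : Fin d, ∑ _j : Fin d, a ^ 2 :=
        Finset.sum_le_sum fun i _ => Finset.sum_le_sum fun j _ =>
          sq_le_sq.2 ((h i j).trans (le_abs_self a))
    _ = (a * d) ^ 2 := by simp; ring

section Deterministic

variable {α lam : ℝ} {p : Fin n → Fin d × Fin d} {y : Fin n → ℝ}
  {Θ Θhat : Matrix (Fin d) (Fin d) ℝ}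

theorem IsEstimator.abs_sub_le (h : IsEstimator α lam p y Θhat) (hΘ : maxNorm Θ ≤ α)
    (i j : Fin d) : |(Θhat - Θ) i j| ≤ 2 * α := by
  have h1 := (abs_apply_le_maxNorm Θhat i j).trans h.1
  have h2 := (abs_apply_le_maxNorm Θ i j).trans hΘ
  rw [Matrix.sub_apply]
  have := abs_sub (Θhat i j) (Θ i j)
  linarith

/-- Comparison of a minimizer with the truth. -/
theorem IsEstimator.basic_inequality (h : IsEstimator α lam p y Θhat) (hΘ : maxNorm Θ ≤ α)
    (hn : 0 < n) :
    1 / 2 * ∑ k, (Θhat - Θ) (p k).1 (p k).2 ^ 2 ≤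
      ∑ k, (y k - Θ (p k).1 (p k).2) * (Θhat - Θ) (p k).1 (p k).2 +
        n * lam * (nuclearNorm Θ - nuclearNorm Θhat) := by
  have hn' : (0 : ℝ) < n := by exact_mod_cast hn
  have h1 : objective lam p y Θhat ≤ objective lam p y Θ := h.2 hΘ
  simp only [objective, matInner_design] at h1
  have h2 : ∑ k, (y k - Θhat (p k).1 (p k).2) ^ 2 = ∑ k, (y k - Θ (p k).1 (p k).2) ^ 2 -
      2 * ∑ k, (y k - Θ (p k).1 (p k).2) * (Θhat - Θ) (p k).1 (p k).2 +
      ∑ k, (Θhat - Θ) (p k).1 (p k).2 ^ 2 := by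
    rw [Finset.mul_sum, ← Finset.sum_sub_distrib, ← Finset.sum_add_distrib]
    refine Finset.sum_congr rfl fun k _ => ?_
    rw [Matrix.sub_apply]
    ring
  rw [h2] at h1
  have h3 := mul_le_mul_of_nonneg_left h1 hn'.le
  have h4 : ∀ x, (n : ℝ) * (1 / (2 * n) * x) = x / 2 := fun x => by field_simp
  rw [mul_add (n : ℝ) _ (lam * nuclearNorm Θhat), mul_add (n : ℝ) _ (lam * nuclearNorm Θ), h4, h4] at h3
  linarith

/-- Insert duality and decomposability into the basic inequality. Because the noise norm is at most
half of `n * lam`, the right side becomes `n * lam * (3‖D₁‖ - ‖D₂‖)` in nuclear norms. Its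
nonnegativity is the cone condition, and `D₁` has rank at most `2 * r`. -/
theorem IsEstimator.error_cone (h : IsEstimator α lam p y Θhat) (hΘ : maxNorm Θ ≤ α)
    (hn : 0 < n) (hlam : 0 < lam) {r : ℕ} (hr : Θ.rank ≤ r)
    (hop : OpLe (∑ k, (y k - Θ (p k).1 (p k).2) • design (p k)) (n * lam / 2)) :
    nuclearNorm (Θhat - Θ) ≤ 4 * (√(2 * r) * frobNorm (Θhat - Θ)) ∧
      ∑ k, (Θhat - Θ) (p k).1 (p k).2 ^ 2 ≤
        3 * (n * lam) * (√(2 * r) * frobNorm (Θhat - Θ)) := by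
  have hnl : 0 < (n : ℝ) * lam := mul_pos (by exact_mod_cast hn) hlam
  have hb := h.basic_inequality hΘ hn
  have hinner : ∑ k, (y k - Θ (p k).1 (p k).2) * (Θhat - Θ) (p k).1 (p k).2 =
      matInner (∑ k, (y k - Θ (p k).1 (p k).2) • design (p k)) (Θhat - Θ) := by
    rw [matInner_sum_left]
    simp_rw [matInner_smul_left, matInner_design]
  have hdual := hop.matInner_le (Θhat - Θ)
  rw [← hinner] at hdual
  obtain ⟨D₁, D₂, hD, hrank, hfrob, hnuc⟩ := exists_nuclearNorm_decomposition Θ (Θhat - Θ)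
  rw [add_sub_cancel] at hnuc
  have hadd := nuclearNorm_add_le D₁ D₂
  rw [← hD] at hadd
  have hD₁ : nuclearNorm D₁ ≤ √(2 * r) * frobNorm (Θhat - Θ) := by
    refine (nuclearNorm_le_sqrt_rank D₁).trans
      (mul_le_mul (Real.sqrt_le_sqrt ?_) hfrob (frobNorm_nonneg _) (Real.sqrt_nonneg _))
    exact_mod_cast hrank.trans (Nat.mul_le_mul_left 2 hr)
  have hS : 0 ≤ ∑ k, (Θhat - Θ) (p k).1 (p k).2 ^ 2 := Finset.sum_nonneg fun k _ => sq_nonneg _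
  have h1 : n * lam * (nuclearNorm Θ - nuclearNorm Θhat) ≤
      n * lam * (nuclearNorm D₁ - nuclearNorm D₂) :=
    mul_le_mul_of_nonneg_left (by linarith) hnl.le
  have h2 : n * lam / 2 * nuclearNorm (Θhat - Θ) ≤
      n * lam / 2 * (nuclearNorm D₁ + nuclearNorm D₂) :=
    mul_le_mul_of_nonneg_left hadd (by linarith)
  have h3 : ∑ k, (Θhat - Θ) (p k).1 (p k).2 ^ 2 ≤
      n * lam * (3 * nuclearNorm D₁ - nuclearNorm D₂) := by linarith
  have h4 : nuclearNorm D₂ ≤ 3 * nuclearNorm D₁ := by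
    have := nonneg_of_mul_nonneg_right (hS.trans h3) hnl
    linarith
  refine ⟨by linarith, h3.trans ?_⟩
  have h5 := nuclearNorm_nonneg D₂
  have h6 : n * lam * (3 * nuclearNorm D₁ - nuclearNorm D₂) ≤
      n * lam * (3 * (√(2 * r) * frobNorm (Θhat - Θ))) :=
    mul_le_mul_of_nonneg_left (by linarith) hnl.le
  linarith

/-- On the event that restricted convexity holds, the error is small in Frobenius norm. -/
theorem frobNorm_le_of_not_convexityFails [NeZero d] (hn : 0 < n) {a s u : ℝ}
    (hs : 0 < s) (hu : u ≤ n * s ^ 2 / 2) {b c : ℝ} {D : Matrix (Fin d) (Fin d) ℝ}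
    (hD : ∀ i j, |D i j| ≤ a) (hnuc : nuclearNorm D ≤ b * frobNorm D)
    (hsum : ∑ k, D (p k).1 (p k).2 ^ 2 ≤ n * c * frobNorm D)
    (hconv : ¬ ConvexityFails a (b * (s * d)) u p) :
    frobNorm D / d ≤ max s (2 * c * d) := by
  have hd : (0 : ℝ) < d := by exact_mod_cast Nat.pos_of_ne_zero (NeZero.ne d)
  have hn' : (0 : ℝ) < n := by exact_mod_cast hn
  by_cases hle : frobNorm D / d ≤ s
  · exact hle.trans (le_max_left _ _)
  refine le_max_of_le_right ?_
  have hlt : s * d < frobNorm D := (lt_div_iff₀ hd).1 (not_le.1 hle)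
  have hF : 0 < frobNorm D := (by positivity : 0 < s * d).trans hlt
  -- An error above the critical radius `s` is shrunk onto it. The entry bound survives, and the
  -- cone condition bounds the nuclear norm by `b * (s * d)`, so one class of matrices serves all
  -- scales.
  set t := s * d / frobNorm D with ht
  have ht0 : 0 < t := by positivity
  have ht1 : t ≤ 1 := (div_le_one hF).2 hlt.le
  have htF : t * frobNorm D = s * d := div_mul_cancel₀ _ hF.ne'
  have hnot := fun h => hconv ⟨t • D, h⟩
  rw [imp_false, not_and, not_and, not_le] at hnot
  have h1 := hnot (fun i j => by
    rw [Matrix.smul_apply, smul_eq_mul, abs_mul, abs_of_pos ht0]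
    exact (mul_le_of_le_one_left (abs_nonneg _) ht1).trans (hD i j)) (by
    refine (nuclearNorm_smul_le ht0.le D).trans ?_
    rw [← htF]
    linarith [mul_le_mul_of_nonneg_left hnuc ht0.le])
  rw [frobNorm_smul ht0.le, htF, mul_pow, mul_div_cancel_right₀ _ (by positivity)] at h1
  simp only [Matrix.smul_apply, smul_eq_mul, mul_pow, ← Finset.mul_sum] at h1
  have h2 : n * s ^ 2 / 2 ≤ t ^ 2 * (n * c * frobNorm D) := by
    linarith [mul_le_mul_of_nonneg_left hsum (sq_nonneg t)]
  have h3 : t ^ 2 * (n * c * frobNorm D) = n * (t * c * (s * d)) := by rw [← htF]; ring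
  rw [h3] at h2
  have h4 : s * s ≤ s * (2 * (t * c * d)) := by
    have := le_of_mul_le_mul_left
      (by linarith : (n : ℝ) * (s ^ 2 / 2) ≤ n * (t * c * (s * d))) hn'
    linarith
  have h5 : s ≤ 2 * (t * c * d) := le_of_mul_le_mul_left h4 hs
  have h6 : t * (frobNorm D / d) ≤ t * (2 * c * d) := by
    rw [← mul_div_assoc, htF, mul_div_cancel_right₀ _ hd.ne']
    linarith
  exact le_of_mul_le_mul_left h6 ht0

/-- The basic inequality with its quadratic term dropped and the error entries bounded by `2 * α`.
It requires no control of the noise matrix, which suits small samples. -/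
theorem IsEstimator.nuclearNorm_sub_le (h : IsEstimator α lam p y Θhat) (hΘ : maxNorm Θ ≤ α)
    (hn : 0 < n) :
    n * lam * (nuclearNorm Θhat - nuclearNorm Θ) ≤
      2 * α * ∑ k, |y k - Θ (p k).1 (p k).2| := by
  have hb := h.basic_inequality hΘ hn
  have hS : 0 ≤ ∑ k, (Θhat - Θ) (p k).1 (p k).2 ^ 2 := Finset.sum_nonneg fun k _ => sq_nonneg _
  have h1 : ∑ k, (y k - Θ (p k).1 (p k).2) * (Θhat - Θ) (p k).1 (p k).2 ≤
      2 * α * ∑ k, |y k - Θ (p k).1 (p k).2| := by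
    rw [Finset.mul_sum]
    refine Finset.sum_le_sum fun k _ => (le_abs_self _).trans ?_
    rw [abs_mul, mul_comm]
    exact mul_le_mul_of_nonneg_right (h.abs_sub_le hΘ _ _) (abs_nonneg _)
  linarith

end Deterministic

/-- The bad set quantifies over all minimizers and is not known to be measurable; the event is the
complement of its measurable hull, which has the same outer measure. -/
theorem exists_event_of_measure_le {Ω : Type*} [MeasurableSpace Ω] (μ : Measure Ω)
    [IsProbabilityMeasure μ] {q : ℝ} (hq : 0 ≤ q) {P : Ω → Prop}
    (h : μ {ω | ¬ P ω} ≤ ENNReal.ofReal q) :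
    ∃ E : Set Ω, MeasurableSet E ∧ 1 - q ≤ μ.real E ∧ ∀ ω ∈ E, P ω := by
  have hm := measurableSet_toMeasurable μ {ω | ¬ P ω}
  refine ⟨(toMeasurable μ {ω | ¬ P ω})ᶜ, hm.compl, ?_, fun ω hω => ?_⟩
  · rw [probReal_compl_eq_one_sub hm]
    have : μ.real (toMeasurable μ {ω | ¬ P ω}) ≤ q := by
      rw [Measure.real, measure_toMeasurable]
      exact ENNReal.toReal_le_of_le_ofReal hq h
    linarith
  · by_contra hP
    exact hω (subset_toMeasurable μ _ hP)

end QMC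

/-! ### Error bounds with high probability -/

namespace QMC

open Matrix

variable {d n : ℕ}

section Bounds

variable {Ω : Type*} [MeasurableSpace Ω] {μ : Measure Ω} {σ Δ : ℝ}
  {J : Fin n → Ω → Fin d × Fin d} {ε τ : Fin n → Ω → ℝ}

theorem IsModel.measure_convexityFails_le [NeZero d] (h : IsModel μ σ Δ J ε τ) {a ρ κ : ℝ}
    (ha : 0 < a) (hρ : 0 < ρ) (hκ0 : 0 < κ) (hκ : κ ≤ 1) (u : ℝ) :
    μ {ω | ConvexityFails a ρ u fun k => J k ω} ≤
      ENNReal.ofReal (2 * d * Real.exp (n * κ ^ 2 / d - κ / (4 * a * ρ) * u)) := by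
  classical
  have hd : (0 : ℝ) < d := by exact_mod_cast Nat.pos_of_ne_zero (NeZero.ne d)
  refine (h.measure_positions_le fun J => ConvexityFails a ρ u J).trans
    (ENNReal.ofReal_le_ofReal ?_)
  rw [div_le_iff₀ (by positivity), mul_comm]
  convert card_convexityFails_le (d := d) (n := n) ha hρ hκ0 hκ u

/-- The extra `2 * log d` in `M` pays for the dimensional factor, since `2 * d ≤ d²`. -/
theorem two_mul_dim_mul_exp_neg_le (hd : 2 ≤ d) {δ M : ℝ} (hM : (δ + 2) * Real.log d ≤ M) :
    2 * d * Real.exp (-M) ≤ (d : ℝ) ^ (-δ) := by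
  have hd' : (2 : ℝ) ≤ d := by exact_mod_cast hd
  have hd0 : (0 : ℝ) < d := by linarith
  rw [Real.rpow_def_of_pos hd0]
  have h1 : (2 * d : ℝ) ≤ Real.exp (2 * Real.log d) := by
    rw [mul_comm 2 (Real.log _), Real.exp_mul, Real.exp_log hd0]
    norm_cast
    nlinarith
  refine (mul_le_mul_of_nonneg_right h1 (Real.exp_pos _).le).trans ?_
  rw [← Real.exp_add]
  exact Real.exp_le_exp.2 (by linarith)

/-- The error bounds when the sample size is at least of order `d log d`. -/
theorem IsModel.measure_error_large_le [IsProbabilityMeasure μ]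
    (h : IsModel μ σ Δ J ε τ) (hd : 2 ≤ d) (hn : 0 < n) (hσ : 0 ≤ σ) (hΔ : 0 ≤ Δ) (hσΔ : 0 < σ + Δ) {α δ M lam : ℝ} {r : ℕ} (hr : 0 < r)
    {Θ : Matrix (Fin d) (Fin d) ℝ} (hrank : Θ.rank ≤ r) (hΘ : maxNorm Θ ≤ α)
    (hM : (δ + 2) * Real.log d ≤ M) (hM0 : 0 < M) (hnM : d * M ≤ n)
    (hlam : 72 * (σ + Δ) * √(d * M / n) ≤ lam * d) :
    μ {ω | ¬ ∀ Θhat : Matrix (Fin d) (Fin d) ℝ,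
        IsEstimator α lam (fun k => J k ω)
          (fun k => quantizedObs Δ Θ (J k ω) (ε k ω) (τ k ω)) Θhat →
        frobNorm (Θhat - Θ) / d ≤
            √r * max (200 * (α + σ + Δ) * √(d * M / n)) (9 * (lam * d)) ∧
        nuclearNorm (Θhat - Θ) / d ≤
            6 * r * max (200 * (α + σ + Δ) * √(d * M / n)) (9 * (lam * d))} ≤
      ENNReal.ofReal (2 * (d : ℝ) ^ (-δ)) := by
  have : NeZero d := ⟨by omega⟩
  have hd0 : (0 : ℝ) < d := by exact_mod_cast (by omega : 0 < d)
  have hn0 : (0 : ℝ) < n := by exact_mod_cast hn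
  have hr0 : (0 : ℝ) < r := by exact_mod_cast hr
  have hα : 0 ≤ α := (maxNorm_nonneg Θ).trans hΘ
  set L := α + σ + Δ with hL
  have hL0 : 0 < L := by linarith
  set Y := √(d * M / n) with hY
  have hY0 : 0 < Y := Real.sqrt_pos.2 (by positivity)
  have hYsq : Y ^ 2 = d * M / n := Real.sq_sqrt (by positivity)
  have hY1 : Y ≤ 1 := Real.sqrt_le_one.2 ((div_le_one hn0).2 hnM)
  have hMY : M = n * Y ^ 2 / d := by rw [hYsq]; field_simp
  have hlam0 : 0 < lam := by
    have : 0 < lam * d := lt_of_lt_of_le (by positivity) hlam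
    exact pos_of_mul_pos_left this hd0.le
  have hexp := two_mul_dim_mul_exp_neg_le hd hM
  -- With this `κ` the moment factor is at most `exp (8 * M)`, so level `9 * M` leaves `exp (-M)`.
  -- The requirement `κ ≤ 1 / 2` is exactly `Y ≤ 1`, that is `d * M ≤ n`. The resulting norm bound,
  -- `36 * (σ + Δ) * n * Y / d`, explains the constant `72` in the condition on `lam`.
  have hnoise := h.measure_noise_le hσ hΔ hσΔ Θ (κ := Y / 2) (by positivity) (by linarith) (9 * M)
  have hnoise' : (1 + 32 * (Y / 2) ^ 2 / d) ^ n * (2 * d) * Real.exp (-(9 * M)) ≤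
      (d : ℝ) ^ (-δ) := by
    refine le_trans ?_ hexp
    have h1 : (1 + 32 * (Y / 2) ^ 2 / d) ^ n ≤ Real.exp (8 * M) := by
      have h2 : 8 * M = n * (32 * (Y / 2) ^ 2 / d) := by rw [hMY]; ring
      rw [h2, Real.exp_nat_mul]
      refine pow_le_pow_left₀ (by positivity) ?_ n
      linarith [Real.add_one_le_exp (32 * (Y / 2) ^ 2 / d)]
    calc (1 + 32 * (Y / 2) ^ 2 / d) ^ n * (2 * d) * Real.exp (-(9 * M))
        ≤ Real.exp (8 * M) * (2 * d) * Real.exp (-(9 * M)) := by gcongr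
      _ = 2 * d * Real.exp (-M) := by
        rw [mul_comm (Real.exp (8 * M)), mul_assoc, ← Real.exp_add]
        ring_nf
  -- The critical radius, large enough that the allowed deviation `u` below is at most half of `n *
  -- s ^ 2`.
  set s := 200 * L * (√r * Y) with hs
  have hs0 : 0 < s := by positivity
  set b := 4 * √(2 * r) with hb
  have hb0 : 0 < b := by positivity
  have hsqrt2 : √(2 * r : ℝ) ≤ 3 / 2 * √r := by
    rw [Real.sqrt_mul (by norm_num)]
    refine mul_le_mul_of_nonneg_right (Real.sqrt_le_iff.2 ⟨by norm_num, by norm_num⟩)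
      (Real.sqrt_nonneg _)
  -- Taking `κ = Y`, this value makes the linear part of the exponent `2 * M` against the quadratic
  -- part `M`.
  set u := 8 * (2 * L) * (b * (s * d)) * (n * Y / d) with hu
  have hconv := h.measure_convexityFails_le (a := 2 * L) (ρ := b * (s * d)) (by positivity)
    (by positivity) hY0 hY1 u
  have hconv' : 2 * d * Real.exp (n * Y ^ 2 / d - Y / (4 * (2 * L) * (b * (s * d))) * u) ≤
      (d : ℝ) ^ (-δ) := by
    have h1 : Y / (4 * (2 * L) * (b * (s * d))) * u = 2 * M := by
      rw [hMY, hu]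
      field_simp
      ring
    rw [h1, ← hMY]
    convert hexp using 3
    ring
  have hus : u ≤ n * s ^ 2 / 2 := by
    have h1 : u = n * s * (64 * L * (√(2 * r) * Y)) := by
      rw [hu, hb]
      field_simp
      ring
    have h2 : n * s ^ 2 / 2 = n * s * (100 * L * (√r * Y)) := by rw [hs]; ring
    rw [h1, h2]
    refine mul_le_mul_of_nonneg_left ?_ (by positivity)
    have h3 := mul_le_mul_of_nonneg_left hsqrt2 (by positivity : 0 ≤ 64 * L * Y)
    have h4 : 0 ≤ L * Y * √r := by positivity
    linarith
  refine (measure_mono (t := {ω | ¬ OpLe (∑ k, noiseTerm Δ Θ (J k ω, ε k ω, τ k ω) •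
      design (J k ω)) (2 * (σ + Δ) / (Y / 2) * (9 * M))} ∪
      {ω | ConvexityFails (2 * L) (b * (s * d)) u fun k => J k ω}) ?_).trans ?_
  · intro ω hω
    by_contra hgood
    rw [Set.mem_union, not_or] at hgood
    obtain ⟨hg1, hg2⟩ := hgood
    simp only [Set.mem_ofPred_eq, not_not] at hg1 hg2
    refine hω fun Θhat hest => ?_
    have hop : OpLe (∑ k, (quantizedObs Δ Θ (J k ω) (ε k ω) (τ k ω) -
        Θ (J k ω).1 (J k ω).2) • design (J k ω)) (n * lam / 2) := by
      refine OpLe.mono ?_ hg1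
      have h1 : 2 * (σ + Δ) / (Y / 2) * (9 * M) = n / (2 * d) * (72 * (σ + Δ) * Y) := by
        rw [hMY]
        field_simp
        ring
      have h2 : n * lam / 2 = n / (2 * d) * (lam * d) := by field_simp
      rw [h1, h2]
      exact mul_le_mul_of_nonneg_left hlam (by positivity)
    obtain ⟨hc1, hc2⟩ := hest.error_cone hΘ hn hlam0 hrank hop
    have hF := frobNorm_le_of_not_convexityFails (p := fun k => J k ω) hn hs0 hus (b := b)
      (c := 3 * lam * √(2 * r)) (D := Θhat - Θ)
      (fun i j => (hest.abs_sub_le hΘ i j).trans (by linarith)) (by linarith) (by linarith) hg2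
    have hF' : frobNorm (Θhat - Θ) / d ≤ √r * max (200 * L * Y) (9 * (lam * d)) := by
      refine hF.trans (max_le ?_ ?_)
      · rw [hs]
        have := mul_le_mul_of_nonneg_left (le_max_left (200 * L * Y) (9 * (lam * d)))
          (Real.sqrt_nonneg r)
        linarith
      · have h1 := mul_le_mul_of_nonneg_left (le_max_right (200 * L * Y) (9 * (lam * d)))
          (Real.sqrt_nonneg r)
        have h2 := mul_le_mul_of_nonneg_left hsqrt2 (by positivity : 0 ≤ 6 * (lam * d))
        linarith
    refine ⟨hF', ?_⟩
    have h1 : nuclearNorm (Θhat - Θ) / d ≤ b * (frobNorm (Θhat - Θ) / d) := by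
      rw [← mul_div_assoc]
      exact div_le_div_of_nonneg_right (by linarith) hd0.le
    have h2 : b ≤ 6 * √r := by linarith
    refine h1.trans ((mul_le_mul h2 hF' (div_nonneg (frobNorm_nonneg _) hd0.le)
      (by positivity)).trans (le_of_eq ?_))
    rw [← mul_assoc, mul_assoc 6, Real.mul_self_sqrt hr0.le]
  · refine (measure_union_le _ _).trans ?_
    rw [two_mul ((d : ℝ) ^ (-δ)), ENNReal.ofReal_add (by positivity) (by positivity)]
    exact add_le_add (hnoise.trans (ENNReal.ofReal_le_ofReal hnoise'))
      (hconv.trans (ENNReal.ofReal_le_ofReal hconv'))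

/-- The error bounds when the sample size is at most of order `d log d`. -/
theorem IsModel.measure_error_small_le [IsProbabilityMeasure μ]
    (h : IsModel μ σ Δ J ε τ) (hd : 2 ≤ d) (hn : 0 < n) (hσ : 0 ≤ σ) (hΔ : 0 ≤ Δ) (hσΔ : 0 < σ + Δ) {α δ lam : ℝ} {r : ℕ}
    {Θ : Matrix (Fin d) (Fin d) ℝ} (hrank : Θ.rank ≤ r) (hΘ : maxNorm Θ ≤ α) (hlam : 0 < lam) :
    μ {ω | ¬ ∀ Θhat : Matrix (Fin d) (Fin d) ℝ,
        IsEstimator α lam (fun k => J k ω)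
          (fun k => quantizedObs Δ Θ (J k ω) (ε k ω) (τ k ω)) Θhat →
        frobNorm (Θhat - Θ) / d ≤ 2 * α ∧
        nuclearNorm (Θhat - Θ) / d ≤
            α * (2 * √r + 4 * (σ + Δ) / (lam * d) * (2 + δ * Real.log d / n))} ≤
      ENNReal.ofReal ((d : ℝ) ^ (-δ)) := by
  have : NeZero d := ⟨by omega⟩
  have hd0 : (0 : ℝ) < d := by exact_mod_cast (by omega : 0 < d)
  have hn0 : (0 : ℝ) < n := by exact_mod_cast hn
  have hα : 0 ≤ α := (maxNorm_nonneg Θ).trans hΘ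
  -- The term `2 * n` absorbs the moment factor `4 ^ n`, as `4 ≤ exp 2`; the rest is the tail `d ^
  -- (-δ)`.
  have hsum := h.measure_sum_abs_noise_le hσ hΔ hσΔ Θ (2 * n + δ * Real.log d)
  have hprob : (4 : ℝ) ^ n * Real.exp (-(2 * n + δ * Real.log d)) ≤ (d : ℝ) ^ (-δ) := by
    have h4 : (4 : ℝ) ≤ Real.exp 2 := by
      have h1 := Real.add_one_le_exp (1 : ℝ)
      have h2 : Real.exp 2 = Real.exp 1 * Real.exp 1 := by rw [← Real.exp_add]; norm_num
      rw [h2]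
      nlinarith
    have h5 : (4 : ℝ) ^ n ≤ Real.exp (2 * n) := by
      rw [mul_comm, Real.exp_nat_mul]
      exact pow_le_pow_left₀ (by norm_num) h4 n
    refine (mul_le_mul_of_nonneg_right h5 (Real.exp_pos _).le).trans (le_of_eq ?_)
    rw [← Real.exp_add, Real.rpow_def_of_pos hd0]
    ring_nf
  refine (measure_mono ?_).trans (hsum.trans (ENNReal.ofReal_le_ofReal hprob))
  intro ω hω
  by_contra hgood
  rw [Set.mem_ofPred_eq, not_lt, ← Finset.sum_div, div_le_iff₀ (by positivity)] at hgood
  refine hω fun Θhat hest => ⟨?_, ?_⟩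
  · rw [div_le_iff₀ hd0]
    exact frobNorm_le_of_abs_le (by positivity) fun i j => hest.abs_sub_le hΘ i j
  · have h1 := hest.nuclearNorm_sub_le hΘ hn
    have h2 := nuclearNorm_sub_le Θhat Θ
    have h3 : nuclearNorm Θ ≤ √r * (α * d) :=
      (nuclearNorm_le_sqrt_rank Θ).trans (mul_le_mul (Real.sqrt_le_sqrt (by exact_mod_cast hrank))
        (frobNorm_le_of_abs_le hα fun i j => (abs_apply_le_maxNorm Θ i j).trans hΘ)
        (frobNorm_nonneg _) (Real.sqrt_nonneg _))
    have h4 := h1.trans (mul_le_mul_of_nonneg_left hgood (by positivity : 0 ≤ 2 * α))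
    have h5 : nuclearNorm Θhat - nuclearNorm Θ ≤
        2 * α * ((2 * n + δ * Real.log d) * (2 * (σ + Δ))) / (n * lam) := by
      rw [le_div_iff₀ (by positivity), mul_comm]
      exact h4
    rw [div_le_iff₀ hd0]
    have h6 : α * (2 * √r + 4 * (σ + Δ) / (lam * d) * (2 + δ * Real.log d / n)) * d =
        2 * (√r * (α * d)) + 2 * α * ((2 * n + δ * Real.log d) * (2 * (σ + Δ))) / (n * lam) := by
      field_simp
      ring
    rw [h6]
    linarith

end Bounds

end QMC

/-! ### Main theorem -/

namespace QMC

/-- Here `C * t * X` stands for `lam * d`. Since `X` is at least `1 / √B`, both a constant and `1 /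
X` are at most `B * X`, and `x / X ≤ X`; this turns the crude bound into one of the required rate.
-/
theorem small_sample_bound {t X B C x r : ℝ} (ht : 0 < t) (hX : 0 < X) (hB : 1 ≤ B) (hC : 1 ≤ C)
    (hBX : 1 ≤ √B * X) (hx : x ≤ X ^ 2) (hr : 1 ≤ r) :
    2 * √r + 4 * t / (C * t * X) * (2 + x) ≤ 14 * B * X * r := by
  have hsB : √B ≤ B := (Real.sqrt_le_left (by linarith)).2 (by nlinarith)
  have hsr : √r ≤ r := (Real.sqrt_le_left (by linarith)).2 (by nlinarith)
  have h1 : 4 * t / (C * t * X) * (2 + x) ≤ (8 * B + 4) * X := by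
    have h2 : 4 * t / (C * t * X) = 4 / (C * X) := by field_simp
    rw [h2, div_mul_eq_mul_div, div_le_iff₀ (by positivity)]
    have h3 : 1 ≤ B * X ^ 2 := by
      have := one_le_pow₀ hBX (n := 2)
      rwa [mul_pow, Real.sq_sqrt (by linarith)] at this
    have h4 : 4 * ((2 * B + 1) * X ^ 2) ≤ 4 * ((2 * B + 1) * X ^ 2) * C :=
      le_mul_of_one_le_right (by positivity) hC
    linarith
  have h5 : r ≤ B * X * r :=
    le_mul_of_one_le_left (by linarith) (hBX.trans (mul_le_mul_of_nonneg_right hsB hX.le))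
  have h6 : (8 * B + 4) * X ≤ 12 * B * X := mul_le_mul_of_nonneg_right (by linarith) hX.le
  have h7 : 12 * B * X ≤ 12 * B * X * r := le_mul_of_one_le_right (by positivity) hr
  linarith

end QMC

theorem theorem3p6 :
    ∀ δ₀ : ℝ, 0 < δ₀ → ∃ C₀ : ℝ, 0 < C₀ ∧ ∀ C₁ : ℝ, C₀ ≤ C₁ →
    ∀ c K : ℝ, 0 < c → 0 < K → ∃ C₂ C₃ : ℝ, 0 < C₂ ∧ 0 < C₃ ∧
    ∀ (d n r : ℕ) (δ α σ Δ : ℝ), 1 ≤ d → δ₀ ≤ δ → 0 ≤ σ → 0 ≤ Δ → 0 < σ + Δ →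
    c * ((d : ℝ) * Real.log d ^ 3) ≤ (n : ℝ) →
    (n : ℝ) ≤ K * ((r : ℝ) ^ 2 * (d : ℝ) ^ 2 * Real.log d) →
    ∀ Θstar : Matrix (Fin d) (Fin d) ℝ, Θstar.rank ≤ r → QMC.maxNorm Θstar ≤ α →
    ∀ {Ω : Type*} [MeasurableSpace Ω] (μ : Measure Ω) [IsProbabilityMeasure μ]
      (J : Fin n → Ω → Fin d × Fin d) (ε τ : Fin n → Ω → ℝ),
    QMC.IsModel μ σ Δ J ε τ →
    ∃ E : Set Ω, MeasurableSet E ∧ 1 - 4 * (d : ℝ) ^ (-δ) ≤ μ.real E ∧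
      ∀ ω ∈ E, ∀ Θhat : Matrix (Fin d) (Fin d) ℝ,
        QMC.IsEstimator α (C₁ * (σ + Δ) * √(δ * Real.log d / (n * d)))
          (fun k => J k ω)
          (fun k => QMC.quantizedObs Δ Θstar (J k ω) (ε k ω) (τ k ω)) Θhat →
        QMC.frobNorm (Θhat - Θstar) / d
            ≤ C₂ * (α + σ + Δ) * √(δ * r * d * Real.log d / n) ∧
        QMC.nuclearNorm (Θhat - Θstar) / d
            ≤ C₃ * (α + σ + Δ) * r * √(δ * d * Real.log d / n) := by
  intro δ₀ hδ₀
  -- This makes `δ + 2 ≤ B * δ` for all `δ ≥ δ₀`, so the union bound over dimensions is absorbed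
  -- into `δ * log d`.
  set B : ℝ := 1 + 2 / δ₀ with hB
  have hB1 : 1 ≤ B := by
    have : 0 < 2 / δ₀ := by positivity
    linarith
  have hsB1 : 1 ≤ √B := Real.one_le_sqrt.2 hB1
  refine ⟨72 * √B, by positivity, fun C₁ hC₁ c K hc hK => ?_⟩
  have hC₁1 : 1 ≤ C₁ := by linarith
  -- The first constant bounds the maximum in the large-sample estimate and also dominates the
  -- trivial bound for small samples. In the second, `6` times it serves large samples and `14 * B`
  -- small ones.
  refine ⟨200 * √B + 9 * C₁, 6 * (200 * √B + 9 * C₁) + 14 * B, by positivity, by positivity, ?_⟩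
  intro d n r δ α σ Δ hd1 hδ hσ hΔ hσΔ hnlow hnup Θ hrank hΘ Ω _ μ _ J ε τ h
  have hδ0 : 0 < δ := hδ₀.trans_le hδ
  rcases eq_or_lt_of_le hd1 with hd | hd
  -- For `d = 1` the promised probability `1 - 4` is negative, so the empty event qualifies.
  · refine ⟨∅, MeasurableSet.empty, ?_, fun ω hω => absurd hω (Set.notMem_empty ω)⟩
    rw [← hd]
    norm_num
  have hd2 : (2 : ℝ) ≤ d := by exact_mod_cast hd
  have hd0 : (0 : ℝ) < d := by linarith
  have hlog : 0 < Real.log d := Real.log_pos (by linarith)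
  have hn0 : (0 : ℝ) < n := lt_of_lt_of_le (by positivity) hnlow
  have hn : 0 < n := by exact_mod_cast hn0
  -- If `r` were zero, the upper bound on the sample size would force `n = 0`, which the lower bound
  -- excludes.
  have hr : 0 < r := by
    refine Nat.pos_of_ne_zero fun hr => ?_
    rw [hr] at hnup
    norm_num at hnup
    omega
  have hr1 : (1 : ℝ) ≤ r := by exact_mod_cast hr
  have hsr1 : 1 ≤ √(r : ℝ) := Real.one_le_sqrt.2 hr1
  have hα : 0 ≤ α := (QMC.maxNorm_nonneg Θ).trans hΘ
  set L := α + σ + Δ with hL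
  have hL0 : 0 < L := by linarith
  have hαL : α ≤ L := by linarith
  set X := √(δ * d * Real.log d / n) with hX
  have hX0 : 0 < X := Real.sqrt_pos.2 (by positivity)
  have hXsq : X ^ 2 = δ * d * Real.log d / n := Real.sq_sqrt (by positivity)
  have hrX : √(δ * r * d * Real.log d / n) = √r * X := by
    rw [hX, ← Real.sqrt_mul (by linarith)]
    ring_nf
  set lam := C₁ * (σ + Δ) * √(δ * Real.log d / (n * d)) with hlam
  have hlamd : lam * d = C₁ * (σ + Δ) * X := by
    have h1 : √(δ * Real.log d / (n * d)) * d = X := by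
      rw [← sq_eq_sq₀ (by positivity) hX0.le, mul_pow, hXsq, Real.sq_sqrt (by positivity)]
      field_simp
    rw [hlam, mul_assoc, h1]
  have hlam0 : 0 < lam := by positivity
  have hprob0 : 0 ≤ (d : ℝ) ^ (-δ) := by positivity
  rw [hrX]
  have hM : (δ + 2) * Real.log d ≤ B * (δ * Real.log d) := by
    have h1 : 2 ≤ 2 / δ₀ * δ := by
      rw [div_mul_eq_mul_div, le_div_iff₀ hδ₀]
      linarith
    have h2 : δ + 2 ≤ B * δ := by rw [hB]; linarith
    rw [← mul_assoc]
    exact mul_le_mul_of_nonneg_right h2 hlog.le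
  have hY : √(d * (B * (δ * Real.log d)) / n) = √B * X := by
    rw [hX, ← Real.sqrt_mul (by linarith)]
    ring_nf
  refine QMC.exists_event_of_measure_le μ (by positivity) ?_
  -- The split is at `√B * X = 1`: on one side the exponential moment parameter is admissible, on
  -- the other the target rate is bounded below.
  rcases le_or_gt (d * (B * (δ * Real.log d))) (n : ℝ) with hcase | hcase
  · have key := h.measure_error_large_le hd hn hσ hΔ hσΔ hr hrank hΘ hM (by positivity) hcase
      (lam := lam) (by
        rw [hY, hlamd]
        have := mul_le_mul_of_nonneg_right hC₁ (by positivity : 0 ≤ (σ + Δ) * X)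
        linarith)
    rw [hY, hlamd, ← hL] at key
    have hmax : max (200 * L * (√B * X)) (9 * (C₁ * (σ + Δ) * X)) ≤
        (200 * √B + 9 * C₁) * L * X := by
      have h1 : 0 ≤ √B * (L * X) := by positivity
      have h2 : 0 ≤ C₁ * (L * X) := by positivity
      have h3 : C₁ * X * (σ + Δ) ≤ C₁ * X * L :=
        mul_le_mul_of_nonneg_left (by linarith) (by positivity)
      exact max_le (by linarith) (by linarith)
    refine (measure_mono fun ω hω => ?_).trans
      (key.trans (ENNReal.ofReal_le_ofReal (by linarith)))
    refine fun hgood => hω fun Θhat hest => ?_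
    obtain ⟨h1, h2⟩ := hgood Θhat hest
    refine ⟨?_, ?_⟩
    · have := mul_le_mul_of_nonneg_left hmax (Real.sqrt_nonneg r)
      linarith
    · have h3 := mul_le_mul_of_nonneg_left hmax (by positivity : (0 : ℝ) ≤ 6 * r)
      have h4 : 0 ≤ 14 * B * (L * r * X) := by positivity
      linarith
  · have key := h.measure_error_small_le hd hn hσ hΔ hσΔ (δ := δ) hrank hΘ hlam0
    have hBX : 1 ≤ √B * X := by
      rw [← hY, Real.one_le_sqrt, one_le_div hn0]
      exact hcase.le
    refine (measure_mono fun ω hω => ?_).trans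
      (key.trans (ENNReal.ofReal_le_ofReal (by linarith)))
    refine fun hgood => hω fun Θhat hest => ?_
    obtain ⟨h1, h2⟩ := hgood Θhat hest
    refine ⟨h1.trans ?_, h2.trans ?_⟩
    · have h3 : 2 * α ≤ 2 * L * (√B * X) :=
        (by linarith : 2 * α ≤ 2 * L).trans (le_mul_of_one_le_right (by positivity) hBX)
      have h4 : 2 * L * (√B * X) ≤ 2 * L * (√B * X) * √r :=
        le_mul_of_one_le_right (by positivity) hsr1
      have h5 : 0 ≤ (198 * √B + 9 * C₁) * L * (√r * X) := by positivity
      linarith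
    · have hlogn : δ * Real.log d / n ≤ X ^ 2 := by
        rw [hXsq]
        refine div_le_div_of_nonneg_right ?_ hn0.le
        exact mul_le_mul_of_nonneg_right (le_mul_of_one_le_right hδ0.le (by linarith)) hlog.le
      have h3 := QMC.small_sample_bound hσΔ hX0 hB1 hC₁1 hBX hlogn hr1
      rw [← hlamd] at h3
      have h6 : α * (2 * √r + 4 * (σ + Δ) / (lam * d) * (2 + δ * Real.log d / n)) ≤
          L * (14 * B * X * r) :=
        mul_le_mul hαL h3 (by positivity) hL0.le
      have h4 : 0 ≤ 6 * (200 * √B + 9 * C₁) * (L * r * X) := by positivity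
      linarith
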